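/- Let $\mathcal A$ be a finite set of names, $\overline{\mathcal A}=\{\overline a: a\in\mathcal A\}$ a disjoint copy of it (the co-names, with $\overline{\overline a}=a$), and $\mathcal A_\tau=\mathcal A\cup\overline{\mathcal A}\cup\{\tau\}$. CCS terms over a countably infinite set of variables are given by $$t ::= \mathbf 0 \mid x \mid \mu.t \mid t+t \mid t\parallel t \qquad (\mu\in\mathcal A_\tau).$$ The transitions of closed terms are those provable from the rules: $\mu.p\xrightarrow{\mu}p$; if $p\xrightarrow{\mu}p'$ then $p+q\xrightarrow{\mu}p'$, $q+p\xrightarrow{\mu}p'$, $p\parallel q\xrightarrow{\mu}p'\parallel q$ and $q\parallel p\xrightarrow{\mu}q\parallel p'$; if $p\xrightarrow{\alpha}p'$ and $q\xrightarrow{\overline\alpha}q'$ with $\alpha\in\mathcal A\cup\overline{\mathcal A}$ then $p\parallel q\xrightarrow{\tau}p'\parallel q'$. Let $\mathrm{init}(p)=\{\mu : p\xrightarrow{\mu}\}$. The equivalences on closed terms are the following (all actions, including $\tau$, are observable). A simulation is a relation $R$ such that $p\,R\,q$ and $p\xrightarrow{\mu}p'$ imply $q\xrightarrow{\mu}q'$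 and $p'\,R\,q'$ for some $q'$; it is a completed simulation if moreover $p\,R\,q$ implies ($\mathrm{init}(p)=\emptyset\Leftrightarrow\mathrm{init}(q)=\emptyset$), and a ready simulation if moreover $p\,R\,q$ implies $\mathrm{init}(p)=\mathrm{init}(q)$. Then $p\sim_{\mathtt S}q$ (resp. $p\sim_{\mathtt{CS}}q$, $p\sim_{\mathtt{RS}}q$) if $p\,R\,q$ and $q\,R'\,p$ for some simulations (resp. completed, ready simulations) $R,R'$. The relations $\sim_{\mathtt T},\sim_{\mathtt R},\sim_{\mathtt F},\sim_{\mathtt{RT}},\sim_{\mathtt{FT}}$ are equality of the sets of, respectively, traces $\varphi$ ($p\xrightarrow{\varphi}p'$ for some $p'$); ready pairs $(\varphi,X)$ ($p\xrightarrow{\varphi}p'$, $\mathrm{init}(p')=X$); failure pairs $(\varphi,X)$ ($p\xrightarrow{\varphi}p'$, $\mathrm{init}(p')\cap X=\emptyset$); ready traces, and failure traces, $X_0\mu_1X_1\cdots\mu_nX_n$ ($p=p_0\xrightarrow{\mu_1}p_1\cdots\xrightarrow{\mu_n}p_n$ with $\mathrm{init}(p_i)=X_i$, resp. $\mathrm{init}(p_i)\cap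 X_i=\emptyset$, for all $i$). And $p\sim_{\mathtt{CT}}q$ if $p$ and $q$ have the same traces and the same completed traces ($p\xrightarrow{\varphi}p'$ with $\mathrm{init}(p')=\emptyset$). In the following axiom schemata the action metavariables $\mu,\nu,\xi,\zeta,\mu_i,\nu_j$ range over $\mathcal A_\tau$; "$\mu=\overline\nu$" means that $\mu,\nu\ne\tau$ are complementary; prefixing binds tighter than $\parallel$, which binds tighter than $+$; empty sums are $\mathbf 0$. - $\mathcal E_1$: $x+\mathbf 0\approx x$; $x+y\approx y+x$; $(x+y)+z\approx x+(y+z)$; $x+x\approx x$; $x\parallel\mathbf 0\approx x$; $x\parallel y\approx y\parallel x$. - EL1: $\mu x\parallel\nu y\approx\mu(x\parallel\nu y)+\nu(\mu x\parallel y)$ if not $\mu=\overline\nu$; $\mu x\parallel\nu y\approx\mu(x\parallel\nu y)+\nu(\mu x\parallel y)+\tau(x\parallel y)$ if $\mu=\overline\nu$. - EL2: $P\parallel Q\approx\sum_{i\in I}\mu_i(x_i\parallel Q)+\sum_{j\in J}\nu_j(P\parallel y_j)+\sum_{i\in I,j\in J,\mu_i=\overline{\nu_j}}\tau(x_i\parallel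 y_j)$ where $P=\sum_{i\in I}\mu_ix_i$, $Q=\sum_{j\in J}\nu_jy_j$, the $\mu_i$ are pairwise distinct, and so are the $\nu_j$. - RS: $\mu(\nu x+\nu y+z)\approx\mu(\nu x+\nu y+z)+\mu(\nu x+z)$. - RSP1: $(\mu x+\mu y+u)\parallel(\nu z+\nu w+v)\approx(\mu x+u)\parallel(\nu z+\nu w+v)+(\mu y+u)\parallel(\nu z+\nu w+v)+(\mu x+\mu y+u)\parallel(\nu z+v)+(\mu x+\mu y+u)\parallel(\nu w+v)$. - RSP2: $P\parallel(\nu y+\nu z+w)\approx P\parallel(\nu y+w)+P\parallel(\nu z+w)+\sum_{i\in I}\mu_i(x_i\parallel(\nu y+\nu z+w))$ where $P=\sum_{i\in I}\mu_ix_i$ with pairwise distinct $\mu_i$. - CS: $\mu(\nu x+y+z)\approx\mu(\nu x+y+z)+\mu(\nu x+z)$. - CSP1: $(\mu x+\nu y+u)\parallel(\xi z+\zeta w+v)\approx(\mu x+u)\parallel(\xi z+\zeta w+v)+(\nu y+u)\parallel(\xi z+\zeta w+v)+(\mu x+\nu y+u)\parallel(\xi z+v)+(\mu x+\nu y+u)\parallel(\zeta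 w+v)$. - CSP2: $\mu x\parallel(\nu y+\xi z+w)\approx\mu(x\parallel(\nu y+\xi z+w))+\mu x\parallel(\nu y+w)+\mu x\parallel(\xi z+w)$. - S: $\mu(x+y)\approx\mu(x+y)+\mu x$. - SP1: $(x+y)\parallel(z+w)\approx x\parallel(z+w)+y\parallel(z+w)+(x+y)\parallel z+(x+y)\parallel w$. - SP2: $\mu x\parallel(y+z)\approx\mu(x\parallel(y+z))+\mu x\parallel y+\mu x\parallel z$. - RT: $\mu\big(\sum_{i=1}^{n}(\nu_ix_i+\nu_iy_i)+z\big)\approx\mu\big(\sum_{i=1}^{n}\nu_ix_i+z\big)+\mu\big(\sum_{i=1}^{n}\nu_iy_i+z\big)$ with $n=|\mathcal A_\tau|$ and $\nu_1,\dots,\nu_n$ not necessarily distinct. - FP: $(\mu x+\mu y+w)\parallel z\approx(\mu x+w)\parallel z+(\mu y+w)\parallel z$. - FT: $\mu x+\mu y\approx\mu x+\mu y+\mu(x+y)$. - R: $\mu(\nu x+z)+\mu(\nu y+w)\approx\mu(\nu x+\nu y+z)+\mu(\nu y+w)$. - F: $\mu x+\mu(y+z)\approx\mu x+\mu(x+y)+\mu(y+z)$.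 - CT: $\mu(\nu x+z)+\mu(\xi y+w)\approx\mu(\nu x+\xi y+z+w)$. - CTP: $(\mu x+\nu y+w)\parallel z\approx(\mu x+w)\parallel z+(\nu y+w)\parallel z$. - T: $\mu x+\mu y\approx\mu(x+y)$. - TP: $(x+y)\parallel z\approx x\parallel z+y\parallel z$. Put $\mathcal E_{\mathtt{RS}}=\mathcal E_1\cup\{\mathrm{RS,RSP1,RSP2,EL2}\}$, $\mathcal E_{\mathtt{CS}}=\mathcal E_1\cup\{\mathrm{CS,CSP1,CSP2,EL1}\}$, $\mathcal E_{\mathtt S}=\mathcal E_1\cup\{\mathrm{S,SP1,SP2,EL1}\}$, $\mathcal E_{\mathtt{RT}}=\mathcal E_1\cup\{\mathrm{RT,FP,EL2}\}$, $\mathcal E_{\mathtt{FT}}=\mathcal E_1\cup\{\mathrm{FT,RS,FP,EL2}\}$, $\mathcal E_{\mathtt R}=\mathcal E_1\cup\{\mathrm{R,FP,EL2}\}$, $\mathcal E_{\mathtt F}=\mathcal E_1\cup\{\mathrm{F,R,FP,EL2}\}$, $\mathcal E_{\mathtt{CT}}=\mathcal E_1\cup\{\mathrm{CT,CTP,EL1}\}$,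 $\mathcal E_{\mathtt T}=\mathcal E_1\cup\{\mathrm{T,TP,EL1}\}$, each schema standing for all its instances. **Theorem.** Let $\mathtt X\in\{\mathtt{RS},\mathtt{CS},\mathtt S,\mathtt{RT},\mathtt{FT},\mathtt R,\mathtt F,\mathtt{CT},\mathtt T\}$. The axiom system $\mathcal E_{\mathtt X}$ is finite, and it is sound and ground-complete modulo $\sim_{\mathtt X}$ over CCS: for every equation $t\approx u$ in $\mathcal E_{\mathtt X}$ and every closed substitution $\sigma$ we have $\sigma(t)\sim_{\mathtt X}\sigma(u)$, and whenever closed CCS terms $p,q$ satisfy $p\sim_{\mathtt X}q$, the equation $p\approx q$ is derivable from $\mathcal E_{\mathtt X}$ by the rules of equational logic (reflexivity, symmetry, transitivity, substitution, congruence). -/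

import Mathlib

/-! ## Behavioural equivalences on a labelled transition system `tr : P → L → P → Prop` -/

namespace LTS

universe u v
variable {P : Type u} {L : Type v}

/-- The initials of a process. -/
def init (tr : P → L → P → Prop) (p : P) : Set L := {a | ∃ p', tr p a p'}

/-- `Steps tr p φ p'`: `p` reaches `p'` by performing the sequence of actions `φ`. -/
def Steps (tr : P → L → P → Prop) : P → List L → P → Prop
  | p, [], p' => p = p'
  | p, a :: φ, p' => ∃ r, tr p a r ∧ Steps tr r φ p'

def IsSimulation (tr : P → L → P → Prop) (R : P → P → Prop) : Prop :=
  ∀ p q, R p q → ∀ a p', tr p a p' → ∃ q', tr q a q' ∧ R p' q'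

/-- A completed simulation relates a deadlocked process only to deadlocked processes,
and a process that is not deadlocked only to processes that are not deadlocked. -/
def IsCompletedSimulation (tr : P → L → P → Prop) (R : P → P → Prop) : Prop :=
  IsSimulation tr R ∧ ∀ p q, R p q → (init tr p = ∅ ↔ init tr q = ∅)

def IsReadySimulation (tr : P → L → P → Prop) (R : P → P → Prop) : Prop :=
  IsSimulation tr R ∧ ∀ p q, R p q → init tr p = init tr q

/-- Simulation equivalence. -/
def SimEquiv (tr : P → L → P → Prop) (p q : P) : Prop :=
  (∃ R, IsSimulation tr R ∧ R p q) ∧ (∃ R, IsSimulation tr R ∧ R q p)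

/-- Completed simulation equivalence. -/
def CompletedSimEquiv (tr : P → L → P → Prop) (p q : P) : Prop :=
  (∃ R, IsCompletedSimulation tr R ∧ R p q) ∧ (∃ R, IsCompletedSimulation tr R ∧ R q p)

/-- Ready simulation equivalence. -/
def ReadySimEquiv (tr : P → L → P → Prop) (p q : P) : Prop :=
  (∃ R, IsReadySimulation tr R ∧ R p q) ∧ (∃ R, IsReadySimulation tr R ∧ R q p)

/-- The traces of a process. -/
def traces (tr : P → L → P → Prop) (p : P) : Set (List L) :=
  {φ | ∃ p', Steps tr p φ p'}

/-- The completed traces of a process: the traces that lead to a deadlocked process. -/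
def completedTraces (tr : P → L → P → Prop) (p : P) : Set (List L) :=
  {φ | ∃ p', Steps tr p φ p' ∧ init tr p' = ∅}

/-- The ready pairs of a process. -/
def readies (tr : P → L → P → Prop) (p : P) : Set (List L × Set L) :=
  {φX | ∃ p', Steps tr p φX.1 p' ∧ init tr p' = φX.2}

/-- The failure pairs of a process. -/
def failures (tr : P → L → P → Prop) (p : P) : Set (List L × Set L) :=
  {φX | ∃ p', Steps tr p φX.1 p' ∧ init tr p' ∩ φX.2 = ∅}

/-- `IsReadyTrace tr p X₀ [(a₁, X₁), …, (aₙ, Xₙ)]`: `X₀ a₁ X₁ … aₙ Xₙ` is a ready trace of `p`,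
i.e. `p = p₀` performs `a₁ … aₙ` through `p₁, …, pₙ` with `init pᵢ = Xᵢ` for all `i`. -/
def IsReadyTrace (tr : P → L → P → Prop) : P → Set L → List (L × Set L) → Prop
  | p, X, [] => init tr p = X
  | p, X, (a, Y) :: φ => init tr p = X ∧ ∃ p', tr p a p' ∧ IsReadyTrace tr p' Y φ

/-- `IsFailureTrace tr p X₀ [(a₁, X₁), …, (aₙ, Xₙ)]`: `X₀ a₁ X₁ … aₙ Xₙ` is a failure trace
of `p`, i.e. `p = p₀` performs `a₁ … aₙ` through `p₁, …, pₙ` with `init pᵢ ∩ Xᵢ = ∅`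
for all `i`. -/
def IsFailureTrace (tr : P → L → P → Prop) : P → Set L → List (L × Set L) → Prop
  | p, X, [] => init tr p ∩ X = ∅
  | p, X, (a, Y) :: φ => init tr p ∩ X = ∅ ∧ ∃ p', tr p a p' ∧ IsFailureTrace tr p' Y φ

/-- The ready traces of a process. -/
def readyTraces (tr : P → L → P → Prop) (p : P) : Set (Set L × List (L × Set L)) :=
  {φ | IsReadyTrace tr p φ.1 φ.2}

/-- The failure traces of a process. -/
def failureTraces (tr : P → L → P → Prop) (p : P) : Set (Set L × List (L × Set L)) :=
  {φ | IsFailureTrace tr p φ.1 φ.2}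

end LTS

/-- The nine semantics: ready simulation, completed simulation, simulation, ready trace,
failure trace, readies, failures, completed trace, trace. -/
inductive Semantics : Type
  | RS | CS | S | RT | FT | R | F | CT | T

/-- The equivalence `∼_X` on the states of a labelled transition system. -/
def Semantics.Equiv {P : Type*} {L : Type*} (tr : P → L → P → Prop) :
    Semantics → P → P → Prop
  | .RS, p, q => LTS.ReadySimEquiv tr p q
  | .CS, p, q => LTS.CompletedSimEquiv tr p q
  | .S, p, q => LTS.SimEquiv tr p q
  | .RT, p, q => LTS.readyTraces tr p = LTS.readyTraces tr q
  | .FT, p, q => LTS.failureTraces tr p = LTS.failureTraces tr q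
  | .R, p, q => LTS.readies tr p = LTS.readies tr q
  | .F, p, q => LTS.failures tr p = LTS.failures tr q
  | .CT, p, q =>
      LTS.traces tr p = LTS.traces tr q ∧ LTS.completedTraces tr p = LTS.completedTraces tr q
  | .T, p, q => LTS.traces tr p = LTS.traces tr q

/-! ## The language CCS -/

namespace CCS

universe u

/-- Actions over a set `A` of names: names, co-names, and `τ`. -/
inductive Act (A : Type u) : Type u
  | tau : Act A
  | name (a : A) : Act A
  | coname (a : A) : Act A

/-- `Compl μ ν`: `μ` and `ν` are complementary visible actions, i.e. `μ = ν̄`. -/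
inductive Act.Compl {A : Type u} : Act A → Act A → Prop
  | name_coname (a : A) : Act.Compl (.name a) (.coname a)
  | coname_name (a : A) : Act.Compl (.coname a) (.name a)

/-- CCS terms without recursion, restriction and relabelling; the variables are indexed by `ℕ`. -/
inductive Term (A : Type u) : Type u
  | nil : Term A
  | var (n : ℕ) : Term A
  | pre (μ : Act A) (t : Term A) : Term A
  | plus (t u : Term A) : Term A
  | par (t u : Term A) : Term A

namespace Term

variable {A : Type u}

instance : Zero (Term A) := ⟨nil⟩
instance : Add (Term A) := ⟨plus⟩

/-- A term is closed if it contains no variables. -/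
def Closed : Term A → Prop
  | nil => True
  | var _ => False
  | pre _ t => t.Closed
  | plus t u => t.Closed ∧ u.Closed
  | par t u => t.Closed ∧ u.Closed

/-- Application of a substitution. -/
def subst (σ : ℕ → Term A) : Term A → Term A
  | nil => nil
  | var n => σ n
  | pre μ t => pre μ (t.subst σ)
  | plus t u => plus (t.subst σ) (u.subst σ)
  | par t u => par (t.subst σ) (u.subst σ)

/-- `t₁ + ⋯ + tₖ`; the empty sum is `0`. -/
def sum : List (Term A) → Term A
  | [] => 0
  | [t] => t
  | t :: u :: l => t + sum (u :: l)

/-- `∑_{i < k} t i`. -/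
def finSum {k : ℕ} (t : Fin k → Term A) : Term A := sum (List.ofFn t)

theorem closed_subst {σ : ℕ → Term A} (hσ : ∀ n, (σ n).Closed) (t : Term A) :
    (t.subst σ).Closed := by
  induction t with
  | nil => trivial
  | var n => exact hσ n
  | pre μ t ih => exact ih
  | plus t u iht ihu => exact ⟨iht, ihu⟩
  | par t u iht ihu => exact ⟨iht, ihu⟩

end Term

/-- The transitions provable from the SOS rules of CCS. -/
inductive Step {A : Type u} : Term A → Act A → Term A → Prop
  | pre (μ : Act A) (t : Term A) : Step (.pre μ t) μ t
  | plus_left {t t' u : Term A} {μ : Act A} : Step t μ t' → Step (.plus t u) μ t'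
  | plus_right {t u u' : Term A} {μ : Act A} : Step u μ u' → Step (.plus t u) μ u'
  | par_left {t t' u : Term A} {μ : Act A} : Step t μ t' → Step (.par t u) μ (.par t' u)
  | par_right {t u u' : Term A} {μ : Act A} : Step u μ u' → Step (.par t u) μ (.par t u')
  | comm {t t' u u' : Term A} {α β : Act A} : Act.Compl α β → Step t α t' → Step u β u' →
      Step (.par t u) .tau (.par t' u')

/-- Processes are the closed terms. -/
def Proc (A : Type u) : Type u := {t : Term A // t.Closed}

/-- The transition relation of the LTS of CCS processes. -/
def Proc.tr {A : Type u} (p : Proc A) (μ : Act A) (p' : Proc A) : Prop := Step p.1 μ p'.1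

/-- The process obtained from a term by a closed substitution. -/
def Term.close {A : Type u} (σ : ℕ → Proc A) (t : Term A) : Proc A :=
  ⟨t.subst fun n => (σ n).1, Term.closed_subst (fun n => (σ n).2) t⟩

/-! ## Equational logic -/

/-- An equation `lhs ≈ rhs` between CCS terms. -/
structure Equation (A : Type u) : Type u where
  lhs : Term A
  rhs : Term A

/-- `Derivable E t u`: the equation `t ≈ u` can be inferred from the axiom system `E` with the
rules of equational logic. -/
inductive Derivable {A : Type u} (E : Set (Equation A)) : Term A → Term A → Prop
  | ax {e : Equation A} : e ∈ E → Derivable E e.lhs e.rhs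
  | refl (t : Term A) : Derivable E t t
  | symm {t u : Term A} : Derivable E t u → Derivable E u t
  | trans {t u v : Term A} : Derivable E t u → Derivable E u v → Derivable E t v
  | subst {t u : Term A} (σ : ℕ → Term A) : Derivable E t u →
      Derivable E (t.subst σ) (u.subst σ)
  | pre {t u : Term A} (μ : Act A) : Derivable E t u → Derivable E (.pre μ t) (.pre μ u)
  | plus {t u t' u' : Term A} : Derivable E t u → Derivable E t' u' →
      Derivable E (.plus t t') (.plus u u')
  | par {t u t' u' : Term A} : Derivable E t u → Derivable E t' u' →
      Derivable E (.par t t') (.par u u')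

/-- `E` is sound modulo `r`: all closed instances of its equations hold modulo `r`. -/
def Sound {A : Type u} (E : Set (Equation A)) (r : Proc A → Proc A → Prop) : Prop :=
  ∀ e ∈ E, ∀ σ : ℕ → Proc A, r (e.lhs.close σ) (e.rhs.close σ)

/-- `E` is ground-complete modulo `r`: it proves all equations between closed terms that hold
modulo `r`. -/
def GroundComplete {A : Type u} (E : Set (Equation A)) (r : Proc A → Proc A → Prop) : Prop :=
  ∀ p q : Proc A, r p q → Derivable E p.1 q.1

/-! ## The axioms -/

section Axioms

variable (A : Type u)

local infixr:75 " ⬝ " => Term.pre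
local infixl:70 " ∥ " => Term.par
local infix:50 " ≋ " => Equation.mk
local notation "𝗑" => Term.var 0
local notation "𝗒" => Term.var 1
local notation "𝗓" => Term.var 2
local notation "𝗐" => Term.var 3
local notation "𝗎" => Term.var 4
local notation "𝗏" => Term.var 5

def axA0 : Set (Equation A) := {𝗑 + 0 ≋ 𝗑}
def axA1 : Set (Equation A) := {𝗑 + 𝗒 ≋ 𝗒 + 𝗑}
def axA2 : Set (Equation A) := {(𝗑 + 𝗒) + 𝗓 ≋ 𝗑 + (𝗒 + 𝗓)}
def axA3 : Set (Equation A) := {𝗑 + 𝗑 ≋ 𝗑}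
def axP0 : Set (Equation A) := {𝗑 ∥ 0 ≋ 𝗑}
def axP1 : Set (Equation A) := {𝗑 ∥ 𝗒 ≋ 𝗒 ∥ 𝗑}

def E0 : Set (Equation A) := axA0 A ∪ axA1 A ∪ axA2 A ∪ axA3 A
def E1 : Set (Equation A) := E0 A ∪ axP0 A ∪ axP1 A

/-- The expansion law for two prefixed terms, without and with synchronisation. -/
def axEL1 : Set (Equation A) :=
  {e | ∃ μ ν : Act A, ¬ μ.Compl ν ∧
    e = (μ ⬝ 𝗑 ∥ ν ⬝ 𝗒 ≋ μ ⬝ (𝗑 ∥ ν ⬝ 𝗒) + ν ⬝ (μ ⬝ 𝗑 ∥ 𝗒))} ∪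
  {e | ∃ μ ν : Act A, μ.Compl ν ∧
    e = (μ ⬝ 𝗑 ∥ ν ⬝ 𝗒 ≋ μ ⬝ (𝗑 ∥ ν ⬝ 𝗒) + ν ⬝ (μ ⬝ 𝗑 ∥ 𝗒) + Act.tau ⬝ (𝗑 ∥ 𝗒))}

open Classical in
/-- `∑_{i, j : μᵢ = ν̄ⱼ} τ.(x i ∥ y j)`. -/
noncomputable def syncSum {A : Type u} {m n : ℕ} (μ : Fin m → Act A) (ν : Fin n → Act A)
    (x : Fin m → Term A) (y : Fin n → Term A) : Term A :=
  Term.sum (((List.finRange m ×ˢ List.finRange n).filter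
    fun ij => (μ ij.1).Compl (ν ij.2)).map fun ij => Act.tau ⬝ (x ij.1 ∥ y ij.2))

/-- The expansion law for sums of prefixed terms with pairwise distinct prefixes; the variables
are `xᵢ = var (2 i)` and `yⱼ = var (2 j + 1)`. -/
def axEL2 : Set (Equation A) :=
  {e | ∃ (m n : ℕ) (μ : Fin m → Act A) (ν : Fin n → Act A),
    Function.Injective μ ∧ Function.Injective ν ∧
    let x : Fin m → Term A := fun i => .var (2 * i)
    let y : Fin n → Term A := fun j => .var (2 * j + 1)
    let p : Term A := Term.finSum fun i => μ i ⬝ x i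
    let q : Term A := Term.finSum fun j => ν j ⬝ y j
    e = (p ∥ q ≋ (Term.finSum fun i => μ i ⬝ (x i ∥ q)) + (Term.finSum fun j => ν j ⬝ (p ∥ y j))
      + syncSum μ ν x y)}

def axRS : Set (Equation A) :=
  {e | ∃ μ ν : Act A,
    e = (μ ⬝ (ν ⬝ 𝗑 + ν ⬝ 𝗒 + 𝗓) ≋ μ ⬝ (ν ⬝ 𝗑 + ν ⬝ 𝗒 + 𝗓) + μ ⬝ (ν ⬝ 𝗑 + 𝗓))}

def axRSP1 : Set (Equation A) :=
  {e | ∃ μ ν : Act A,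
    e = ((μ ⬝ 𝗑 + μ ⬝ 𝗒 + 𝗎) ∥ (ν ⬝ 𝗓 + ν ⬝ 𝗐 + 𝗏) ≋
      (μ ⬝ 𝗑 + 𝗎) ∥ (ν ⬝ 𝗓 + ν ⬝ 𝗐 + 𝗏) + (μ ⬝ 𝗒 + 𝗎) ∥ (ν ⬝ 𝗓 + ν ⬝ 𝗐 + 𝗏)
      + (μ ⬝ 𝗑 + μ ⬝ 𝗒 + 𝗎) ∥ (ν ⬝ 𝗓 + 𝗏) + (μ ⬝ 𝗑 + μ ⬝ 𝗒 + 𝗎) ∥ (ν ⬝ 𝗐 + 𝗏))}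

/-- The variables `xᵢ` of the sum with pairwise distinct prefixes are `var (i + 4)`. -/
def axRSP2 : Set (Equation A) :=
  {e | ∃ (m : ℕ) (μ : Fin m → Act A) (ν : Act A), Function.Injective μ ∧
    let x : Fin m → Term A := fun i => .var (i + 4)
    let p : Term A := Term.finSum fun i => μ i ⬝ x i
    e = (p ∥ (ν ⬝ 𝗒 + ν ⬝ 𝗓 + 𝗐) ≋
      p ∥ (ν ⬝ 𝗒 + 𝗐) + p ∥ (ν ⬝ 𝗓 + 𝗐)
      + Term.finSum fun i => μ i ⬝ (x i ∥ (ν ⬝ 𝗒 + ν ⬝ 𝗓 + 𝗐)))}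

def axCS : Set (Equation A) :=
  {e | ∃ μ ν : Act A, e = (μ ⬝ (ν ⬝ 𝗑 + 𝗒 + 𝗓) ≋ μ ⬝ (ν ⬝ 𝗑 + 𝗒 + 𝗓) + μ ⬝ (ν ⬝ 𝗑 + 𝗓))}

def axCSP1 : Set (Equation A) :=
  {e | ∃ μ ν ξ ζ : Act A,
    e = ((μ ⬝ 𝗑 + ν ⬝ 𝗒 + 𝗎) ∥ (ξ ⬝ 𝗓 + ζ ⬝ 𝗐 + 𝗏) ≋
      (μ ⬝ 𝗑 + 𝗎) ∥ (ξ ⬝ 𝗓 + ζ ⬝ 𝗐 + 𝗏) + (ν ⬝ 𝗒 + 𝗎) ∥ (ξ ⬝ 𝗓 + ζ ⬝ 𝗐 + 𝗏)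
      + (μ ⬝ 𝗑 + ν ⬝ 𝗒 + 𝗎) ∥ (ξ ⬝ 𝗓 + 𝗏) + (μ ⬝ 𝗑 + ν ⬝ 𝗒 + 𝗎) ∥ (ζ ⬝ 𝗐 + 𝗏))}

def axCSP2 : Set (Equation A) :=
  {e | ∃ μ ν ξ : Act A,
    e = (μ ⬝ 𝗑 ∥ (ν ⬝ 𝗒 + ξ ⬝ 𝗓 + 𝗐) ≋
      μ ⬝ (𝗑 ∥ (ν ⬝ 𝗒 + ξ ⬝ 𝗓 + 𝗐)) + μ ⬝ 𝗑 ∥ (ν ⬝ 𝗒 + 𝗐) + μ ⬝ 𝗑 ∥ (ξ ⬝ 𝗓 + 𝗐))}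

def axS : Set (Equation A) :=
  {e | ∃ μ : Act A, e = (μ ⬝ (𝗑 + 𝗒) ≋ μ ⬝ (𝗑 + 𝗒) + μ ⬝ 𝗑)}

def axSP1 : Set (Equation A) :=
  {(𝗑 + 𝗒) ∥ (𝗓 + 𝗐) ≋
    𝗑 ∥ (𝗓 + 𝗐) + 𝗒 ∥ (𝗓 + 𝗐) + (𝗑 + 𝗒) ∥ 𝗓 + (𝗑 + 𝗒) ∥ 𝗐}

def axSP2 : Set (Equation A) :=
  {e | ∃ μ : Act A,
    e = (μ ⬝ 𝗑 ∥ (𝗒 + 𝗓) ≋ μ ⬝ (𝗑 ∥ (𝗒 + 𝗓)) + μ ⬝ 𝗑 ∥ 𝗒 + μ ⬝ 𝗑 ∥ 𝗓)}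

/-- The sums have as many (not necessarily distinct) indices as there are actions; the variables
are `xᵢ = var (2 i + 1)`, `yᵢ = var (2 i + 2)` and `z = var 0`. -/
def axRT : Set (Equation A) :=
  {e | ∃ (μ : Act A) (ν : Fin (Nat.card (Act A)) → Act A),
    let x : Fin (Nat.card (Act A)) → Term A := fun i => .var (2 * i + 1)
    let y : Fin (Nat.card (Act A)) → Term A := fun i => .var (2 * i + 2)
    let z : Term A := .var 0
    e = (μ ⬝ ((Term.finSum fun i => ν i ⬝ x i + ν i ⬝ y i) + z) ≋
      μ ⬝ ((Term.finSum fun i => ν i ⬝ x i) + z) + μ ⬝ ((Term.finSum fun i => ν i ⬝ y i) + z))}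

def axFP : Set (Equation A) :=
  {e | ∃ μ : Act A,
    e = ((μ ⬝ 𝗑 + μ ⬝ 𝗒 + 𝗐) ∥ 𝗓 ≋ (μ ⬝ 𝗑 + 𝗐) ∥ 𝗓 + (μ ⬝ 𝗒 + 𝗐) ∥ 𝗓)}

def axFT : Set (Equation A) :=
  {e | ∃ μ : Act A, e = (μ ⬝ 𝗑 + μ ⬝ 𝗒 ≋ μ ⬝ 𝗑 + μ ⬝ 𝗒 + μ ⬝ (𝗑 + 𝗒))}

def axR : Set (Equation A) :=
  {e | ∃ μ ν : Act A,
    e = (μ ⬝ (ν ⬝ 𝗑 + 𝗓) + μ ⬝ (ν ⬝ 𝗒 + 𝗐) ≋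
      μ ⬝ (ν ⬝ 𝗑 + ν ⬝ 𝗒 + 𝗓) + μ ⬝ (ν ⬝ 𝗒 + 𝗐))}

def axF : Set (Equation A) :=
  {e | ∃ μ : Act A, e = (μ ⬝ 𝗑 + μ ⬝ (𝗒 + 𝗓) ≋ μ ⬝ 𝗑 + μ ⬝ (𝗑 + 𝗒) + μ ⬝ (𝗒 + 𝗓))}

def axCT : Set (Equation A) :=
  {e | ∃ μ ν ξ : Act A,
    e = (μ ⬝ (ν ⬝ 𝗑 + 𝗓) + μ ⬝ (ξ ⬝ 𝗒 + 𝗐) ≋ μ ⬝ (ν ⬝ 𝗑 + ξ ⬝ 𝗒 + 𝗓 + 𝗐))}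

def axCTP : Set (Equation A) :=
  {e | ∃ μ ν : Act A,
    e = ((μ ⬝ 𝗑 + ν ⬝ 𝗒 + 𝗐) ∥ 𝗓 ≋ (μ ⬝ 𝗑 + 𝗐) ∥ 𝗓 + (ν ⬝ 𝗒 + 𝗐) ∥ 𝗓)}

def axT : Set (Equation A) :=
  {e | ∃ μ : Act A, e = (μ ⬝ 𝗑 + μ ⬝ 𝗒 ≋ μ ⬝ (𝗑 + 𝗒))}

def axTP : Set (Equation A) := {(𝗑 + 𝗒) ∥ 𝗓 ≋ 𝗑 ∥ 𝗓 + 𝗒 ∥ 𝗓}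

/-- The axiom system `E_X`. -/
def axiomSystem : Semantics → Set (Equation A)
  | .RS => E1 A ∪ axRS A ∪ axRSP1 A ∪ axRSP2 A ∪ axEL2 A
  | .CS => E1 A ∪ axCS A ∪ axCSP1 A ∪ axCSP2 A ∪ axEL1 A
  | .S => E1 A ∪ axS A ∪ axSP1 A ∪ axSP2 A ∪ axEL1 A
  | .RT => E1 A ∪ axRT A ∪ axFP A ∪ axEL2 A
  | .FT => E1 A ∪ axFT A ∪ axRS A ∪ axFP A ∪ axEL2 A
  | .R => E1 A ∪ axR A ∪ axFP A ∪ axEL2 A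
  | .F => E1 A ∪ axF A ∪ axR A ∪ axFP A ∪ axEL2 A
  | .CT => E1 A ∪ axCT A ∪ axCTP A ∪ axEL1 A
  | .T => E1 A ∪ axT A ∪ axTP A ∪ axEL1 A

end Axioms

end CCS

/-! Soundness is checked on all terms, open ones included, and carried to closed terms along the
inclusion, a functional bisimulation. The expansion laws have the same transitions on both sides.
The simulation laws hold because deleting summands gives a simulated process, provided the condition
on initials survives, and because simulation is compatible with prefixing and parallel composition.
The linear laws hold because a run of `(p₁ + p₂) ∥ q` may postpone the choice between `p₁` and `p₂`
until that component moves, and the observations made before do not reveal it.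

For completeness, terms modulo derivability form a join semilattice `Alg` with bottom `0`. An
equation becomes two inequalities, and a sum lies below `m` iff each summand does. The proof then
has two halves.

The first eliminates `∥`: each closed term is provably equal to its synchronisation tree
(`mk_eq_ev`), which amounts to the expansion law for arbitrary sums (`par_ev`). The axioms give this
law only for sums with distinct labels (EL2) or at most one summand (EL1). Both cases are covered by
a relation `r` on labels, equality or the total relation. By induction on size, two summands with
`r`-related labels are split apart. In the linear semantics the pieces are glued together by
distributing a prefix over sums with matching initials (`LinearLaws`). In the simulation semantics
the pieces are bounded by monotonicity of prefixing (`SimLaws`).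

The second half shows that if `s` is below `t` in the semantic preorder, then `ev s ≤ ev t`, by
induction on the tree `s`. For a branch `μ.s'` of `s`, a simulation provides one matching derivative
of `t`. In the linear semantics no single derivative need suffice; instead suitable branches of the
`μ`-derivatives of `t` are merged into one tree `t'` such that `μ.t'` is provably below `t` and `t'`
has all observations of `s'` (`exists_sum`, `ev_le_of_axR`). Monotonicity of prefixing, under the
appropriate condition on initials, concludes. -/

/-! ## Traces, decorated traces and simulations -/

namespace LTS

universe u v w
variable {P : Type u} {P' : Type w} {L : Type v}

/-- `p` can perform `φ` and end in a state whose initials satisfy `K`. -/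
def Reach (tr : P → L → P → Prop) (K : Set L → Prop) : P → List L → Prop
  | p, [] => K (init tr p)
  | p, a :: φ => ∃ p', tr p a p' ∧ Reach tr K p' φ

/-- Traces whose states are decorated with sets that are related by `D` to their initials. -/
def DTrace (tr : P → L → P → Prop) (D : Set L → Set L → Prop) : P → Set L → List (L × Set L) → Prop
  | p, X, [] => D (init tr p) X
  | p, X, (a, Y) :: φ => D (init tr p) X ∧ ∃ p', tr p a p' ∧ DTrace tr D p' Y φ

theorem reach_iff {tr : P → L → P → Prop} {K : Set L → Prop} {p : P} {φ : List L} :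
    Reach tr K p φ ↔ ∃ p', Steps tr p φ p' ∧ K (init tr p') := by
  induction φ generalizing p with
  | nil => simp [Reach, Steps]
  | cons a φ ih =>
    simp only [Reach, Steps, ih]
    grind

theorem mem_traces_iff {tr : P → L → P → Prop} {p : P} {φ : List L} :
    φ ∈ traces tr p ↔ Reach tr (fun _ => True) p φ := by
  simp [traces, reach_iff]

theorem mem_completedTraces_iff {tr : P → L → P → Prop} {p : P} {φ : List L} :
    φ ∈ completedTraces tr p ↔ Reach tr (fun X => X = ∅) p φ := by
  simp [completedTraces, reach_iff]

theorem mem_readies_iff {tr : P → L → P → Prop} {p : P} {φ : List L} {X : Set L} :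
    (φ, X) ∈ readies tr p ↔ Reach tr (fun Y => Y = X) p φ := by
  simp [readies, reach_iff]

theorem mem_failures_iff {tr : P → L → P → Prop} {p : P} {φ : List L} {X : Set L} :
    (φ, X) ∈ failures tr p ↔ Reach tr (fun Y => Y ∩ X = ∅) p φ := by
  simp [failures, reach_iff]

theorem isReadyTrace_iff {tr : P → L → P → Prop} {p : P} {X : Set L} {φ : List (L × Set L)} :
    IsReadyTrace tr p X φ ↔ DTrace tr (fun I Y => I = Y) p X φ := by
  induction φ generalizing p X with
  | nil => rfl
  | cons a φ ih => obtain ⟨a, Y⟩ := a; simp only [IsReadyTrace, DTrace, ih]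

theorem isFailureTrace_iff {tr : P → L → P → Prop} {p : P} {X : Set L} {φ : List (L × Set L)} :
    IsFailureTrace tr p X φ ↔ DTrace tr (fun I Y => I ∩ Y = ∅) p X φ := by
  induction φ generalizing p X with
  | nil => rfl
  | cons a φ ih => obtain ⟨a, Y⟩ := a; simp only [IsFailureTrace, DTrace, ih]

/-- Only the first decoration speaks about `p` itself. For failure traces this allows the first
refusal set to be enlarged to the complement of the initials. -/
theorem DTrace.decoration {tr : P → L → P → Prop} {D : Set L → Set L → Prop} {p : P}
    {Y Z : Set L} {φ : List (L × Set L)} (h : DTrace tr D p Y φ) (hZ : D (init tr p) Z) :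
    DTrace tr D p Z φ := by
  cases φ with
  | nil => exact hZ
  | cons a φ => exact ⟨hZ, h.2⟩

theorem DTrace.head {tr : P → L → P → Prop} {D : Set L → Set L → Prop} {p : P} {Y : Set L}
    {φ : List (L × Set L)} (h : DTrace tr D p Y φ) : D (init tr p) Y := by
  cases φ with
  | nil => exact h
  | cons a φ => exact h.1

/-- `p` is simulated by `q` through a simulation that relates only states whose initials are
related by `C`. -/
def SimLE (tr : P → L → P → Prop) (C : Set L → Set L → Prop) (p q : P) : Prop :=
  ∃ R, (IsSimulation tr R ∧ ∀ p q, R p q → C (init tr p) (init tr q)) ∧ R p q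

/-- Both sets are empty or both are not. -/
def EmptyIff (X Y : Set L) : Prop := X = ∅ ↔ Y = ∅

theorem simEquiv_iff {tr : P → L → P → Prop} {p q : P} : SimEquiv tr p q ↔
    SimLE tr (fun _ _ => True) p q ∧ SimLE tr (fun _ _ => True) q p := by
  simp [SimEquiv, SimLE]

theorem completedSimEquiv_iff {tr : P → L → P → Prop} {p q : P} : CompletedSimEquiv tr p q ↔
    SimLE tr EmptyIff p q ∧ SimLE tr EmptyIff q p := Iff.rfl

theorem readySimEquiv_iff {tr : P → L → P → Prop} {p q : P} : ReadySimEquiv tr p q ↔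
    SimLE tr Eq p q ∧ SimLE tr Eq q p := Iff.rfl

/-- Reduces the nine semantics to three shapes, `SimLE`, `Reach` and `DTrace`, so that transfer and
soundness arguments are made once per shape. -/
theorem _root_.Semantics.equiv_iff {tr : P → L → P → Prop} {X : Semantics} {p q : P} :
    X.Equiv tr p q ↔ match X with
      | .RS => SimLE tr Eq p q ∧ SimLE tr Eq q p
      | .CS => SimLE tr EmptyIff p q ∧ SimLE tr EmptyIff q p
      | .S => SimLE tr (fun _ _ => True) p q ∧ SimLE tr (fun _ _ => True) q p
      | .RT => ∀ Y φ, DTrace tr (fun I Y => I = Y) p Y φ ↔ DTrace tr (fun I Y => I = Y) q Y φ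
      | .FT => ∀ Y φ, DTrace tr (fun I Y => I ∩ Y = ∅) p Y φ ↔
          DTrace tr (fun I Y => I ∩ Y = ∅) q Y φ
      | .R => ∀ Y φ, Reach tr (fun I => I = Y) p φ ↔ Reach tr (fun I => I = Y) q φ
      | .F => ∀ Y φ, Reach tr (fun I => I ∩ Y = ∅) p φ ↔ Reach tr (fun I => I ∩ Y = ∅) q φ
      | .CT => (∀ φ, Reach tr (fun _ => True) p φ ↔ Reach tr (fun _ => True) q φ) ∧
          ∀ φ, Reach tr (fun I => I = ∅) p φ ↔ Reach tr (fun I => I = ∅) q φ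
      | .T => ∀ φ, Reach tr (fun _ => True) p φ ↔ Reach tr (fun _ => True) q φ := by
  cases X
  · exact readySimEquiv_iff
  · exact completedSimEquiv_iff
  · exact simEquiv_iff
  · simp only [Semantics.Equiv, Set.ext_iff, Prod.forall, readyTraces, Set.mem_ofPred_eq,
      isReadyTrace_iff]
  · simp only [Semantics.Equiv, Set.ext_iff, Prod.forall, failureTraces, Set.mem_ofPred_eq,
      isFailureTrace_iff]
  · rw [Semantics.Equiv, Set.ext_iff, Prod.forall, forall_comm]
    simp only [mem_readies_iff]
  · rw [Semantics.Equiv, Set.ext_iff, Prod.forall, forall_comm]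
    simp only [mem_failures_iff]
  · simp only [Semantics.Equiv, Set.ext_iff, mem_traces_iff, mem_completedTraces_iff]
  · simp only [Semantics.Equiv, Set.ext_iff, mem_traces_iff]

theorem SimLE.init_rel {tr : P → L → P → Prop} {C : Set L → Set L → Prop} {p q : P}
    (h : SimLE tr C p q) : C (init tr p) (init tr q) := by
  obtain ⟨R, hR, h⟩ := h
  exact hR.2 p q h

theorem SimLE.step {tr : P → L → P → Prop} {C : Set L → Set L → Prop} {p q : P}
    (h : SimLE tr C p q) {a : L} {p' : P} (hp : tr p a p') : ∃ q', tr q a q' ∧ SimLE tr C p' q' := by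
  obtain ⟨R, hR, h⟩ := h
  obtain ⟨q', hq, h'⟩ := hR.1 p q h a p' hp
  exact ⟨q', hq, R, hR, h'⟩

/-- Simulation up to similarity: the union of `R` with the similarity `SimLE` is itself a
simulation. -/
theorem SimLE.of_relation {tr : P → L → P → Prop} {C : Set L → Set L → Prop} {R : P → P → Prop}
    (hC : ∀ p q, R p q → C (init tr p) (init tr q))
    (hR : ∀ p q, R p q → ∀ a p', tr p a p' → ∃ q', tr q a q' ∧ (R p' q' ∨ SimLE tr C p' q'))
    {p q : P} (h : R p q) : SimLE tr C p q := by
  refine ⟨fun p q => R p q ∨ SimLE tr C p q, ⟨?_, ?_⟩, Or.inl h⟩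
  · rintro p q (h | h) a p' hp
    · exact hR p q h a p' hp
    · obtain ⟨q', hq, h'⟩ := h.step hp
      exact ⟨q', hq, Or.inr h'⟩
  · rintro p q (h | h)
    exacts [hC p q h, h.init_rel]

theorem SimLE.of_step {tr : P → L → P → Prop} {C : Set L → Set L → Prop} {p q : P}
    (hC : C (init tr p) (init tr q))
    (h : ∀ a p', tr p a p' → ∃ q', tr q a q' ∧ SimLE tr C p' q') : SimLE tr C p q := by
  refine SimLE.of_relation (R := fun x y => x = p ∧ y = q) ?_ ?_ ⟨rfl, rfl⟩
  · rintro _ _ ⟨rfl, rfl⟩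
    exact hC
  · rintro _ _ ⟨rfl, rfl⟩ a p' hp
    obtain ⟨q', hq, h'⟩ := h a p' hp
    exact ⟨q', hq, Or.inr h'⟩

theorem SimLE.refl {tr : P → L → P → Prop} {C : Set L → Set L → Prop} (hC : ∀ X, C X X) (p : P) :
    SimLE tr C p p :=
  ⟨Eq, ⟨fun _ _ h a p' hp => ⟨p', h ▸ hp, rfl⟩, fun _ _ h => h ▸ hC _⟩, rfl⟩

theorem SimLE.of_subset {tr : P → L → P → Prop} {C : Set L → Set L → Prop} (hC : ∀ X, C X X)
    {p q : P} (hpq : C (init tr p) (init tr q)) (h : ∀ a r, tr p a r → tr q a r) :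
    SimLE tr C p q :=
  .of_step hpq fun a r hr => ⟨r, h a r hr, .refl hC r⟩

theorem SimLE.mono {tr : P → L → P → Prop} {C C' : Set L → Set L → Prop}
    (hC : ∀ X Y, C X Y → C' X Y) {p q : P} (h : SimLE tr C p q) : SimLE tr C' p q := by
  obtain ⟨R, hR, h⟩ := h
  exact ⟨R, ⟨hR.1, fun p q h => hC _ _ (hR.2 p q h)⟩, h⟩

theorem SimLE.reach {tr : P → L → P → Prop} {K : Set L → Prop} {p q : P}
    (h : SimLE tr Eq p q) {φ : List L} (hp : Reach tr K p φ) : Reach tr K q φ := by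
  induction φ generalizing p q with
  | nil => simpa only [Reach, h.init_rel] using hp
  | cons a φ ih =>
    obtain ⟨p', hp, h'⟩ := hp
    obtain ⟨q', hq, h⟩ := h.step hp
    exact ⟨q', hq, ih h h'⟩

theorem SimLE.dtrace {tr : P → L → P → Prop} {D : Set L → Set L → Prop} {p q : P}
    (h : SimLE tr Eq p q) {X : Set L} {φ : List (L × Set L)} (hp : DTrace tr D p X φ) :
    DTrace tr D q X φ := by
  induction φ generalizing p q X with
  | nil => simpa only [DTrace, h.init_rel] using hp
  | cons a φ ih =>
    obtain ⟨hX, p', hp, h'⟩ := hp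
    obtain ⟨q', hq, hs⟩ := h.step hp
    exact ⟨h.init_rel ▸ hX, q', hq, ih hs h'⟩

/-- Ready simulation equivalence is the finest of the nine equivalences. -/
theorem equiv_of_simLE {tr : P → L → P → Prop} {p q : P} (h : SimLE tr Eq p q)
    (h' : SimLE tr Eq q p) (X : Semantics) : X.Equiv tr p q := by
  rw [Semantics.equiv_iff]
  cases X
  · exact ⟨h, h'⟩
  · exact ⟨h.mono fun X Y e => by rw [e]; exact Iff.rfl, h'.mono fun X Y e => by rw [e]; exact Iff.rfl⟩
  · exact ⟨h.mono fun _ _ _ => trivial, h'.mono fun _ _ _ => trivial⟩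
  · exact fun Y φ => ⟨h.dtrace, h'.dtrace⟩
  · exact fun Y φ => ⟨h.dtrace, h'.dtrace⟩
  · exact fun Y φ => ⟨h.reach, h'.reach⟩
  · exact fun Y φ => ⟨h.reach, h'.reach⟩
  · exact ⟨fun φ => ⟨h.reach, h'.reach⟩, fun φ => ⟨h.reach, h'.reach⟩⟩
  · exact fun φ => ⟨h.reach, h'.reach⟩

/-- A symmetric simulation is contained in all nine equivalences. -/
theorem equiv_of_bisimulation {tr : P → L → P → Prop} {R : P → P → Prop}
    (hs : ∀ p q, R p q → R q p) (hR : IsSimulation tr R) {p q : P} (h : R p q) (X : Semantics) :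
    X.Equiv tr p q := by
  have key : ∀ p q, R p q → init tr p ⊆ init tr q := by
    rintro p q h a ⟨p', hp⟩
    obtain ⟨q', hq, -⟩ := hR p q h a p' hp
    exact ⟨q', hq⟩
  have hE : ∀ p q, R p q → init tr p = init tr q := fun p q h =>
    (key p q h).antisymm (key q p (hs p q h))
  exact equiv_of_simLE ⟨R, ⟨hR, hE⟩, h⟩ ⟨R, ⟨hR, hE⟩, hs p q h⟩ X

theorem equiv_of_same_steps {tr : P → L → P → Prop} {p q : P}
    (h : ∀ a r, tr p a r ↔ tr q a r) (X : Semantics) : X.Equiv tr p q := by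
  have hi : init tr p = init tr q := by
    ext a
    exact exists_congr fun r => h a r
  exact equiv_of_simLE (.of_subset (fun _ => rfl) hi fun a r => (h a r).1)
    (.of_subset (fun _ => rfl) hi.symm fun a r => (h a r).2) X

/-! ### Functional bisimulations -/

/-- The graph of `f` is a bisimulation. -/
structure IsFunctionalBisim (tr : P → L → P → Prop) (tr' : P' → L → P' → Prop) (f : P → P') :
    Prop where
  forth : ∀ {p a q}, tr p a q → tr' (f p) a (f q)
  back : ∀ {p a r}, tr' (f p) a r → ∃ q, tr p a q ∧ f q = r

namespace IsFunctionalBisim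

variable {tr : P → L → P → Prop} {tr' : P' → L → P' → Prop} {f : P → P'}

theorem exists_step (h : IsFunctionalBisim tr tr' f) {p : P} {a : L} {Q : P' → Prop} :
    (∃ r, tr' (f p) a r ∧ Q r) ↔ ∃ q, tr p a q ∧ Q (f q) := by
  constructor
  · rintro ⟨r, hr, hQ⟩
    obtain ⟨q, hq, rfl⟩ := h.back hr
    exact ⟨q, hq, hQ⟩
  · rintro ⟨q, hq, hQ⟩
    exact ⟨f q, h.forth hq, hQ⟩

theorem init_eq (h : IsFunctionalBisim tr tr' f) (p : P) : init tr' (f p) = init tr p := by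
  ext a
  have := h.exists_step (p := p) (a := a) (Q := fun _ => True)
  simp only [and_true] at this
  exact this

theorem reach_iff (h : IsFunctionalBisim tr tr' f) {K : Set L → Prop} {p : P} {φ : List L} :
    Reach tr' K (f p) φ ↔ Reach tr K p φ := by
  induction φ generalizing p with
  | nil => simp only [Reach, h.init_eq]
  | cons a φ ih => simp only [Reach, h.exists_step, ih]

theorem dtrace_iff (h : IsFunctionalBisim tr tr' f) {D : Set L → Set L → Prop} {p : P} {X : Set L}
    {φ : List (L × Set L)} : DTrace tr' D (f p) X φ ↔ DTrace tr D p X φ := by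
  induction φ generalizing p X with
  | nil => simp only [DTrace, h.init_eq]
  | cons a φ ih => simp only [DTrace, h.exists_step, h.init_eq, ih]

theorem simLE_iff (h : IsFunctionalBisim tr tr' f) {C : Set L → Set L → Prop} {p q : P} :
    SimLE tr' C (f p) (f q) ↔ SimLE tr C p q := by
  constructor <;> intro hs
  · refine SimLE.of_relation (R := fun p q => SimLE tr' C (f p) (f q)) ?_ ?_ hs
    · intro p q hs
      simpa only [h.init_eq] using hs.init_rel
    · intro p q hs a p' hp
      obtain ⟨r, hr, hs'⟩ := hs.step (h.forth hp)
      obtain ⟨q', hq, rfl⟩ := h.back hr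
      exact ⟨q', hq, Or.inl hs'⟩
  · refine SimLE.of_relation (R := fun x y => ∃ p q, f p = x ∧ f q = y ∧ SimLE tr C p q) ?_ ?_
      ⟨p, q, rfl, rfl, hs⟩
    · rintro _ _ ⟨p, q, rfl, rfl, hs⟩
      simpa only [h.init_eq] using hs.init_rel
    · rintro _ _ ⟨p, q, rfl, rfl, hs⟩ a r hr
      obtain ⟨p', hp, rfl⟩ := h.back hr
      obtain ⟨q', hq, hs'⟩ := hs.step hp
      exact ⟨f q', h.forth hq, Or.inl ⟨p', q', rfl, rfl, hs'⟩⟩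

/-- Needed twice: for the inclusion of closed terms into all terms, and for the passage from closed
terms to synchronisation trees. -/
theorem equiv_iff (h : IsFunctionalBisim tr tr' f) (X : Semantics) {p q : P} :
    X.Equiv tr' (f p) (f q) ↔ X.Equiv tr p q := by
  rw [Semantics.equiv_iff, Semantics.equiv_iff]
  cases X <;> simp only [h.simLE_iff, h.reach_iff, h.dtrace_iff]

end IsFunctionalBisim

/-! ### Choices between two states -/

theorem init_union {tr : P → L → P → Prop} {p q r : P}
    (h : ∀ a t, tr r a t ↔ tr p a t ∨ tr q a t) : init tr r = init tr p ∪ init tr q := by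
  ext a
  simp only [init, Set.mem_ofPred_eq, h, Set.mem_union, exists_or]

/-- A nonempty trace only sees the first transitions, which are those of `p` and `q` together. Only
the empty trace tests the initials of `r`, hence `hK`. -/
theorem reach_union {tr : P → L → P → Prop} {K : Set L → Prop} {p q r : P}
    (h : ∀ a t, tr r a t ↔ tr p a t ∨ tr q a t)
    (hK : K (init tr r) ↔ K (init tr p) ∨ K (init tr q)) (φ : List L) :
    Reach tr K r φ ↔ Reach tr K p φ ∨ Reach tr K q φ := by
  cases φ with
  | nil => exact hK
  | cons a φ => simp only [Reach, h, or_and_right, exists_or]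

/-- The first decoration is tested in the state where the choice is still open, so the three sets of
initials have to agree. -/
theorem dtrace_union {tr : P → L → P → Prop} {D : Set L → Set L → Prop} {p q r : P}
    (h : ∀ a t, tr r a t ↔ tr p a t ∨ tr q a t)
    (hp : init tr r = init tr p) (hq : init tr r = init tr q) (X : Set L)
    (φ : List (L × Set L)) : DTrace tr D r X φ ↔ DTrace tr D p X φ ∨ DTrace tr D q X φ := by
  cases φ with
  | nil => simp only [DTrace, ← hp, ← hq, or_self]
  | cons a φ =>
    simp only [DTrace, h, or_and_right, exists_or, ← hp, ← hq, ← and_or_left]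

end LTS

/-! ## Soundness -/

namespace CCS

universe u
variable {A : Type u}

open LTS

/-! ### Transitions of compound terms -/

namespace Term

theorem add_eq (t u : Term A) : t + u = plus t u := rfl

theorem zero_eq : (0 : Term A) = nil := rfl

theorem subst_add (σ : ℕ → Term A) (t u : Term A) : (t + u).subst σ = t.subst σ + u.subst σ := rfl

theorem subst_sum (σ : ℕ → Term A) (l : List (Term A)) :
    (sum l).subst σ = sum (l.map (subst σ)) := by
  fun_induction sum l with
  | case1 => rfl
  | case2 t => rfl
  | case3 t u l ih => simp [sum, subst_add, ih]

theorem subst_finSum (σ : ℕ → Term A) {k : ℕ} (t : Fin k → Term A) :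
    (finSum t).subst σ = finSum fun i => (t i).subst σ := by
  simp [finSum, subst_sum, List.map_ofFn, Function.comp_def]

end Term

theorem step_pre_iff {μ ν : Act A} {t r : Term A} : Step (.pre μ t) ν r ↔ ν = μ ∧ r = t := by
  constructor
  · intro h
    cases h
    exact ⟨rfl, rfl⟩
  · rintro ⟨rfl, rfl⟩
    exact .pre _ _

theorem step_nil_iff {ν : Act A} {r : Term A} : Step .nil ν r ↔ False :=
  ⟨fun h => (nomatch h), False.elim⟩

theorem step_var_iff {n : ℕ} {ν : Act A} {r : Term A} : Step (.var n) ν r ↔ False :=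
  ⟨fun h => (nomatch h), False.elim⟩

theorem step_plus_iff {ν : Act A} {t u r : Term A} :
    Step (.plus t u) ν r ↔ Step t ν r ∨ Step u ν r := by
  constructor
  · intro h
    cases h with
    | plus_left h => exact Or.inl h
    | plus_right h => exact Or.inr h
  · rintro (h | h)
    exacts [.plus_left h, .plus_right h]

theorem step_add_iff {ν : Act A} {t u r : Term A} :
    Step (t + u) ν r ↔ Step t ν r ∨ Step u ν r := step_plus_iff

theorem step_par_iff {ν : Act A} {t u r : Term A} :
    Step (.par t u) ν r ↔ (∃ t', Step t ν t' ∧ r = .par t' u) ∨ (∃ u', Step u ν u' ∧ r = .par t u') ∨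
      ∃ t' u' α β, Act.Compl α β ∧ Step t α t' ∧ Step u β u' ∧ ν = .tau ∧ r = .par t' u' := by
  constructor
  · intro h
    cases h with
    | par_left h => exact Or.inl ⟨_, h, rfl⟩
    | par_right h => exact Or.inr (Or.inl ⟨_, h, rfl⟩)
    | comm hc h h' => exact Or.inr (Or.inr ⟨_, _, _, _, hc, h, h', rfl, rfl⟩)
  · rintro (⟨t', h, rfl⟩ | ⟨u', h, rfl⟩ | ⟨t', u', α, β, hc, h, h', rfl, rfl⟩)
    exacts [.par_left h, .par_right h, .comm hc h h']

theorem step_sum_iff {ν : Act A} {l : List (Term A)} {r : Term A} :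
    Step (Term.sum l) ν r ↔ ∃ t ∈ l, Step t ν r := by
  fun_induction Term.sum l with
  | case1 => simp [Term.zero_eq, step_nil_iff]
  | case2 t => simp
  | case3 t u l ih => rw [step_add_iff, ih]; simp

theorem step_finSum_iff {ν : Act A} {k : ℕ} {t : Fin k → Term A} {r : Term A} :
    Step (Term.finSum t) ν r ↔ ∃ i, Step (t i) ν r := by
  simp [Term.finSum, step_sum_iff, List.mem_ofFn]

theorem Act.Compl.symm {α β : Act A} (h : Act.Compl α β) : Act.Compl β α := by
  cases h <;> constructor

/-- The initials of a parallel composition, in terms of those of the components. -/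
def parInit (X Y : Set (Act A)) : Set (Act A) :=
  X ∪ Y ∪ {a | a = .tau ∧ ∃ α ∈ X, ∃ β ∈ Y, Act.Compl α β}

theorem init_par (t u : Term A) : init Step (.par t u) = parInit (init Step t) (init Step u) := by
  ext a
  simp only [init, parInit, Set.mem_union, Set.mem_ofPred_eq, step_par_iff]
  grind

theorem init_plus (t u : Term A) : init Step (.plus t u) = init Step t ∪ init Step u :=
  init_union fun _ _ => step_plus_iff

theorem init_pre (μ : Act A) (t : Term A) : init Step (.pre μ t) = {μ} := by
  ext a
  simp [init, step_pre_iff]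

/-! ### Laws of strong bisimilarity -/

theorem equiv_par_nil (X : Semantics) (t : Term A) : X.Equiv Step (.par t .nil) t := by
  refine equiv_of_bisimulation (R := fun p q => p = .par q .nil ∨ q = .par p .nil) ?_ ?_ (Or.inl rfl) X
  · exact fun p q h => h.symm
  · rintro p q (rfl | rfl) a r hr
    · simp only [step_par_iff, step_nil_iff] at hr
      grind
    · exact ⟨_, .par_left hr, Or.inr rfl⟩

theorem equiv_par_comm (X : Semantics) (t u : Term A) : X.Equiv Step (.par t u) (.par u t) := by
  refine equiv_of_bisimulation (R := fun p q => ∃ t u, p = .par t u ∧ q = .par u t) ?_ ?_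
    ⟨t, u, rfl, rfl⟩ X
  · rintro _ _ ⟨t, u, rfl, rfl⟩
    exact ⟨u, t, rfl, rfl⟩
  · rintro _ _ ⟨t, u, rfl, rfl⟩ a r hr
    rcases step_par_iff.1 hr with ⟨t', h, rfl⟩ | ⟨u', h, rfl⟩ | ⟨t', u', α, β, hc, h, h', rfl, rfl⟩
    · exact ⟨_, .par_right h, _, _, rfl, rfl⟩
    · exact ⟨_, .par_left h, _, _, rfl, rfl⟩
    · exact ⟨_, .comm hc.symm h' h, _, _, rfl, rfl⟩

/-- All instances of the equations of `E` with terms for the variables hold modulo `X`. -/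
def Valid (E : Set (Equation A)) (X : Semantics) : Prop :=
  ∀ e ∈ E, ∀ σ : ℕ → Term A, X.Equiv Step (e.lhs.subst σ) (e.rhs.subst σ)

theorem Valid.union {E E' : Set (Equation A)} {X : Semantics} (h : Valid E X) (h' : Valid E' X) :
    Valid (E ∪ E') X := by
  rintro e (he | he)
  exacts [h e he, h' e he]

theorem valid_E1 (X : Semantics) : Valid (E1 A) X := by
  rintro e (((((rfl | rfl) | rfl) | rfl) | rfl) | rfl) σ
  · refine equiv_of_same_steps (fun a r => ?_) X
    simp only [Term.subst, step_plus_iff, step_nil_iff, or_false]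
  · refine equiv_of_same_steps (fun a r => ?_) X
    simp only [Term.subst_add, step_add_iff]
    exact or_comm
  · refine equiv_of_same_steps (fun a r => ?_) X
    simp only [Term.subst_add, step_add_iff]
    exact or_assoc
  · refine equiv_of_same_steps (fun a r => ?_) X
    simp only [Term.subst_add, step_add_iff]
    exact or_self_iff
  · exact equiv_par_nil X _
  · exact equiv_par_comm X _ _

theorem valid_axEL1 (X : Semantics) : Valid (axEL1 A) X := by
  rintro e (⟨μ, ν, h, rfl⟩ | ⟨μ, ν, h, rfl⟩) σ <;>
    refine equiv_of_same_steps (fun a r => ?_) X <;>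
    simp only [Term.subst, step_plus_iff, step_par_iff, step_pre_iff] <;>
    grind

/-- Hides the filtered list of index pairs behind a membership criterion, which is all that
transitions and upper bounds depend on. -/
theorem syncSum_eq_sum {m n : ℕ} (μ : Fin m → Act A) (ν : Fin n → Act A)
    (x : Fin m → Term A) (y : Fin n → Term A) : ∃ l, syncSum μ ν x y = Term.sum l ∧
      ∀ t, t ∈ l ↔ ∃ i j, Act.Compl (μ i) (ν j) ∧ t = .pre .tau (.par (x i) (y j)) := by
  refine ⟨_, rfl, fun t => ?_⟩
  have hmem (i : Fin m) (j : Fin n) : (i, j) ∈ List.finRange m ×ˢ List.finRange n :=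
    List.pair_mem_product.2 ⟨List.mem_finRange i, List.mem_finRange j⟩
  simp only [List.mem_map, List.mem_filter, Prod.exists, decide_eq_true_eq, hmem, true_and]
  grind

theorem valid_axEL2 (X : Semantics) : Valid (axEL2 A) X := by
  rintro e ⟨m, n, μ, ν, -, -, rfl⟩ σ
  refine equiv_of_same_steps (fun a r => ?_) X
  obtain ⟨l, hl, hmem⟩ := syncSum_eq_sum μ ν (fun i : Fin m => Term.var (2 * i))
    (fun j : Fin n => Term.var (2 * j + 1))
  have hs : Step ((Term.sum l).subst σ) a r ↔ ∃ i j, Act.Compl (μ i) (ν j) ∧ a = .tau ∧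
      r = .par (σ (2 * i)) (σ (2 * j + 1)) := by
    simp only [Term.subst_sum, step_sum_iff, List.mem_map, exists_exists_and_eq_and, hmem]
    constructor
    · rintro ⟨_, ⟨i, j, h, rfl⟩, hr⟩
      exact ⟨i, j, h, step_pre_iff.1 hr⟩
    · rintro ⟨i, j, h, hr⟩
      exact ⟨_, ⟨i, j, h, rfl⟩, step_pre_iff.2 hr⟩
  simp only [hl, Term.subst, Term.subst_finSum, step_plus_iff, step_par_iff,
    step_pre_iff, step_finSum_iff, hs]
  grind

/-! ### Simulation semantics -/

/-- Conditions on the initials of related states that fit with the operators of CCS. -/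
structure Admissible (C : Set (Act A) → Set (Act A) → Prop) : Prop where
  refl : ∀ X, C X X
  par : ∀ X X' Y Y', C X X' → C Y Y' → C (parInit X Y) (parInit X' Y')

theorem admissible_eq : Admissible (A := A) Eq where
  refl _ := rfl
  par _ _ _ _ h h' := by rw [h, h']

theorem admissible_true : Admissible (A := A) fun _ _ => True :=
  ⟨fun _ => trivial, fun _ _ _ _ _ _ => trivial⟩

theorem parInit_eq_empty {X Y : Set (Act A)} : parInit X Y = ∅ ↔ X = ∅ ∧ Y = ∅ := by
  simp only [parInit, Set.union_empty_iff]
  refine ⟨fun h => h.1, fun h => ⟨h, ?_⟩⟩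
  ext a
  simp [h.1]

theorem admissible_emptyIff : Admissible (A := A) EmptyIff where
  refl _ := Iff.rfl
  par _ _ _ _ h h' := by
    rw [EmptyIff] at *
    rw [parInit_eq_empty, parInit_eq_empty, h, h']

/-- Parallel compositions of related components form a simulation. The condition on initials is kept
because `parInit` computes the initials of a composition from those of its components. -/
theorem SimLE.par {C : Set (Act A) → Set (Act A) → Prop} (hC : Admissible C) {t t' u u' : Term A}
    (ht : SimLE Step C t t') (hu : SimLE Step C u u') : SimLE Step C (.par t u) (.par t' u') := by
  refine SimLE.of_relation (R := fun p q => ∃ t u t' u', p = .par t u ∧ q = .par t' u' ∧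
    SimLE Step C t t' ∧ SimLE Step C u u') ?_ ?_ ⟨t, u, t', u', rfl, rfl, ht, hu⟩
  · rintro _ _ ⟨t, u, t', u', rfl, rfl, ht, hu⟩
    rw [init_par, init_par]
    exact hC.par _ _ _ _ ht.init_rel hu.init_rel
  · rintro _ _ ⟨t, u, t', u', rfl, rfl, ht, hu⟩ a r hr
    rcases step_par_iff.1 hr with ⟨v, h, rfl⟩ | ⟨v, h, rfl⟩ | ⟨v, w, α, β, hc, h, h', rfl, rfl⟩
    · obtain ⟨v', h', hs⟩ := ht.step h
      exact ⟨_, .par_left h', Or.inl ⟨_, _, _, _, rfl, rfl, hs, hu⟩⟩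
    · obtain ⟨v', h', hs⟩ := hu.step h
      exact ⟨_, .par_right h', Or.inl ⟨_, _, _, _, rfl, rfl, ht, hs⟩⟩
    · obtain ⟨v', hv, hs⟩ := ht.step h
      obtain ⟨w', hw, hs'⟩ := hu.step h'
      exact ⟨_, .comm hc hv hw, Or.inl ⟨_, _, _, _, rfl, rfl, hs, hs'⟩⟩

theorem simLE_pre {C : Set (Act A) → Set (Act A) → Prop} (hC : Admissible C) {t u : Term A}
    (h : SimLE Step C t u) (μ : Act A) : SimLE Step C (.pre μ t) (.pre μ u) := by
  refine .of_step (by simpa only [init_pre] using hC.refl _) fun a r hr => ?_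
  obtain ⟨rfl, rfl⟩ := step_pre_iff.1 hr
  exact ⟨u, .pre _ _, h⟩

/-- `μ(u) ≈ μ(u) + μ(t)` holds if `t` is simulated by `u`. -/
theorem simLE_pre_absorb {C : Set (Act A) → Set (Act A) → Prop} (hC : Admissible C)
    {t u : Term A} (h : SimLE Step C t u) (μ : Act A) :
    SimLE Step C (.pre μ u) (.pre μ u + .pre μ t) ∧
      SimLE Step C (.pre μ u + .pre μ t) (.pre μ u) := by
  have hi : init Step (.pre μ u + .pre μ t) = init Step (.pre μ u) := by
    simp [Term.add_eq, init_plus, init_pre]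
  constructor
  · exact .of_subset hC.refl (by rw [hi]; exact hC.refl _) fun a r h => .plus_left h
  · refine .of_step (by rw [hi]; exact hC.refl _) fun a r hr => ?_
    rw [step_add_iff] at hr
    rcases hr with hr | hr
    · exact ⟨r, hr, .refl hC.refl r⟩
    · exact (simLE_pre hC h μ).step hr

/-- A process is equivalent to one that has more transitions, if it simulates these. -/
theorem simLE_of_cover {C : Set (Act A) → Set (Act A) → Prop} (hC : Admissible C) {p q : Term A}
    (hle : ∀ a r, Step q a r → ∃ r', Step p a r' ∧ SimLE Step C r r')
    (hpq : ∀ a r, Step p a r → Step q a r) :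
    SimLE Step C p q ∧ SimLE Step C q p := by
  have hi : init Step q = init Step p := by
    ext a
    constructor
    · rintro ⟨r, hr⟩
      obtain ⟨r', hr', -⟩ := hle a r hr
      exact ⟨r', hr'⟩
    · rintro ⟨r, hr⟩
      exact ⟨r, hpq a r hr⟩
  exact ⟨.of_subset hC.refl (by rw [hi]; exact hC.refl _) hpq,
    .of_step (by rw [hi]; exact hC.refl _) hle⟩

/-- The common form of the axioms that split both components of a parallel composition. -/
theorem simLE_par_split {C : Set (Act A) → Set (Act A) → Prop} (hC : Admissible C)
    {p p₁ p₂ q q₁ q₂ : Term A} (hp₁ : SimLE Step C p₁ p) (hp₂ : SimLE Step C p₂ p)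
    (hq₁ : SimLE Step C q₁ q) (hq₂ : SimLE Step C q₂ q)
    (hp : ∀ a r, Step p a r → Step p₁ a r ∨ Step p₂ a r)
    (hq : ∀ a r, Step q a r → Step q₁ a r ∨ Step q₂ a r) :
    SimLE Step C (.par p q) (.par p₁ q + .par p₂ q + .par p q₁ + .par p q₂) ∧
      SimLE Step C (.par p₁ q + .par p₂ q + .par p q₁ + .par p q₂) (.par p q) := by
  refine simLE_of_cover hC (fun a r hr => ?_) fun a r hr => ?_
  · simp only [Term.add_eq, step_plus_iff] at hr
    rcases hr with ((hr | hr) | hr) | hr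
    · exact (SimLE.par hC hp₁ (.refl hC.refl q)).step hr
    · exact (SimLE.par hC hp₂ (.refl hC.refl q)).step hr
    · exact (SimLE.par hC (.refl hC.refl p) hq₁).step hr
    · exact (SimLE.par hC (.refl hC.refl p) hq₂).step hr
  · simp only [step_add_iff, step_par_iff] at hr ⊢
    grind

/-- The common form of the axioms that split one component of a parallel composition. -/
theorem simLE_par_split_right {C : Set (Act A) → Set (Act A) → Prop} (hC : Admissible C)
    {p q q₁ q₂ s : Term A} (hq₁ : SimLE Step C q₁ q) (hq₂ : SimLE Step C q₂ q)
    (hq : ∀ a r, Step q a r → Step q₁ a r ∨ Step q₂ a r)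
    (hs : ∀ a r, Step s a r ↔ Step (.par p q₁) a r ∨ Step (.par p q₂) a r ∨
      ∃ x, Step p a x ∧ r = .par x q) :
    SimLE Step C (.par p q) s ∧ SimLE Step C s (.par p q) := by
  refine simLE_of_cover hC (fun a r hr => ?_) fun a r hr => ?_
  · rw [hs] at hr
    rcases hr with hr | hr | ⟨x, hx, rfl⟩
    · exact (SimLE.par hC (.refl hC.refl p) hq₁).step hr
    · exact (SimLE.par hC (.refl hC.refl p) hq₂).step hr
    · exact ⟨_, .par_left hx, .refl hC.refl _⟩
  · rw [hs]
    simp only [step_par_iff] at hr ⊢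
    grind

theorem valid_axRS : Valid (axRS A) .RS := by
  rintro e ⟨μ, ν, rfl⟩ σ
  refine simLE_pre_absorb admissible_eq (.of_subset admissible_eq.refl ?_ fun a r => ?_) μ
  · simp only [Term.subst, init_plus, init_pre]
    grind
  · simp only [Term.subst, step_plus_iff, step_pre_iff]
    grind

theorem valid_axRSP1 : Valid (axRSP1 A) .RS := by
  rintro e ⟨μ, ν, rfl⟩ σ
  have hC := admissible_eq (A := A)
  have key₁ : ∀ (μ : Act A) (x y u : Term A),
      SimLE Step Eq (.pre μ x + u) (.pre μ x + .pre μ y + u) := fun μ x y u =>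
    .of_subset hC.refl (by simp [Term.add_eq, init_plus, init_pre]) fun a r => by simp only [Term.add_eq, step_plus_iff]; grind
  have key₂ : ∀ (μ : Act A) (x y u : Term A),
      SimLE Step Eq (.pre μ y + u) (.pre μ x + .pre μ y + u) := fun μ x y u =>
    .of_subset hC.refl (by simp [Term.add_eq, init_plus, init_pre]) fun a r => by simp only [Term.add_eq, step_plus_iff]; grind
  refine simLE_par_split hC (key₁ _ _ _ _) (key₂ _ _ _ _) (key₁ _ _ _ _) (key₂ _ _ _ _) ?_ ?_ <;>
    (intro a r; simp only [Term.subst, step_plus_iff]; grind)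

theorem valid_axRSP2 : Valid (axRSP2 A) .RS := by
  rintro e ⟨m, μ, ν, -, rfl⟩ σ
  have hC := admissible_eq (A := A)
  simp only [Term.subst, Term.subst_finSum]
  refine simLE_par_split_right hC
    (q₁ := .pre ν (σ 1) + σ 3) (q₂ := .pre ν (σ 2) + σ 3)
    (.of_subset hC.refl (by simp [Term.add_eq, init_plus, init_pre]) fun a r => by simp only [Term.add_eq, step_plus_iff]; grind)
    (.of_subset hC.refl (by simp [Term.add_eq, init_plus, init_pre]) fun a r => by simp only [Term.add_eq, step_plus_iff]; grind)
    (fun a r => by simp only [Term.add_eq, step_plus_iff]; grind) fun a r => ?_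
  simp only [Term.add_eq, step_plus_iff, step_finSum_iff, step_pre_iff]
  grind

theorem emptyIff_of_mem {X Y : Set (Act A)} {a b : Act A} (hX : a ∈ X) (hY : b ∈ Y) :
    EmptyIff X Y :=
  iff_of_false (Set.nonempty_iff_ne_empty.1 ⟨a, hX⟩) (Set.nonempty_iff_ne_empty.1 ⟨b, hY⟩)

theorem emptyIff_init_pre_add (μ : Act A) (x u v : Term A) {ν : Act A} (h : ν ∈ init Step v) :
    EmptyIff (init Step (.pre μ x + u)) (init Step v) :=
  emptyIff_of_mem ⟨x, .plus_left (.pre μ x)⟩ h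

theorem valid_axCS : Valid (axCS A) .CS := by
  rintro e ⟨μ, ν, rfl⟩ σ
  refine simLE_pre_absorb admissible_emptyIff (.of_subset admissible_emptyIff.refl
    (emptyIff_init_pre_add ν _ _ _ (ν := ν) ⟨σ 0, .plus_left (.plus_left (.pre _ _))⟩)
    fun a r => ?_) μ
  simp only [Term.subst, Term.add_eq, step_plus_iff, step_pre_iff]
  grind

theorem simLE_emptyIff_left (μ ν : Act A) (x y u : Term A) :
    SimLE Step EmptyIff (.pre μ x + u) (.pre μ x + .pre ν y + u) :=
  .of_subset admissible_emptyIff.refl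
    (emptyIff_init_pre_add μ _ _ _ (ν := μ) ⟨_, .plus_left (.plus_left (.pre _ _))⟩)
    fun a r => by simp only [Term.add_eq, step_plus_iff]; grind

theorem simLE_emptyIff_right (μ ν : Act A) (x y u : Term A) :
    SimLE Step EmptyIff (.pre ν y + u) (.pre μ x + .pre ν y + u) :=
  .of_subset admissible_emptyIff.refl
    (emptyIff_init_pre_add ν _ _ _ (ν := μ) ⟨_, .plus_left (.plus_left (.pre _ _))⟩)
    fun a r => by simp only [Term.add_eq, step_plus_iff]; grind

theorem valid_axCSP1 : Valid (axCSP1 A) .CS := by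
  rintro e ⟨μ, ν, ξ, ζ, rfl⟩ σ
  refine simLE_par_split admissible_emptyIff (simLE_emptyIff_left ..) (simLE_emptyIff_right ..)
    (simLE_emptyIff_left ..) (simLE_emptyIff_right ..) ?_ ?_ <;>
    (intro a r; simp only [Term.subst, step_plus_iff]; grind)

theorem valid_axCSP2 : Valid (axCSP2 A) .CS := by
  rintro e ⟨μ, ν, ξ, rfl⟩ σ
  refine simLE_par_split_right admissible_emptyIff (simLE_emptyIff_left ν ξ (σ 1) (σ 2) (σ 3))
    (simLE_emptyIff_right ..) (fun a r => by simp only [Term.add_eq, Term.subst, step_plus_iff]; grind) fun a r => ?_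
  simp only [Term.subst, Term.add_eq, step_plus_iff, step_pre_iff]
  grind

theorem simLE_true_of_subset {p q : Term A} (h : ∀ a r, Step p a r → Step q a r) :
    SimLE Step (fun _ _ => True) p q :=
  .of_subset (fun _ => trivial) trivial h

theorem valid_axS : Valid (axS A) .S := by
  rintro e ⟨μ, rfl⟩ σ
  exact simEquiv_iff.2 (simLE_pre_absorb admissible_true
    (simLE_true_of_subset fun a r => .plus_left) μ)

theorem valid_axSP1 : Valid (axSP1 A) .S := by
  rintro e rfl σ
  refine simEquiv_iff.2 (simLE_par_split admissible_true ?_ ?_ ?_ ?_ ?_ ?_)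
  · exact simLE_true_of_subset fun a r => .plus_left
  · exact simLE_true_of_subset fun a r => .plus_right
  · exact simLE_true_of_subset fun a r => .plus_left
  · exact simLE_true_of_subset fun a r => .plus_right
  · exact fun a r => step_add_iff.1
  · exact fun a r => step_add_iff.1

theorem valid_axSP2 : Valid (axSP2 A) .S := by
  rintro e ⟨μ, rfl⟩ σ
  refine simEquiv_iff.2 (simLE_par_split_right admissible_true (q₁ := σ 1) (q₂ := σ 2) ?_ ?_ ?_
    fun a r => ?_)
  · exact simLE_true_of_subset fun a r => .plus_left
  · exact simLE_true_of_subset fun a r => .plus_right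
  · exact fun a r => step_add_iff.1
  · simp only [Term.subst, step_plus_iff, step_pre_iff]
    grind

/-! ### Linear semantics -/

theorem reach_pre {K : Set (Act A) → Prop} {μ : Act A} {t : Term A} {φ : List (Act A)} :
    Reach Step K (.pre μ t) φ ↔ (φ = [] ∧ K {μ}) ∨ ∃ ψ, φ = μ :: ψ ∧ Reach Step K t ψ := by
  cases φ with
  | nil => simp [Reach, init_pre]
  | cons a φ => simp only [Reach, step_pre_iff]; grind

theorem dtrace_pre {D : Set (Act A) → Set (Act A) → Prop} {μ : Act A} {t : Term A}
    {X : Set (Act A)} {φ : List (Act A × Set (Act A))} :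
    DTrace Step D (.pre μ t) X φ ↔
      D {μ} X ∧ (φ = [] ∨ ∃ Y ψ, φ = (μ, Y) :: ψ ∧ DTrace Step D t Y ψ) := by
  cases φ with
  | nil => simp [DTrace, init_pre]
  | cons a φ => obtain ⟨a, Y⟩ := a; simp only [DTrace, step_pre_iff, init_pre]; grind

theorem reach_pre_add_pre {K : Set (Act A) → Prop} {μ : Act A} {t u : Term A} {φ : List (Act A)} :
    Reach Step K (.pre μ t + .pre μ u) φ ↔
      (φ = [] ∧ K {μ}) ∨ ∃ ψ, φ = μ :: ψ ∧ (Reach Step K t ψ ∨ Reach Step K u ψ) := by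
  rw [reach_union (fun _ _ => step_add_iff) (by simp [Term.add_eq, init_plus, init_pre]), reach_pre, reach_pre]
  grind

theorem dtrace_pre_add_pre {D : Set (Act A) → Set (Act A) → Prop} {μ : Act A} {t u : Term A}
    {X : Set (Act A)} {φ : List (Act A × Set (Act A))} :
    DTrace Step D (.pre μ t + .pre μ u) X φ ↔ D {μ} X ∧ (φ = [] ∨
      ∃ Y ψ, φ = (μ, Y) :: ψ ∧ (DTrace Step D t Y ψ ∨ DTrace Step D u Y ψ)) := by
  rw [dtrace_union (fun _ _ => step_add_iff) (by simp [Term.add_eq, init_plus, init_pre])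
    (by simp [Term.add_eq, init_plus, init_pre]), dtrace_pre, dtrace_pre]
  grind

/-- The choice between `p₁` and `p₂` is postponed: while only `q` moves, the induction hypothesis
applies to the new `q`; once `p` moves, the residual already belongs to `p₁` or to `p₂`. The trace
may end before `p` moves, so `hK` has to hold for every `q`. -/
theorem reach_par_union {K : Set (Act A) → Prop} {p p₁ p₂ : Term A}
    (h : ∀ a r, Step p a r ↔ Step p₁ a r ∨ Step p₂ a r)
    (hK : ∀ q, K (init Step (.par p q)) ↔
      K (init Step (.par p₁ q)) ∨ K (init Step (.par p₂ q))) (q : Term A) (φ : List (Act A)) :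
    Reach Step K (.par p q) φ ↔ Reach Step K (.par p₁ q) φ ∨ Reach Step K (.par p₂ q) φ := by
  induction φ generalizing q with
  | nil => exact hK q
  | cons a φ ih =>
    simp only [Reach, step_par_iff, h]
    grind

/-- As for `reach_par_union`; equal initials make all decorations agree until the first component
moves. -/
theorem dtrace_par_union {D : Set (Act A) → Set (Act A) → Prop} {p p₁ p₂ : Term A}
    (h : ∀ a r, Step p a r ↔ Step p₁ a r ∨ Step p₂ a r)
    (h₁ : init Step p = init Step p₁) (h₂ : init Step p = init Step p₂) (q : Term A)
    (X : Set (Act A)) (φ : List (Act A × Set (Act A))) :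
    DTrace Step D (.par p q) X φ ↔ DTrace Step D (.par p₁ q) X φ ∨ DTrace Step D (.par p₂ q) X φ := by
  have h₁' : ∀ q, init Step (.par p q) = init Step (.par p₁ q) := fun q => by
    rw [init_par, init_par, h₁]
  have h₂' : ∀ q, init Step (.par p q) = init Step (.par p₂ q) := fun q => by
    rw [init_par, init_par, h₂]
  induction φ generalizing q X with
  | nil => simp only [DTrace, ← h₁', ← h₂', or_self]
  | cons a φ ih =>
    obtain ⟨a, Y⟩ := a
    simp only [DTrace, ← h₁', ← h₂', ← and_or_left]
    refine and_congr_right fun _ => ?_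
    simp only [step_par_iff, h]
    grind

/-! ### Soundness of the axioms for linear semantics -/

theorem dtrace_FP {D : Set (Act A) → Set (Act A) → Prop} (μ : Act A) (x y w z : Term A)
    (X : Set (Act A)) (φ : List (Act A × Set (Act A))) :
    DTrace Step D (.par (.pre μ x + .pre μ y + w) z) X φ ↔
      DTrace Step D (.par (.pre μ x + w) z + .par (.pre μ y + w) z) X φ := by
  have h₁ : init Step (.pre μ x + .pre μ y + w) = init Step (.pre μ x + w) := by
    simp [Term.add_eq, init_plus, init_pre]
  have h₂ : init Step (.pre μ x + .pre μ y + w) = init Step (.pre μ y + w) := by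
    simp [Term.add_eq, init_plus, init_pre]
  rw [dtrace_par_union (fun a r => by simp only [step_add_iff]; grind) h₁ h₂,
    dtrace_union (fun _ _ => step_add_iff)] <;>
  simp [Term.add_eq, init_plus, init_par, init_pre]

theorem reach_FP {K : Set (Act A) → Prop} (μ : Act A) (x y w z : Term A) (φ : List (Act A)) :
    Reach Step K (.par (.pre μ x + .pre μ y + w) z) φ ↔
      Reach Step K (.par (.pre μ x + w) z + .par (.pre μ y + w) z) φ := by
  rw [reach_par_union (p₁ := .pre μ x + w) (p₂ := .pre μ y + w)
    (fun a r => by simp only [step_add_iff]; grind),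
    reach_union (fun _ _ => step_add_iff)] <;>
  simp [Term.add_eq, init_plus, init_par, init_pre]

theorem valid_axFP_of {X : Semantics} (hX : X = .RT ∨ X = .FT ∨ X = .R ∨ X = .F) :
    Valid (axFP A) X := by
  rintro e ⟨μ, rfl⟩ σ
  rw [Semantics.equiv_iff]
  rcases hX with rfl | rfl | rfl | rfl
  · exact fun Y φ => dtrace_FP ..
  · exact fun Y φ => dtrace_FP ..
  · exact fun Y φ => reach_FP ..
  · exact fun Y φ => reach_FP ..

theorem valid_axRT : Valid (axRT A) .RT := by
  rintro e ⟨μ, ν, rfl⟩ σ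
  refine (Semantics.equiv_iff (X := .RT)).2 fun Y φ => ?_
  simp only [Term.add_eq, Term.subst, Term.subst_finSum]
  rw [dtrace_pre, ← Term.add_eq (.pre μ _) (.pre μ _), dtrace_pre_add_pre]
  have key := dtrace_union (tr := Step) (D := fun I Y => I = Y)
    (r := Term.plus (Term.finSum fun i => .plus (.pre (ν i) (σ (2 * i + 1)))
      (.pre (ν i) (σ (2 * i + 2)))) (σ 0))
    (p := Term.plus (Term.finSum fun i => .pre (ν i) (σ (2 * i + 1))) (σ 0))
    (q := Term.plus (Term.finSum fun i => .pre (ν i) (σ (2 * i + 2))) (σ 0))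
    (fun a t => by simp only [step_plus_iff, step_finSum_iff, exists_or]; grind)
    (by ext a; simp [init, step_plus_iff, step_finSum_iff, step_pre_iff]; grind)
    (by ext a; simp [init, step_plus_iff, step_finSum_iff, step_pre_iff]; grind)
  simp only [key]

theorem valid_axFT : Valid (axFT A) .FT := by
  rintro e ⟨μ, rfl⟩ σ
  refine (Semantics.equiv_iff (X := .FT)).2 fun Y φ => ?_
  simp only [Term.subst]
  rw [dtrace_union (fun _ _ => step_plus_iff (t := .plus _ _)) (by simp [init_plus, init_pre])
    (by simp [init_plus, init_pre]), ← Term.add_eq, dtrace_pre_add_pre, dtrace_pre]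
  -- What the sum refuses is refused by both summands, and its first transition belongs to one of
  -- them. Hence each failure trace of the sum is one of a summand.
  have key : ∀ Y φ, DTrace Step (fun I Y => I ∩ Y = ∅) (.plus (σ 0) (σ 1)) Y φ →
      DTrace Step (fun I Y => I ∩ Y = ∅) (σ 0) Y φ ∨
        DTrace Step (fun I Y => I ∩ Y = ∅) (σ 1) Y φ := by
    intro Y φ h
    cases φ with
    | nil =>
      simp only [DTrace, init_plus, Set.union_inter_distrib_right, Set.union_empty_iff] at h
      exact Or.inl h.1
    | cons a φ =>
      simp only [DTrace, init_plus, Set.union_inter_distrib_right, Set.union_empty_iff,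
        step_plus_iff] at h ⊢
      grind
  grind

/-- The first action `ν` into `y` is also offered by the second process, and adding a `ν`-branch to
a process that has one leaves its initials unchanged. -/
theorem reach_axR {K : Set (Act A) → Prop} (ν : Act A) (x y z w : Term A) (φ : List (Act A)) :
    Reach Step K (.pre ν x + z) φ ∨ Reach Step K (.pre ν y + w) φ ↔
      Reach Step K (.pre ν x + .pre ν y + z) φ ∨ Reach Step K (.pre ν y + w) φ := by
  cases φ with
  | nil => simp [Reach, Term.add_eq, init_plus, init_pre]
  | cons a φ => simp only [Reach, Term.add_eq, step_plus_iff]; grind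

theorem valid_axR_of {X : Semantics} (hX : X = .R ∨ X = .F) : Valid (axR A) X := by
  rintro e ⟨μ, ν, rfl⟩ σ
  rw [Semantics.equiv_iff]
  have key : ∀ (K : Set (Act A) → Prop) φ,
      Reach Step K (.pre μ (.pre ν (σ 0) + σ 2) + .pre μ (.pre ν (σ 1) + σ 3)) φ ↔
      Reach Step K (.pre μ (.pre ν (σ 0) + .pre ν (σ 1) + σ 2) + .pre μ (.pre ν (σ 1) + σ 3)) φ := by
    intro K φ
    simp only [reach_pre_add_pre, reach_axR]
  rcases hX with rfl | rfl
  · exact fun Y φ => key _ φ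
  · exact fun Y φ => key _ φ

theorem valid_axF : Valid (axF A) .F := by
  rintro e ⟨μ, rfl⟩ σ
  refine (Semantics.equiv_iff (X := .F)).2 fun Y φ => ?_
  change Reach Step _ (.pre μ (σ 0) + .pre μ (σ 1 + σ 2)) φ ↔
    Reach Step _ (.pre μ (σ 0) + .pre μ (σ 0 + σ 1) + .pre μ (σ 1 + σ 2)) φ
  rw [reach_union (tr := Step) (p := .pre μ (σ 0) + .pre μ (σ 0 + σ 1)) (q := .pre μ (σ 1 + σ 2))
    (r := .pre μ (σ 0) + .pre μ (σ 0 + σ 1) + .pre μ (σ 1 + σ 2))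
    (fun _ _ => step_add_iff) (by simp [Term.add_eq, init_plus, init_pre]), reach_pre_add_pre,
    reach_pre_add_pre, reach_pre]
  -- A refusal of `σ 0 + σ 1` is a refusal of `σ 0`, and a nonempty trace starts in `σ 0` or in `σ
  -- 1`.
  have key : ∀ φ, Reach Step (fun I => I ∩ Y = ∅) (σ 0 + σ 1) φ →
      Reach Step (fun I => I ∩ Y = ∅) (σ 0) φ ∨
        Reach Step (fun I => I ∩ Y = ∅) (σ 1 + σ 2) φ := by
    intro φ h
    cases φ with
    | nil =>
      simp only [Reach, Term.add_eq, init_plus, Set.union_inter_distrib_right,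
        Set.union_empty_iff] at h
      exact Or.inl h.1
    | cons a φ =>
      simp only [Reach, Term.add_eq, step_plus_iff] at h ⊢
      grind
  grind

theorem insert_eq_empty_iff {a : Act A} {X : Set (Act A)} : insert a X = ∅ ↔ False :=
  iff_false_intro (Set.insert_nonempty a X).ne_empty

/-- Neither form of `K` distinguishes one nonempty set of initials from another, and every process
below the prefix `μ` has an initial action. -/
theorem reach_axCT {K : Set (Act A) → Prop}
    (hK : (∀ X, K X) ∨ K = fun X => X = ∅) (μ ν ξ : Act A) (x y z w : Term A) (φ : List (Act A)) :
    Reach Step K (.pre μ (.pre ν x + z) + .pre μ (.pre ξ y + w)) φ ↔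
      Reach Step K (.pre μ (.pre ν x + .pre ξ y + z + w)) φ := by
  simp only [reach_pre_add_pre, reach_pre]
  have key : ∀ φ, Reach Step K (.pre ν x + .pre ξ y + z + w) φ ↔
      Reach Step K (.pre ν x + z) φ ∨ Reach Step K (.pre ξ y + w) φ := by
    refine reach_union (fun a t => by simp only [step_add_iff]; grind) ?_
    rcases hK with hK | rfl
    · simp [hK]
    · simp [Term.add_eq, init_plus, init_pre, insert_eq_empty_iff]
  simp only [key]

theorem valid_axCT : Valid (axCT A) .CT := by
  rintro e ⟨μ, ν, ξ, rfl⟩ σ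
  refine (Semantics.equiv_iff (X := .CT)).2 ⟨fun φ => ?_, fun φ => ?_⟩
  · exact reach_axCT (Or.inl fun _ => trivial) ..
  · exact reach_axCT (Or.inr rfl) ..

theorem valid_axCTP : Valid (axCTP A) .CT := by
  rintro e ⟨μ, ν, rfl⟩ σ
  have key : ∀ K : Set (Act A) → Prop, ((∀ X, K X) ∨ K = fun X => X = ∅) → ∀ φ,
      Reach Step K (.par (.pre μ (σ 0) + .pre ν (σ 1) + σ 3) (σ 2)) φ ↔
        Reach Step K (.par (.pre μ (σ 0) + σ 3) (σ 2) + .par (.pre ν (σ 1) + σ 3) (σ 2)) φ := by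
    intro K hK φ
    rw [reach_par_union (p₁ := .pre μ (σ 0) + σ 3) (p₂ := .pre ν (σ 1) + σ 3)
      (fun a r => by simp only [step_add_iff]; grind),
      reach_union (fun _ _ => step_add_iff)] <;>
    rcases hK with hK | rfl <;>
    simp [Term.add_eq, init_plus, init_par, init_pre, parInit_eq_empty, insert_eq_empty_iff, *]
  exact (Semantics.equiv_iff (X := .CT)).2
    ⟨key _ (Or.inl fun _ => trivial), key _ (Or.inr rfl)⟩

theorem valid_axT : Valid (axT A) .T := by
  rintro e ⟨μ, rfl⟩ σ
  refine (Semantics.equiv_iff (X := .T)).2 fun φ => ?_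
  change Reach Step _ (.pre μ (σ 0) + .pre μ (σ 1)) φ ↔ Reach Step _ (.pre μ (σ 0 + σ 1)) φ
  rw [reach_pre_add_pre, reach_pre]
  simp only [reach_union (K := fun _ => True) (fun a t => step_add_iff (t := σ 0) (u := σ 1))
    (or_self_iff (a := True)).symm]

theorem valid_axTP : Valid (axTP A) .T := by
  rintro e rfl σ
  refine (Semantics.equiv_iff (X := .T)).2 fun φ => ?_
  change Reach Step _ (.par (σ 0 + σ 1) (σ 2)) φ ↔
    Reach Step _ (.par (σ 0) (σ 2) + .par (σ 1) (σ 2)) φ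
  rw [reach_par_union (fun a t => step_add_iff) (fun _ => (or_self_iff (a := True)).symm),
    reach_union (fun a t => step_add_iff) (or_self_iff (a := True)).symm]

theorem valid_axiomSystem (X : Semantics) : Valid (axiomSystem A X) X := by
  have hE := valid_E1 (A := A)
  cases X
  · exact ((((hE _).union valid_axRS).union valid_axRSP1).union valid_axRSP2).union (valid_axEL2 _)
  · exact ((((hE _).union valid_axCS).union valid_axCSP1).union valid_axCSP2).union (valid_axEL1 _)
  · exact ((((hE _).union valid_axS).union valid_axSP1).union valid_axSP2).union (valid_axEL1 _)
  · exact (((hE _).union valid_axRT).union (valid_axFP_of (by simp))).union (valid_axEL2 _)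
  · refine ((((hE _).union valid_axFT).union fun e he σ => ?_).union
      (valid_axFP_of (by simp))).union (valid_axEL2 _)
    -- RS is sound for ready simulation equivalence, which is finer than failure trace equivalence.
    have := valid_axRS e he σ
    exact equiv_of_simLE this.1 this.2 _
  · exact (((hE _).union (valid_axR_of (by simp))).union (valid_axFP_of (by simp))).union
      (valid_axEL2 _)
  · exact ((((hE _).union valid_axF).union (valid_axR_of (by simp))).union
      (valid_axFP_of (by simp))).union (valid_axEL2 _)
  · exact (((hE _).union valid_axCT).union valid_axCTP).union (valid_axEL1 _)
  · exact (((hE _).union valid_axT).union valid_axTP).union (valid_axEL1 _)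

theorem Step.closed {t t' : Term A} {μ : Act A} (h : Step t μ t') (ht : t.Closed) : t'.Closed := by
  induction h with
  | pre μ t => exact ht
  | plus_left _ ih => exact ih ht.1
  | plus_right _ ih => exact ih ht.2
  | par_left _ ih => exact ⟨ih ht.1, ht.2⟩
  | par_right _ ih => exact ⟨ht.1, ih ht.2⟩
  | comm _ _ _ ih ih' => exact ⟨ih ht.1, ih' ht.2⟩

theorem isFunctionalBisim_val : IsFunctionalBisim (Proc.tr (A := A)) Step Subtype.val where
  forth h := h
  back {p _ r} h := ⟨⟨r, h.closed p.2⟩, h, rfl⟩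

theorem sound_axiomSystem (X : Semantics) : Sound (axiomSystem A X) (X.Equiv Proc.tr) :=
  fun e he _ => (isFunctionalBisim_val.equiv_iff X).1 (valid_axiomSystem X e he _)

end CCS

/-! ## Finiteness of the axiom systems -/

namespace CCS

universe u
variable {A : Type u}

instance [Finite A] : Finite (Act A) := by
  refine Finite.of_injective (β := Option (A ⊕ A)) (fun
    | .tau => none
    | .name a => some (.inl a)
    | .coname a => some (.inr a)) ?_
  intro a b h
  cases a <;> cases b <;> simp_all

theorem finite_setOf_eq_range {ι α : Type*} [Finite ι] (f : ι → α) {s : Set α}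
    (h : ∀ e ∈ s, ∃ i, f i = e) : s.Finite :=
  (Set.finite_range f).subset h

theorem finite_E1 : (E1 A).Finite := by
  simp only [E1, E0, axA0, axA1, axA2, axA3, axP0, axP1, Set.finite_union, Set.finite_singleton,
    and_self]

variable [Finite A]

theorem finite_of_exists_and {α : Type*} (P : Act A → Act A → Prop) (f : Act A → Act A → α) :
    {e | ∃ μ ν, P μ ν ∧ e = f μ ν}.Finite :=
  finite_setOf_eq_range (fun p : Act A × Act A => f p.1 p.2)
    fun _ ⟨μ, ν, _, h⟩ => ⟨(μ, ν), h.symm⟩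

theorem finite_axEL1 : (axEL1 A).Finite :=
  (finite_of_exists_and (fun μ ν => ¬ μ.Compl ν) _).union (finite_of_exists_and Act.Compl _)

/-- Distinct labels bound the number of summands. This is what makes the schemata EL2 and RSP2
finite. -/
theorem lt_of_injective {m : ℕ} {μ : Fin m → Act A} (h : Function.Injective μ) :
    m < Nat.card (Act A) + 1 := by
  simpa using Nat.lt_succ_of_le (Nat.card_le_card_of_injective _ h)

theorem finite_axEL2 : (axEL2 A).Finite := by
  have key {α : Type u} (f : (m n : ℕ) → (Fin m → Act A) → (Fin n → Act A) → α) :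
      {e | ∃ m n μ ν, Function.Injective μ ∧ Function.Injective ν ∧ e = f m n μ ν}.Finite :=
    finite_setOf_eq_range (ι := Σ (m n : Fin (Nat.card (Act A) + 1)),
      (Fin m → Act A) × (Fin n → Act A)) (fun i => f i.1 i.2.1 i.2.2.1 i.2.2.2)
      fun _ ⟨m, n, μ, ν, hμ, hν, h⟩ =>
        ⟨⟨⟨m, lt_of_injective hμ⟩, ⟨n, lt_of_injective hν⟩, μ, ν⟩, h.symm⟩
  exact key _

theorem finite_axRSP2 : (axRSP2 A).Finite := by
  have key {α : Type u} (f : (m : ℕ) → (Fin m → Act A) → Act A → α) :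
      {e | ∃ m μ ν, Function.Injective μ ∧ e = f m μ ν}.Finite :=
    finite_setOf_eq_range (ι := Σ (m : Fin (Nat.card (Act A) + 1)), (Fin m → Act A) × Act A)
      (fun i => f i.1 i.2.1 i.2.2) fun _ ⟨m, μ, ν, hμ, h⟩ =>
        ⟨⟨⟨m, lt_of_injective hμ⟩, μ, ν⟩, h.symm⟩
  exact key _

theorem finite_axRT : (axRT A).Finite := by
  have key {α : Type u} (f : Act A → (Fin (Nat.card (Act A)) → Act A) → α) :
      {e | ∃ μ ν, e = f μ ν}.Finite :=
    finite_setOf_eq_range (fun i : Act A × (Fin (Nat.card (Act A)) → Act A) => f i.1 i.2)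
      fun _ ⟨μ, ν, h⟩ => ⟨(μ, ν), h.symm⟩
  exact key _

theorem finite_of_exists₁ {α : Type*} (f : Act A → α) : {e | ∃ μ, e = f μ}.Finite :=
  finite_setOf_eq_range f fun _ ⟨μ, h⟩ => ⟨μ, h.symm⟩

theorem finite_of_exists₂ {α : Type*} (f : Act A → Act A → α) : {e | ∃ μ ν, e = f μ ν}.Finite :=
  finite_setOf_eq_range (fun p : Act A × Act A => f p.1 p.2) fun _ ⟨μ, ν, h⟩ => ⟨(μ, ν), h.symm⟩

theorem finite_of_exists₃ {α : Type*} (f : Act A → Act A → Act A → α) :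
    {e | ∃ μ ν ξ, e = f μ ν ξ}.Finite :=
  finite_setOf_eq_range (fun p : Act A × Act A × Act A => f p.1 p.2.1 p.2.2)
    fun _ ⟨μ, ν, ξ, h⟩ => ⟨(μ, ν, ξ), h.symm⟩

theorem finite_of_exists₄ {α : Type*} (f : Act A → Act A → Act A → Act A → α) :
    {e | ∃ μ ν ξ ζ, e = f μ ν ξ ζ}.Finite :=
  finite_setOf_eq_range (fun p : Act A × Act A × Act A × Act A => f p.1 p.2.1 p.2.2.1 p.2.2.2)
    fun _ ⟨μ, ν, ξ, ζ, h⟩ => ⟨(μ, ν, ξ, ζ), h.symm⟩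

theorem finite_axiomSystem (X : Semantics) : (axiomSystem A X).Finite := by
  have h := finite_E1 (A := A)
  cases X
  · exact (((h.union (finite_of_exists₂ _)).union (finite_of_exists₂ _)).union finite_axRSP2).union
      finite_axEL2
  · exact (((h.union (finite_of_exists₂ _)).union (finite_of_exists₄ _)).union
      (finite_of_exists₃ _)).union finite_axEL1
  · exact (((h.union (finite_of_exists₁ _)).union (Set.finite_singleton _)).union
      (finite_of_exists₁ _)).union finite_axEL1
  · exact ((h.union finite_axRT).union (finite_of_exists₁ _)).union finite_axEL2
  · exact (((h.union (finite_of_exists₁ _)).union (finite_of_exists₂ _)).union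
      (finite_of_exists₁ _)).union finite_axEL2
  · exact ((h.union (finite_of_exists₂ _)).union (finite_of_exists₁ _)).union finite_axEL2
  · exact (((h.union (finite_of_exists₁ _)).union (finite_of_exists₂ _)).union
      (finite_of_exists₁ _)).union finite_axEL2
  · exact ((h.union (finite_of_exists₃ _)).union (finite_of_exists₂ _)).union finite_axEL1
  · exact ((h.union (finite_of_exists₁ _)).union (Set.finite_singleton _)).union finite_axEL1

end CCS

/-! ## Synchronisation trees -/

namespace CCS

universe u
variable {A : Type u}

open LTS

/-- Finite synchronisation trees; `cons μ t s` is `μ.t + s`. -/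
inductive Tree (A : Type u) : Type u
  | nil : Tree A
  | cons (μ : Act A) (t s : Tree A) : Tree A

namespace Tree

/-- The branches at the root. -/
def branches : Tree A → List (Act A × Tree A)
  | nil => []
  | cons μ t s => (μ, t) :: s.branches

def ofList : List (Act A × Tree A) → Tree A
  | [] => nil
  | (μ, t) :: l => cons μ t (ofList l)

@[simp]
theorem branches_ofList (l : List (Act A × Tree A)) : (ofList l).branches = l := by
  induction l with
  | nil => rfl
  | cons a l ih => simp [ofList, branches, ih]

/-- The number of edges. It does not depend on the order of the branches, so inductions on it may
permute them. -/
def size : Tree A → ℕ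
  | nil => 0
  | cons _ t s => t.size + s.size + 1

/-- The transition relation of trees. -/
def tr (s : Tree A) (μ : Act A) (t : Tree A) : Prop := (μ, t) ∈ s.branches

@[simp]
theorem tr_nil {ν : Act A} {r : Tree A} : tr nil ν r ↔ False := by simp [tr, branches]

@[simp]
theorem tr_cons {μ ν : Act A} {t s r : Tree A} :
    tr (cons μ t s) ν r ↔ (ν = μ ∧ r = t) ∨ tr s ν r := by simp [tr, branches]

theorem tr_ofList {l : List (Act A × Tree A)} {ν : Act A} {r : Tree A} :
    tr (ofList l) ν r ↔ (ν, r) ∈ l := by rw [tr, branches_ofList]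

theorem size_lt_of_tr {s t : Tree A} {μ : Act A} (h : tr s μ t) : t.size < s.size := by
  induction s with
  | nil => simp at h
  | cons ν r s _ ih =>
    rcases tr_cons.1 h with ⟨-, rfl⟩ | h
    · simp only [size]; omega
    · have := ih h
      simp only [size]; omega

theorem tr_induction {motive : Tree A → Prop}
    (h : ∀ s, (∀ μ t, tr s μ t → motive t) → motive s) (s : Tree A) : motive s := by
  induction hn : s.size using Nat.strong_induction_on generalizing s with
  | _ n ih =>
    exact h s fun μ t ht => ih _ (hn ▸ size_lt_of_tr ht) t rfl

def append : Tree A → Tree A → Tree A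
  | nil, t => t
  | cons μ r s, t => cons μ r (append s t)

@[simp]
theorem tr_append {s t r : Tree A} {ν : Act A} : tr (append s t) ν r ↔ tr s ν r ∨ tr t ν r := by
  induction s with
  | nil => simp [append]
  | cons μ r s _ ih => simp [append, ih, or_assoc]

open Classical in
/-- The parallel composition of trees, according to the expansion law. -/
noncomputable def par (s t : Tree A) : Tree A :=
  ofList ((s.branches.attach.map fun b => (b.1.1, par b.1.2 t)) ++
    (t.branches.attach.map fun c => (c.1.1, par s c.1.2)) ++
    (s.branches.attach.flatMap fun b => (t.branches.attach.filter fun c => b.1.1.Compl c.1.1).map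
      fun c => (.tau, par b.1.2 c.1.2)))
termination_by s.size + t.size
decreasing_by
  · exact Nat.add_lt_add_right (size_lt_of_tr b.2) _
  · exact Nat.add_lt_add_left (size_lt_of_tr c.2) _
  · exact Nat.add_lt_add (size_lt_of_tr b.2) (size_lt_of_tr c.2)

theorem tr_par {s t r : Tree A} {a : Act A} : tr (par s t) a r ↔
    (∃ s', tr s a s' ∧ r = par s' t) ∨ (∃ t', tr t a t' ∧ r = par s t') ∨
      ∃ s' t' α β, Act.Compl α β ∧ tr s α s' ∧ tr t β t' ∧ a = .tau ∧ r = par s' t' := by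
  rw [par, tr_ofList]
  simp only [List.mem_append, List.mem_map, List.mem_attach, true_and, Subtype.exists, Prod.exists,
    List.mem_flatMap, List.mem_filter, decide_eq_true_eq, tr, Prod.mk.injEq]
  grind

/-- The tree of transitions of a term. -/
noncomputable def ofTerm : Term A → Tree A
  | .nil => nil
  | .var _ => nil
  | .pre μ t => cons μ (ofTerm t) nil
  | .plus t u => append (ofTerm t) (ofTerm u)
  | .par t u => par (ofTerm t) (ofTerm u)

theorem tr_ofTerm {p : Term A} {a : Act A} {r : Tree A} :
    tr (ofTerm p) a r ↔ ∃ q, Step p a q ∧ ofTerm q = r := by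
  induction p generalizing a r with
  | nil => simp [ofTerm, step_nil_iff]
  | var n => simp [ofTerm, step_var_iff]
  | pre μ t => simp [ofTerm, step_pre_iff]; grind
  | plus t u iht ihu => simp only [ofTerm, tr_append, iht, ihu, step_plus_iff]; grind
  | par t u iht ihu =>
    simp only [ofTerm, tr_par, iht, ihu, step_par_iff]
    constructor
    · rintro (⟨_, ⟨q, h, rfl⟩, rfl⟩ | ⟨_, ⟨q, h, rfl⟩, rfl⟩ |
        ⟨_, _, α, β, hc, ⟨q, h, rfl⟩, ⟨q', h', rfl⟩, ha, rfl⟩)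
      · exact ⟨_, Or.inl ⟨q, h, rfl⟩, rfl⟩
      · exact ⟨_, Or.inr (Or.inl ⟨q, h, rfl⟩), rfl⟩
      · exact ⟨_, Or.inr (Or.inr ⟨q, q', α, β, hc, h, h', ha, rfl⟩), rfl⟩
    · rintro ⟨_, ⟨q, h, rfl⟩ | ⟨q, h, rfl⟩ | ⟨q, q', α, β, hc, h, h', ha, rfl⟩, rfl⟩
      · exact Or.inl ⟨_, ⟨q, h, rfl⟩, rfl⟩
      · exact Or.inr (Or.inl ⟨_, ⟨q, h, rfl⟩, rfl⟩)
      · exact Or.inr (Or.inr ⟨_, _, α, β, hc, ⟨q, h, rfl⟩, ⟨q', h', rfl⟩, ha, rfl⟩)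

theorem isFunctionalBisim_ofProc :
    IsFunctionalBisim (Proc.tr (A := A)) tr fun p => ofTerm p.1 where
  forth h := tr_ofTerm.2 ⟨_, h, rfl⟩
  back {p _ r} h := by
    obtain ⟨q, hq, rfl⟩ := tr_ofTerm.1 h
    exact ⟨⟨q, hq.closed p.2⟩, hq, rfl⟩

end Tree

end CCS

/-! ## The algebra of terms modulo derivability -/

namespace CCS

universe u
variable {A : Type u}

def derivableSetoid (A : Type u) (X : Semantics) : Setoid (Term A) where
  r := Derivable (axiomSystem A X)
  iseqv := ⟨.refl, .symm, .trans⟩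

/-- Terms modulo the equations that are derivable from the axiom system of `X`. -/
def Alg (A : Type u) (X : Semantics) : Type u := Quotient (derivableSetoid A X)

namespace Alg

variable {X : Semantics}

def mk (t : Term A) : Alg A X := Quotient.mk _ t

theorem mk_eq_mk {t u : Term A} :
    (mk t : Alg A X) = mk u ↔ Derivable (axiomSystem A X) t u :=
  ⟨Quotient.exact, fun h => Quotient.sound h⟩

def add : Alg A X → Alg A X → Alg A X :=
  Quotient.map₂ .plus fun _ _ h _ _ h' => Derivable.plus h h'

instance : Bot (Alg A X) := ⟨mk .nil⟩

def pre (μ : Act A) : Alg A X → Alg A X := Quotient.map (.pre μ) fun _ _ h => Derivable.pre μ h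

def par : Alg A X → Alg A X → Alg A X :=
  Quotient.map₂ .par fun _ _ h _ _ h' => Derivable.par h h'

/-- The value of a term under a valuation of the variables. -/
def eval (ρ : ℕ → Alg A X) : Term A → Alg A X
  | .nil => ⊥
  | .var n => ρ n
  | .pre μ t => pre μ (eval ρ t)
  | .plus t u => add (eval ρ t) (eval ρ u)
  | .par t u => par (eval ρ t) (eval ρ u)

theorem mk_subst (σ : ℕ → Term A) (t : Term A) :
    (mk (t.subst σ) : Alg A X) = eval (fun n => mk (σ n)) t := by
  induction t with
  | nil => rfl
  | var n => rfl
  | pre μ t ih => exact congrArg (pre μ) ih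
  | plus t u iht ihu => exact congrArg₂ add iht ihu
  | par t u iht ihu => exact congrArg₂ par iht ihu

/-- The axioms hold in the algebra. -/
theorem eval_eq {e : Equation A} (he : e ∈ axiomSystem A X) (ρ : ℕ → Alg A X) :
    eval ρ e.lhs = eval ρ e.rhs := by
  have hρ : (fun n => mk (Quotient.out (ρ n))) = ρ := funext fun n => Quotient.out_eq _
  rw [← hρ, ← mk_subst, ← mk_subst, mk_eq_mk]
  exact .subst _ (.ax he)

/-- The valuation that maps the first variables to the elements of a list. -/
def valuation (l : List (Alg A X)) (n : ℕ) : Alg A X := l.getD n ⊥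

theorem E1_subset (X : Semantics) : E1 A ⊆ axiomSystem A X := by
  cases X <;> intro e he <;> simp only [axiomSystem, Set.mem_union, he, true_or]

/-- Axioms are instantiated by listing the values of the variables `0, 1, 2, …`; the stated equation
then follows by computing both sides. -/
theorem add_comm (x y : Alg A X) : add x y = add y x :=
  eval_eq (E1_subset X (Or.inl (Or.inl (Or.inl (Or.inl (Or.inr rfl)))))) (valuation [x, y])

theorem add_assoc (x y z : Alg A X) : add (add x y) z = add x (add y z) :=
  eval_eq (E1_subset X (Or.inl (Or.inl (Or.inl (Or.inr rfl))))) (valuation [x, y, z])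

theorem add_self (x : Alg A X) : add x x = x :=
  eval_eq (E1_subset X (Or.inl (Or.inl (Or.inr rfl)))) (valuation [x])

/-- `a ≤ b` means that `a + b ≈ b` is derivable, so equational derivations become order arguments.
-/
instance : SemilatticeSup (Alg A X) :=
  letI : Max (Alg A X) := ⟨add⟩
  SemilatticeSup.mk' add_comm add_assoc add_self

theorem sup_bot (x : Alg A X) : x ⊔ ⊥ = x :=
  eval_eq (E1_subset X (Or.inl (Or.inl (Or.inl (Or.inl (Or.inl rfl)))))) (valuation [x])

instance : OrderBot (Alg A X) where
  bot_le x := by rw [← sup_eq_right, sup_comm]; exact sup_bot x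

theorem par_bot (x : Alg A X) : par x ⊥ = x :=
  eval_eq (E1_subset X (Or.inl (Or.inr rfl))) (valuation [x])

theorem par_comm (x y : Alg A X) : par x y = par y x :=
  eval_eq (E1_subset X (Or.inr rfl)) (valuation [x, y])

theorem bot_par (x : Alg A X) : par ⊥ x = x := by rw [par_comm, par_bot]

theorem eval_add (ρ : ℕ → Alg A X) (t u : Term A) : eval ρ (t + u) = eval ρ t ⊔ eval ρ u := rfl

theorem eval_zero (ρ : ℕ → Alg A X) : eval ρ (0 : Term A) = ⊥ := rfl

/-- Testing sums against upper bounds avoids all bookkeeping of bracketing, order and empty sums. -/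
theorem eval_sum_le_iff {ρ : ℕ → Alg A X} {l : List (Term A)} {m : Alg A X} :
    eval ρ (Term.sum l) ≤ m ↔ ∀ t ∈ l, eval ρ t ≤ m := by
  fun_induction Term.sum l with
  | case1 => simp [eval_zero]
  | case2 t => simp
  | case3 t u l ih => simp [eval_add, ih]

theorem eval_finSum_le_iff {ρ : ℕ → Alg A X} {k : ℕ} {t : Fin k → Term A} {m : Alg A X} :
    eval ρ (Term.finSum t) ≤ m ↔ ∀ i, eval ρ (t i) ≤ m := by
  simp [Term.finSum, eval_sum_le_iff, List.mem_ofFn]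

/-! ### The values of trees -/

/-- The element of the algebra that a tree represents. -/
def ev : Tree A → Alg A X
  | .nil => ⊥
  | .cons μ t s => pre μ (ev t) ⊔ ev s

theorem ev_le_iff {s : Tree A} {m : Alg A X} :
    ev s ≤ m ↔ ∀ μ t, s.tr μ t → pre μ (ev t) ≤ m := by
  induction s with
  | nil => simp [ev]
  | cons μ t s _ ih =>
    simp only [ev, sup_le_iff, ih, Tree.tr_cons]
    grind

theorem pre_le_ev {s t : Tree A} {μ : Act A} (h : s.tr μ t) :
    pre μ (ev t) ≤ (ev s : Alg A X) := ev_le_iff.1 le_rfl μ t h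

theorem ev_mono {s t : Tree A} (h : ∀ μ r, s.tr μ r → t.tr μ r) : (ev s : Alg A X) ≤ ev t :=
  ev_le_iff.2 fun μ r hr => pre_le_ev (h μ r hr)

theorem ev_congr {s t : Tree A} (h : ∀ μ r, s.tr μ r ↔ t.tr μ r) : (ev s : Alg A X) = ev t :=
  le_antisymm (ev_mono fun μ r => (h μ r).1) (ev_mono fun μ r => (h μ r).2)

theorem ev_append (s t : Tree A) : (ev (s.append t) : Alg A X) = ev s ⊔ ev t := by
  induction s with
  | nil => simp [Tree.append, ev]
  | cons μ r s _ ih => simp [Tree.append, ev, ih, sup_assoc]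

/-- If adding a single branch of `t` does not lead out of the elements below `m`, then neither
does adding `t`. -/
theorem pre_sup_ev_le {μ : Act A} {x m : Alg A X} {t : Tree A} (hx : pre μ x ≤ m)
    (h : ∀ ν r, t.tr ν r → ∀ z, x ≤ z → pre μ z ≤ m → pre μ (z ⊔ pre ν (ev r)) ≤ m) :
    pre μ (x ⊔ ev t) ≤ m := by
  induction t with
  | nil => simpa [ev] using hx
  | cons ν r t _ ih =>
    have h' := ih fun ν' r' hr => h ν' r' (Tree.tr_cons.2 (Or.inr hr))
    have := h ν r (Tree.tr_cons.2 (Or.inl ⟨rfl, rfl⟩)) _ le_sup_left h'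
    rwa [sup_assoc, sup_comm (ev t)] at this

/-! ### The expansion law -/

/-- The summands of the expansion of `s ∥ t` are below `m`. -/
def ExpansionLE (s t : Tree A) (m : Alg A X) : Prop :=
  (∀ μ s', s.tr μ s' → pre μ (par (ev s') (ev t)) ≤ m) ∧
  (∀ ν t', t.tr ν t' → pre ν (par (ev s) (ev t')) ≤ m) ∧
  ∀ μ s' ν t', s.tr μ s' → t.tr ν t' → Act.Compl μ ν → pre .tau (par (ev s') (ev t')) ≤ m

/-- The expansion law holds for `s` and `t`. -/
def Expands (X : Semantics) (s t : Tree A) : Prop :=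
  ∀ m : Alg A X, par (ev s) (ev t) ≤ m ↔ ExpansionLE s t m

theorem ExpansionLE.symm {s t : Tree A} {m : Alg A X} (h : ExpansionLE s t m) :
    ExpansionLE t s m := by
  refine ⟨fun μ t' ht => ?_, fun ν s' hs => ?_, fun μ t' ν s' ht hs hc => ?_⟩ <;> rw [par_comm]
  exacts [h.2.1 μ t' ht, h.1 ν s' hs, h.2.2 ν s' μ t' hs ht hc.symm]

theorem Expands.symm {s t : Tree A} (h : Expands X s t) : Expands X t s := fun m => by
  rw [par_comm, h m]
  exact ⟨.symm, .symm⟩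

theorem Expands.congr_left {s s₀ t : Tree A} (h : ∀ μ r, s.tr μ r ↔ s₀.tr μ r)
    (hs : Expands X s₀ t) : Expands X s t := fun m => by
  simp only [ExpansionLE, ev_congr h, h]
  exact hs m

/-- By `ih` the residuals of a transition are already trees, so the summands of the expansion are
exactly the branches of `s.par t`. This translates between upper bounds, in which the axioms are
convenient, and trees. -/
theorem expands_iff {s t : Tree A} (ih : ∀ s' t' : Tree A, s'.size + t'.size < s.size + t.size →
    par (ev s') (ev t') = (ev (s'.par t') : Alg A X)) :
    Expands X s t ↔ par (ev s) (ev t) = (ev (s.par t) : Alg A X) := by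
  have key : ∀ m : Alg A X, ev (s.par t) ≤ m ↔ ExpansionLE s t m := by
    intro m
    rw [ev_le_iff]
    constructor
    · intro h
      refine ⟨fun μ s' hs => ?_, fun ν t' ht => ?_, fun μ s' ν t' hs ht hc => ?_⟩
      · rw [ih _ _ (by have := Tree.size_lt_of_tr hs; omega)]
        exact h _ _ (Tree.tr_par.2 (Or.inl ⟨_, hs, rfl⟩))
      · rw [ih _ _ (by have := Tree.size_lt_of_tr ht; omega)]
        exact h _ _ (Tree.tr_par.2 (Or.inr (Or.inl ⟨_, ht, rfl⟩)))
      · rw [ih _ _ (by have := Tree.size_lt_of_tr hs; have := Tree.size_lt_of_tr ht; omega)]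
        exact h _ _ (Tree.tr_par.2 (Or.inr (Or.inr ⟨_, _, _, _, hc, hs, ht, rfl, rfl⟩)))
    · intro h μ r hr
      rcases Tree.tr_par.1 hr with ⟨s', hs, rfl⟩ | ⟨t', ht, rfl⟩ |
        ⟨s', t', α, β, hc, hs, ht, rfl, rfl⟩
      · rw [← ih _ _ (by have := Tree.size_lt_of_tr hs; omega)]
        exact h.1 _ _ hs
      · rw [← ih _ _ (by have := Tree.size_lt_of_tr ht; omega)]
        exact h.2.1 _ _ ht
      · rw [← ih _ _ (by have := Tree.size_lt_of_tr hs; have := Tree.size_lt_of_tr ht; omega)]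
        exact h.2.2 _ _ _ _ hs ht hc
  constructor
  · exact fun h => eq_of_forall_ge_iff fun m => (h m).trans (key m).symm
  · exact fun h m => by rw [h, key]

/-! ### Splitting summands with related labels -/

/-- No two branches have labels related by `r`. -/
def Simple (r : Act A → Act A → Prop) (s : Tree A) : Prop :=
  s.branches.Pairwise fun b c => ¬ r b.1 c.1

theorem exists_cons_of_tr {s t : Tree A} {μ : Act A} (h : s.tr μ t) : ∃ w,
    (Tree.cons μ t w).size = s.size ∧ ∀ a x, s.tr a x ↔ (Tree.cons μ t w).tr a x := by
  induction s with
  | nil => simp at h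
  | cons ν r s _ ih =>
    rcases Tree.tr_cons.1 h with ⟨rfl, rfl⟩ | h
    · exact ⟨s, rfl, fun _ _ => Iff.rfl⟩
    · obtain ⟨w, hw, hw'⟩ := ih h
      refine ⟨.cons ν r w, ?_, fun a x => ?_⟩
      · simp only [Tree.size] at hw ⊢
        omega
      · simp only [Tree.tr_cons, hw']
        grind

/-- Moves two summands with related labels to the front, where a splitting axiom applies, without
affecting the induction measure. -/
theorem exists_cons_cons_of_not_simple {r : Act A → Act A → Prop} {s : Tree A}
    (h : ¬ Simple r s) : ∃ μ x ν y w, r μ ν ∧ (Tree.cons μ x (.cons ν y w)).size = s.size ∧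
      ∀ a t, s.tr a t ↔ (Tree.cons μ x (.cons ν y w)).tr a t := by
  induction s with
  | nil => exact absurd List.Pairwise.nil h
  | cons μ x s _ ih =>
    simp only [Simple, Tree.branches, List.pairwise_cons, not_and_or, not_forall, not_not] at h
    rcases h with ⟨⟨ν, y⟩, hy, hr⟩ | h
    · obtain ⟨w, hw, hw'⟩ := exists_cons_of_tr hy
      refine ⟨μ, x, ν, y, w, hr, ?_, fun a t => ?_⟩
      · simp only [Tree.size] at hw ⊢
        omega
      · rw [Tree.tr_cons, hw', ← Tree.tr_cons]
    · obtain ⟨μ', x', ν, y, w, hr, hw, hw'⟩ := ih h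
      refine ⟨μ', x', ν, y, .cons μ x w, hr, ?_, fun a t => ?_⟩
      · simp only [Tree.size] at hw ⊢
        omega
      · simp only [Tree.tr_cons, hw']
        grind

/-- Each initial action of one tree is related by `r` to an initial action of the other. -/
def InitRel (r : Act A → Act A → Prop) (s t : Tree A) : Prop :=
  (∀ a s', s.tr a s' → ∃ b t', r a b ∧ t.tr b t') ∧
  ∀ b t', t.tr b t' → ∃ a s', r b a ∧ s.tr a s'

/-- The two relations on actions for which summands are split. -/
def EqOrTrue (r : Act A → Act A → Prop) : Prop := r = Eq ∨ r = fun _ _ => True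

theorem EqOrTrue.refl {r : Act A → Act A → Prop} (hr : EqOrTrue r) (a : Act A) : r a a := by
  rcases hr with rfl | rfl
  exacts [rfl, trivial]

theorem EqOrTrue.symm {r : Act A → Act A → Prop} (hr : EqOrTrue r) {a b : Act A} (h : r a b) :
    r b a := by
  rcases hr with rfl | rfl
  exacts [Eq.symm h, trivial]

theorem InitRel.symm {r : Act A → Act A → Prop} {s t : Tree A} (h : InitRel r s t) :
    InitRel r t s := ⟨h.2, h.1⟩

theorem InitRel.refl {r : Act A → Act A → Prop} (hr : EqOrTrue r) (s : Tree A) :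
    InitRel r s s :=
  ⟨fun a s' h => ⟨a, s', hr.refl a, h⟩, fun a s' h => ⟨a, s', hr.refl a, h⟩⟩

theorem initRel_par_aux {r : Act A → Act A → Prop} (hr : EqOrTrue r) {s s₁ t t₁ : Tree A}
    (hs : ∀ a x, s.tr a x → ∃ b y, r a b ∧ s₁.tr b y)
    (ht : ∀ a x, t.tr a x → ∃ b y, r a b ∧ t₁.tr b y) {a : Act A} {x : Tree A}
    (h : (s.par t).tr a x) : ∃ b y, r a b ∧ (s₁.par t₁).tr b y := by
  simp only [Tree.tr_par] at h ⊢
  rcases h with ⟨s', h, rfl⟩ | ⟨t', h, rfl⟩ | ⟨s', t', α, β, hc, h, h', rfl, rfl⟩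
  · obtain ⟨b, y, hab, hb⟩ := hs _ _ h
    exact ⟨b, _, hab, Or.inl ⟨y, hb, rfl⟩⟩
  · obtain ⟨b, y, hab, hb⟩ := ht _ _ h
    exact ⟨b, _, hab, Or.inr (Or.inl ⟨y, hb, rfl⟩)⟩
  · obtain ⟨b, y, hab, hb⟩ := hs _ _ h
    obtain ⟨c, z, hac, hz⟩ := ht _ _ h'
    -- For equality the matching moves are again complementary and synchronise. For the total
    -- relation any transition will do, so that of the first component is taken.
    rcases hr with rfl | rfl
    · subst hab hac
      exact ⟨_, _, rfl, Or.inr (Or.inr ⟨y, z, _, _, hc, hb, hz, rfl, rfl⟩)⟩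
    · exact ⟨b, _, trivial, Or.inl ⟨y, hb, rfl⟩⟩

theorem InitRel.par {r : Act A → Act A → Prop} (hr : EqOrTrue r) {s s₁ t t₁ : Tree A}
    (hs : InitRel r s s₁) (ht : InitRel r t t₁) : InitRel r (s.par t) (s₁.par t₁) :=
  ⟨fun _ _ => initRel_par_aux hr hs.1 ht.1, fun _ _ => initRel_par_aux hr hs.2 ht.2⟩

theorem initRel_cons_cons {r : Act A → Act A → Prop} (hr : EqOrTrue r) {μ ν : Act A}
    (h : r μ ν) (x y w : Tree A) : InitRel r (.cons μ x w) (.cons μ x (.cons ν y w)) := by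
  simp only [InitRel, Tree.tr_cons]
  constructor
  · intro a s' hs
    exact ⟨a, s', hr.refl a, by grind⟩
  · intro a s' hs
    rcases hs with hs | ⟨rfl, rfl⟩ | hs
    · exact ⟨a, s', hr.refl a, by grind⟩
    · exact ⟨μ, x, hr.symm h, by grind⟩
    · exact ⟨a, s', hr.refl a, by grind⟩

theorem initRel_cons_cons' {r : Act A → Act A → Prop} (hr : EqOrTrue r) {μ ν : Act A}
    (h : r μ ν) (x y w : Tree A) : InitRel r (.cons ν y w) (.cons μ x (.cons ν y w)) := by
  have h' := initRel_cons_cons hr (hr.symm h) y x w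
  simp only [InitRel, Tree.tr_cons] at h' ⊢
  grind

/-- Laws of the linear semantics that suffice to derive the expansion law. -/
structure LinearLaws (A : Type u) (X : Semantics) (r : Act A → Act A → Prop) : Prop where
  eqOrTrue : EqOrTrue r
  choice : ∀ (μ : Act A) (s t : Tree A), InitRel r s t →
    pre μ (ev s ⊔ ev t) = (pre μ (ev s) ⊔ pre μ (ev t) : Alg A X)
  split : ∀ (μ ν : Act A) (x y w z : Alg A X), r μ ν →
    par (pre μ x ⊔ pre ν y ⊔ w) z = par (pre μ x ⊔ w) z ⊔ par (pre ν y ⊔ w) z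
  expand : ∀ s t : Tree A, Simple r s → Simple r t → Expands X s t

/-- The `split` law leaves two compositions with fewer summands on the left. Together they provide
all left moves and synchronisations. The moves of `t` occur twice, each time with half of the left
component, and are recombined by `choice`. -/
theorem LinearLaws.expands_cons_cons {r : Act A → Act A → Prop} (L : LinearLaws A X r)
    {μ ν : Act A} (hr : r μ ν) {x y w t : Tree A}
    (hx : Expands X (.cons μ x w) t) (hy : Expands X (.cons ν y w) t)
    (ih : ∀ s' t' : Tree A, s'.size < (Tree.cons μ x (.cons ν y w)).size → t'.size < t.size →
      par (ev s') (ev t') = (ev (s'.par t') : Alg A X)) :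
    Expands X (.cons μ x (.cons ν y w)) t := by
  have hsplit : ∀ z : Alg A X, par (ev (.cons μ x (.cons ν y w))) z =
      par (ev (.cons μ x w)) z ⊔ par (ev (.cons ν y w)) z := by
    intro z
    simp only [ev, ← sup_assoc]
    exact L.split _ _ _ _ _ _ hr
  have hpre : ∀ a t', t.tr a t' → (pre a (par (ev (.cons μ x (.cons ν y w))) (ev t')) : Alg A X) =
      pre a (par (ev (.cons μ x w)) (ev t')) ⊔ pre a (par (ev (.cons ν y w)) (ev t')) := by
    intro a t' ht
    have hlt := Tree.size_lt_of_tr ht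
    rw [hsplit, ih (.cons μ x w) t' (by simp only [Tree.size]; omega) hlt,
      ih (.cons ν y w) t' (by simp only [Tree.size]; omega) hlt]
    -- The two halves differ only in a head branch with label `μ` or `ν`, so their initials match up
    -- to `r`, and parallel composition with `t'` preserves this.
    refine L.choice a _ _ (.par L.eqOrTrue ?_ (.refl L.eqOrTrue _))
    refine ⟨fun b s' hs => ?_, fun b s' hs => ?_⟩ <;> simp only [Tree.tr_cons] at hs ⊢ <;>
      rcases hs with ⟨rfl, rfl⟩ | hs
    · exact ⟨ν, y, hr, Or.inl ⟨rfl, rfl⟩⟩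
    · exact ⟨b, s', L.eqOrTrue.refl b, Or.inr hs⟩
    · exact ⟨μ, x, L.eqOrTrue.symm hr, Or.inl ⟨rfl, rfl⟩⟩
    · exact ⟨b, s', L.eqOrTrue.refl b, Or.inr hs⟩
  intro m
  rw [hsplit, sup_le_iff, hx m, hy m]
  constructor
  · rintro ⟨h, h'⟩
    refine ⟨fun a s' hs => ?_, fun a t' ht => ?_, fun a s' b t' hs ht hc => ?_⟩
    · rcases Tree.tr_cons.1 hs with ⟨rfl, rfl⟩ | hs
      · exact h.1 _ _ (Tree.tr_cons.2 (Or.inl ⟨rfl, rfl⟩))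
      · exact h'.1 _ _ hs
    · rw [hpre a t' ht]
      exact sup_le (h.2.1 _ _ ht) (h'.2.1 _ _ ht)
    · rcases Tree.tr_cons.1 hs with ⟨rfl, rfl⟩ | hs
      · exact h.2.2 _ _ _ _ (Tree.tr_cons.2 (Or.inl ⟨rfl, rfl⟩)) ht hc
      · exact h'.2.2 _ _ _ _ hs ht hc
  · rintro ⟨h₁, h₂, h₃⟩
    have hx' : ∀ a s', (Tree.cons μ x w).tr a s' → (Tree.cons μ x (.cons ν y w)).tr a s' := by
      simp only [Tree.tr_cons]; grind
    have hy' : ∀ a s', (Tree.cons ν y w).tr a s' → (Tree.cons μ x (.cons ν y w)).tr a s' :=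
      fun a s' h => Tree.tr_cons.2 (Or.inr h)
    refine ⟨⟨fun a s' hs => h₁ _ _ (hx' _ _ hs), fun a t' ht => ?_,
      fun a s' b t' hs => h₃ _ _ _ _ (hx' _ _ hs)⟩,
      ⟨fun a s' hs => h₁ _ _ (hy' _ _ hs), fun a t' ht => ?_,
      fun a s' b t' hs => h₃ _ _ _ _ (hy' _ _ hs)⟩⟩
    · exact le_sup_left.trans ((hpre a t' ht).symm.le.trans (h₂ _ _ ht))
    · exact le_sup_right.trans ((hpre a t' ht).symm.le.trans (h₂ _ _ ht))

theorem LinearLaws.par_ev {r : Act A → Act A → Prop} (L : LinearLaws A X r) (s t : Tree A) :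
    par (ev s) (ev t) = (ev (s.par t) : Alg A X) := by
  induction hn : s.size + t.size using Nat.strong_induction_on generalizing s t with
  | _ n ih =>
    subst hn
    have ih' : ∀ s' t' : Tree A, s'.size + t'.size < s.size + t.size →
      par (ev s') (ev t') = (ev (s'.par t') : Alg A X) := fun s' t' h => ih _ h s' t' rfl
    have hex : ∀ s' t' : Tree A, s'.size + t'.size < s.size + t.size → Expands X s' t' :=
      fun s' t' h => (expands_iff fun s'' t'' h' => ih' _ _ (h'.trans h)).2 (ih' _ _ h)
    rw [← expands_iff ih']
    by_cases hs : Simple r s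
    · by_cases ht : Simple r t
      · exact L.expand s t hs ht
      · obtain ⟨μ, x, ν, y, w, hr, hsize, hw⟩ := exists_cons_cons_of_not_simple ht
        refine Expands.symm (.congr_left hw (L.expands_cons_cons hr (hex _ _ ?_) (hex _ _ ?_)
          fun s' t' h h' => ih' _ _ ?_)) <;> simp only [Tree.size] at * <;> omega
    · obtain ⟨μ, x, ν, y, w, hr, hsize, hw⟩ := exists_cons_cons_of_not_simple hs
      refine .congr_left hw (L.expands_cons_cons hr (hex _ _ ?_) (hex _ _ ?_)
        fun s' t' h h' => ih' _ _ ?_) <;> simp only [Tree.size] at * <;> omega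

end Alg

end CCS

/-! ### The expansion law in the simulation semantics -/

namespace CCS

universe u
variable {A : Type u}

namespace Alg

variable {X : Semantics}

/-- Prefixing is monotone on trees if initial actions may be duplicated up to `r`. -/
theorem pre_ev_mono {r : Act A → Act A → Prop}
    (mono : ∀ (μ ν ξ : Act A) (x y z : Alg A X), r ν ξ →
      pre μ (pre ν x ⊔ z) ≤ pre μ (pre ν x ⊔ pre ξ y ⊔ z))
    {s t : Tree A} (hle : (ev s : Alg A X) ≤ ev t)
    (hinit : ∀ b t', t.tr b t' → ∃ a s', r a b ∧ s.tr a s') (μ : Act A) :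
    pre μ (ev s) ≤ (pre μ (ev t) : Alg A X) := by
  have key : pre μ (ev s) ≤ (pre μ (ev s ⊔ ev t) : Alg A X) := by
    -- The bound `hle` is not needed in this induction, which adds the branches of `t` one at a
    -- time. Each addition uses `mono` with a branch of `s` that has a related label. At the end
    -- `hle` collapses `ev s ⊔ ev t` to `ev t`.
    clear hle
    induction t with
    | nil => simp [ev]
    | cons ν y t _ ih =>
      obtain ⟨a, s', hr, hs⟩ := hinit ν y (Tree.tr_cons.2 (Or.inl ⟨rfl, rfl⟩))
      refine (ih fun b t' ht => hinit b t' (Tree.tr_cons.2 (Or.inr ht))).trans ?_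
      have h := mono μ a ν (ev s') (ev y) (ev s ⊔ ev t) hr
      have hs' : (pre a (ev s') : Alg A X) ≤ ev s ⊔ ev t := (pre_le_ev hs).trans le_sup_left
      rw [sup_eq_right.2 hs', sup_comm (pre a _), sup_assoc, sup_eq_right.2 hs'] at h
      rwa [ev, sup_left_comm]
  rwa [sup_eq_right.2 hle] at key

/-- Laws of the simulation semantics that suffice to derive the expansion law. -/
structure SimLaws (A : Type u) (X : Semantics) (r : Act A → Act A → Prop) : Prop where
  eqOrTrue : EqOrTrue r
  mono : ∀ (μ ν ξ : Act A) (x y z : Alg A X), r ν ξ →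
    pre μ (pre ν x ⊔ z) ≤ pre μ (pre ν x ⊔ pre ξ y ⊔ z)
  split_both : ∀ (μ μ' ν ν' : Act A) (x y u z w v : Alg A X), r μ μ' → r ν ν' →
    par (pre μ x ⊔ pre μ' y ⊔ u) (pre ν z ⊔ pre ν' w ⊔ v) =
      par (pre μ x ⊔ u) (pre ν z ⊔ pre ν' w ⊔ v) ⊔ par (pre μ' y ⊔ u) (pre ν z ⊔ pre ν' w ⊔ v) ⊔
        par (pre μ x ⊔ pre μ' y ⊔ u) (pre ν z ⊔ v) ⊔ par (pre μ x ⊔ pre μ' y ⊔ u) (pre ν' w ⊔ v)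
  split_right : ∀ s : Tree A, Simple r s → ∀ (ν ν' : Act A) (y z w m : Alg A X), r ν ν' →
    (par (ev s) (pre ν y ⊔ pre ν' z ⊔ w) ≤ m ↔
      par (ev s) (pre ν y ⊔ w) ≤ m ∧ par (ev s) (pre ν' z ⊔ w) ≤ m ∧
        ∀ μ s', s.tr μ s' → pre μ (par (ev s') (pre ν y ⊔ pre ν' z ⊔ w)) ≤ m)
  expand : ∀ s t : Tree A, Simple r s → Simple r t → Expands X s t

namespace SimLaws

variable {r : Act A → Act A → Prop}

/-- Composition is monotone here because `split_both` exhibits the smaller compositions as summands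
of the larger one. It needs two related branches on the right, so the head branch of `t` is
duplicated using idempotence; if `t` is empty, composition is trivial. -/
theorem par_le (L : SimLaws A X r) {μ ν : Act A} (hr : r μ ν) (x y w t : Tree A) :
    (par (ev (.cons μ x w)) (ev t) : Alg A X) ≤ par (ev (.cons μ x (.cons ν y w))) (ev t) ∧
    (par (ev (.cons ν y w)) (ev t) : Alg A X) ≤ par (ev (.cons μ x (.cons ν y w))) (ev t) := by
  simp only [ev, ← sup_assoc]
  cases t with
  | nil =>
    simp only [ev, par_bot]
    exact ⟨sup_le (le_sup_left.trans le_sup_left) le_sup_right,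
      sup_le (le_sup_right.trans le_sup_left) le_sup_right⟩
  | cons ξ z v =>
    have h := L.split_both μ ν ξ ξ (ev x) (ev y) (ev w) (ev z) (ev z) (ev v) hr
      (L.eqOrTrue.refl ξ)
    rw [sup_idem] at h
    rw [ev, h]
    exact ⟨le_sup_left.trans (le_sup_left.trans le_sup_left),
      le_sup_right.trans (le_sup_left.trans le_sup_left)⟩

/-- The monotonicity of prefixing for parallel compositions that are known to be trees. -/
theorem pre_par_le (L : SimLaws A X r) {s s₁ t : Tree A}
    (hle : (par (ev s₁) (ev t) : Alg A X) ≤ par (ev s) (ev t)) (hinit : InitRel r s₁ s)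
    (h : (par (ev s) (ev t) : Alg A X) = ev (s.par t))
    (h₁ : (par (ev s₁) (ev t) : Alg A X) = ev (s₁.par t)) (ξ : Act A) :
    (pre ξ (par (ev s₁) (ev t)) : Alg A X) ≤ pre ξ (par (ev s) (ev t)) := by
  rw [h, h₁] at hle ⊢
  refine pre_ev_mono L.mono hle (fun b t' ht => ?_) ξ
  obtain ⟨a, s', hr, hs⟩ := (hinit.par L.eqOrTrue (.refl L.eqOrTrue t)).2 b t' ht
  exact ⟨a, s', L.eqOrTrue.symm hr, hs⟩

theorem expansionLE_of_subset {s s₁ t : Tree A} {m : Alg A X}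
    (hs : ∀ a x, s₁.tr a x → s.tr a x)
    (ht : ∀ ν t', t.tr ν t' → (pre ν (par (ev s₁) (ev t')) : Alg A X) ≤ pre ν (par (ev s) (ev t')))
    (h : ExpansionLE s t m) : ExpansionLE s₁ t m :=
  ⟨fun μ s' h' => h.1 μ s' (hs _ _ h'), fun ν t' h' => (ht ν t' h').trans (h.2.1 ν t' h'),
    fun μ s' ν t' h' => h.2.2 μ s' ν t' (hs _ _ h')⟩

theorem tr_cons_left {μ ν : Act A} {x y w : Tree A} (a : Act A) (s : Tree A)
    (h : (Tree.cons μ x w).tr a s) : (Tree.cons μ x (.cons ν y w)).tr a s := by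
  simp only [Tree.tr_cons] at h ⊢
  grind

theorem tr_cons_right {μ ν : Act A} {x y w : Tree A} (a : Act A) (s : Tree A)
    (h : (Tree.cons ν y w).tr a s) : (Tree.cons μ x (.cons ν y w)).tr a s :=
  Tree.tr_cons.2 (Or.inr h)

theorem tr_cons_cons {μ ν : Act A} {x y w : Tree A} {a : Act A} {s : Tree A}
    (h : (Tree.cons μ x (.cons ν y w)).tr a s) :
    (Tree.cons μ x w).tr a s ∨ (Tree.cons ν y w).tr a s := by
  simp only [Tree.tr_cons] at h ⊢
  grind

/-- Left moves and synchronisations of a half are among those of the whole. For a move of `t`, the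
residual still contains the left component, and monotonicity under the prefix is needed. -/
theorem expansionLE_cons_cons (L : SimLaws A X r) {μ ν : Act A} (hr : r μ ν) {x y w t : Tree A}
    (ih : ∀ s' t' : Tree A, s'.size + t'.size < (Tree.cons μ x (.cons ν y w)).size + t.size →
      par (ev s') (ev t') = (ev (s'.par t') : Alg A X)) {m : Alg A X}
    (h : ExpansionLE (.cons μ x (.cons ν y w)) t m) :
    ExpansionLE (.cons μ x w) t m ∧ ExpansionLE (.cons ν y w) t m := by
  constructor
  · refine expansionLE_of_subset tr_cons_left (fun ξ t' ht => ?_) h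
    have := Tree.size_lt_of_tr ht
    refine L.pre_par_le (L.par_le hr x y w t').1 (initRel_cons_cons L.eqOrTrue hr x y w)
      (ih _ _ ?_) (ih _ _ ?_) ξ <;> simp only [Tree.size] <;> omega
  · refine expansionLE_of_subset tr_cons_right (fun ξ t' ht => ?_) h
    have := Tree.size_lt_of_tr ht
    refine L.pre_par_le (L.par_le hr x y w t').2 (initRel_cons_cons' L.eqOrTrue hr x y w)
      (ih _ _ ?_) (ih _ _ ?_) ξ <;> simp only [Tree.size] <;> omega

/-- Of the four compositions given by `split_both`, the first two provide the left moves and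
synchronisations, and the last two provide the right moves with the left component intact. -/
theorem expands_both (L : SimLaws A X r) {μ ν ξ ζ : Act A} (hr : r μ ν) (hr' : r ξ ζ)
    {x y u z w v : Tree A} (ih : ∀ s' t' : Tree A, s'.size + t'.size <
        (Tree.cons μ x (.cons ν y u)).size + (Tree.cons ξ z (.cons ζ w v)).size →
      par (ev s') (ev t') = (ev (s'.par t') : Alg A X)) :
    Expands X (.cons μ x (.cons ν y u)) (.cons ξ z (.cons ζ w v)) := by
  have hex : ∀ s' t' : Tree A, s'.size + t'.size <
      (Tree.cons μ x (.cons ν y u)).size + (Tree.cons ξ z (.cons ζ w v)).size →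
      Expands X s' t' :=
    fun s' t' h => (expands_iff fun s'' t'' h' => ih _ _ (h'.trans h)).2 (ih _ _ h)
  have h₁ := hex (.cons μ x u) (.cons ξ z (.cons ζ w v)) (by simp only [Tree.size]; omega)
  have h₂ := hex (.cons ν y u) (.cons ξ z (.cons ζ w v)) (by simp only [Tree.size]; omega)
  have h₃ := hex (.cons μ x (.cons ν y u)) (.cons ξ z v) (by simp only [Tree.size]; omega)
  have h₄ := hex (.cons μ x (.cons ν y u)) (.cons ζ w v) (by simp only [Tree.size]; omega)
  have hsplit : (par (ev (.cons μ x (.cons ν y u))) (ev (.cons ξ z (.cons ζ w v))) : Alg A X) =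
      par (ev (.cons μ x u)) (ev (.cons ξ z (.cons ζ w v))) ⊔
        par (ev (.cons ν y u)) (ev (.cons ξ z (.cons ζ w v))) ⊔
        par (ev (.cons μ x (.cons ν y u))) (ev (.cons ξ z v)) ⊔
        par (ev (.cons μ x (.cons ν y u))) (ev (.cons ζ w v)) := by
    simp only [ev, ← sup_assoc (pre μ _), ← sup_assoc (pre ξ _)]
    exact L.split_both _ _ _ _ _ _ _ _ _ _ hr hr'
  intro m
  rw [hsplit, sup_le_iff, sup_le_iff, sup_le_iff, h₁ m, h₂ m, h₃ m, h₄ m]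
  constructor
  · rintro ⟨⟨⟨k₁, k₂⟩, k₃⟩, k₄⟩
    refine ⟨fun a s' hs => ?_, fun a t' ht => ?_, fun a s' b t' hs ht hc => ?_⟩
    · rcases tr_cons_cons hs with hs | hs
      exacts [k₁.1 _ _ hs, k₂.1 _ _ hs]
    · rcases tr_cons_cons ht with ht | ht
      exacts [k₃.2.1 _ _ ht, k₄.2.1 _ _ ht]
    · rcases tr_cons_cons hs with hs | hs
      exacts [k₁.2.2 _ _ _ _ hs ht hc, k₂.2.2 _ _ _ _ hs ht hc]
  · intro h
    obtain ⟨k₁, k₂⟩ := L.expansionLE_cons_cons hr ih h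
    obtain ⟨k₃, k₄⟩ := L.expansionLE_cons_cons hr'
      (fun s' t' h => ih s' t' (h.trans_eq (Nat.add_comm _ _))) h.symm
    exact ⟨⟨⟨k₁, k₂⟩, k₃.symm⟩, k₄.symm⟩

/-- Here `split_right` lists the left moves explicitly, with the right component intact; the two
halves provide the right moves and synchronisations. -/
theorem expands_right (L : SimLaws A X r) {ξ ζ : Act A} (hr : r ξ ζ) {s z w v : Tree A}
    (hs : Simple r s) (ih : ∀ s' t' : Tree A, s'.size + t'.size <
        s.size + (Tree.cons ξ z (.cons ζ w v)).size →
      par (ev s') (ev t') = (ev (s'.par t') : Alg A X)) :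
    Expands X s (.cons ξ z (.cons ζ w v)) := by
  have hex : ∀ s' t' : Tree A, s'.size + t'.size <
      s.size + (Tree.cons ξ z (.cons ζ w v)).size → Expands X s' t' :=
    fun s' t' h => (expands_iff fun s'' t'' h' => ih _ _ (h'.trans h)).2 (ih _ _ h)
  have h₁ := hex s (.cons ξ z v) (by simp only [Tree.size]; omega)
  have h₂ := hex s (.cons ζ w v) (by simp only [Tree.size]; omega)
  intro m
  have h := L.split_right s hs ξ ζ (ev z) (ev w) (ev v) m hr
  have hev : (pre ξ (ev z) ⊔ pre ζ (ev w) ⊔ ev v : Alg A X) = ev (.cons ξ z (.cons ζ w v)) :=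
    sup_assoc _ _ _
  rw [hev] at h
  refine h.trans ?_
  change par (ev s) (ev (.cons ξ z v)) ≤ m ∧ par (ev s) (ev (.cons ζ w v)) ≤ m ∧ _ ↔ _
  rw [h₁ m, h₂ m]
  constructor
  · rintro ⟨k₁, k₂, k₃⟩
    refine ⟨k₃, fun a t' ht => ?_, fun a s' b t' hs ht hc => ?_⟩
    · rcases tr_cons_cons ht with ht | ht
      exacts [k₁.2.1 _ _ ht, k₂.2.1 _ _ ht]
    · rcases tr_cons_cons ht with ht | ht
      exacts [k₁.2.2 _ _ _ _ hs ht hc, k₂.2.2 _ _ _ _ hs ht hc]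
  · intro h
    obtain ⟨k₁, k₂⟩ := L.expansionLE_cons_cons hr
      (fun s' t' h => ih s' t' (h.trans_eq (Nat.add_comm _ _))) h.symm
    exact ⟨k₁.symm, k₂.symm, h.1⟩

theorem par_ev (L : SimLaws A X r) (s t : Tree A) :
    par (ev s) (ev t) = (ev (s.par t) : Alg A X) := by
  induction hn : s.size + t.size using Nat.strong_induction_on generalizing s t with
  | _ n ih =>
    subst hn
    have ih' : ∀ s' t' : Tree A, s'.size + t'.size < s.size + t.size →
      par (ev s') (ev t') = (ev (s'.par t') : Alg A X) := fun s' t' h => ih _ h s' t' rfl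
    rw [← expands_iff ih']
    by_cases hs : Simple r s
    · by_cases ht : Simple r t
      · exact L.expand s t hs ht
      · obtain ⟨μ, x, ν, y, w, hr, hsize, hw⟩ := exists_cons_cons_of_not_simple ht
        exact Expands.symm (.congr_left hw (.symm
          (L.expands_right hr hs fun s' t' h => ih' s' t' (by omega))))
    · obtain ⟨μ, x, ν, y, w, hr, hsize, hw⟩ := exists_cons_cons_of_not_simple hs
      refine .congr_left hw ?_
      by_cases ht : Simple r t
      · exact (L.expands_right hr ht fun s' t' h => ih' s' t' (by omega)).symm
      · obtain ⟨μ', x', ν', y', w', hr', hsize', hw'⟩ := exists_cons_cons_of_not_simple ht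
        exact Expands.symm (.congr_left hw' (.symm
          (L.expands_both hr hr' fun s' t' h => ih' s' t' (by omega))))

end SimLaws

/-! ### The expansion laws for sums without repeated labels -/

/-- Here `v i` is the variable that stands for the `i`-th derivative in an axiom about sums. -/
theorem ev_eq_of_get {ρ : ℕ → Alg A X} {s : Tree A} {v : ℕ → ℕ}
    (hv : ∀ i : Fin s.branches.length, ρ (v i) = ev (s.branches.get i).2) :
    eval ρ (Term.finSum fun i : Fin s.branches.length =>
      .pre (s.branches.get i).1 (.var (v i))) = ev s := by
  refine eq_of_forall_ge_iff fun m => ?_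
  simp only [eval_finSum_le_iff, eval, hv, ev_le_iff, Tree.tr, List.mem_iff_get]
  constructor
  · rintro h μ t ⟨i, hi⟩
    have := h i
    rwa [hi] at this
  · exact fun h i => h _ _ ⟨i, rfl⟩

theorem injective_of_simple {s : Tree A} (h : Simple Eq s) :
    Function.Injective fun i : Fin s.branches.length => (s.branches.get i).1 := by
  have h' := List.pairwise_iff_get.1 h
  intro i j hij
  by_contra hne
  rcases lt_or_gt_of_ne hne with hlt | hlt
  exacts [h' _ _ hlt hij, h' _ _ hlt hij.symm]

theorem forall_tr_iff {s : Tree A} {p : Act A → Tree A → Prop} :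
    (∀ μ t, s.tr μ t → p μ t) ↔
      ∀ i : Fin s.branches.length, p (s.branches.get i).1 (s.branches.get i).2 := by
  simp only [Tree.tr, List.mem_iff_get]
  constructor
  · exact fun h i => h _ _ ⟨i, rfl⟩
  · rintro h μ t ⟨i, hi⟩
    have := h i
    rwa [hi] at this

theorem expands_of_axEL2 (h : axEL2 A ⊆ axiomSystem A X) {s t : Tree A} (hs : Simple Eq s)
    (ht : Simple Eq t) : Expands X s t := by
  intro m
  -- In EL2 the derivatives of `s` are the even variables and those of `t` the odd ones.
  let ρ : ℕ → Alg A X := fun k => if k % 2 = 0 then ev ((s.branches.map Prod.snd).getD (k / 2) .nil)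
    else ev ((t.branches.map Prod.snd).getD (k / 2) .nil)
  have hρs : ∀ i : Fin s.branches.length, ρ (2 * i) = ev (s.branches.get i).2 := by
    intro i
    simp [ρ]
  have hρt : ∀ i : Fin t.branches.length, ρ (2 * i + 1) = ev (t.branches.get i).2 := by
    intro i
    have h₁ : (2 * (i : ℕ) + 1) % 2 = 1 := by omega
    have h₂ : (2 * (i : ℕ) + 1) / 2 = i := by omega
    simp [ρ, h₁, h₂]
  have key := eval_eq (h ⟨_, _, _, _, injective_of_simple hs, injective_of_simple ht, rfl⟩) ρ
  obtain ⟨l, hl, hmem⟩ := syncSum_eq_sum (fun i => (s.branches.get i).1)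
    (fun i => (t.branches.get i).1) (fun i : Fin s.branches.length => Term.var (2 * i))
    (fun j : Fin t.branches.length => Term.var (2 * j + 1))
  simp only [hl, eval_add] at key
  simp only [eval] at key
  rw [ev_eq_of_get (v := fun i => 2 * i) hρs, ev_eq_of_get (v := fun i => 2 * i + 1) hρt] at key
  rw [key, sup_le_iff, sup_le_iff, eval_finSum_le_iff, eval_finSum_le_iff, eval_sum_le_iff,
    and_assoc, ExpansionLE]
  simp only [hmem]
  refine and_congr ?_ (and_congr ?_ ?_)
  · simp only [forall_tr_iff, eval, ev_eq_of_get (v := fun i => 2 * i + 1) hρt, hρs]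
  · simp only [forall_tr_iff, eval, ev_eq_of_get (v := fun i => 2 * i) hρs, hρt]
  · constructor
    · intro h μ s' ν t' hs ht hc
      obtain ⟨i, hi⟩ := List.mem_iff_get.1 hs
      obtain ⟨j, hj⟩ := List.mem_iff_get.1 ht
      have := h _ ⟨i, j, by rwa [hi, hj], rfl⟩
      simpa only [eval, hρs, hρt, hi, hj] using this
    · rintro h _ ⟨i, j, hc, rfl⟩
      simp only [eval, hρs, hρt]
      exact h _ _ _ _ (List.get_mem _ i) (List.get_mem _ j) hc

theorem simple_true_iff {s : Tree A} (h : Simple (fun _ _ => True) s) :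
    s = .nil ∨ ∃ μ t, s = .cons μ t .nil := by
  rcases s with _ | ⟨μ, t, _ | ⟨ν, t', s⟩⟩
  · exact Or.inl rfl
  · exact Or.inr ⟨μ, t, rfl⟩
  · exact absurd trivial (List.rel_of_pairwise_cons h List.mem_cons_self)

theorem expands_nil_left (t : Tree A) : Expands X .nil t := by
  intro m
  simp [ExpansionLE, ev, bot_par, ev_le_iff]

theorem expands_of_axEL1 (h : axEL1 A ⊆ axiomSystem A X) {s t : Tree A}
    (hs : Simple (fun _ _ => True) s) (ht : Simple (fun _ _ => True) t) : Expands X s t := by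
  rcases simple_true_iff hs with rfl | ⟨μ, x, rfl⟩
  · exact expands_nil_left t
  rcases simple_true_iff ht with rfl | ⟨ν, y, rfl⟩
  · exact (expands_nil_left _).symm
  intro m
  simp only [ExpansionLE, Tree.tr_cons, Tree.tr_nil, or_false, ev, sup_bot]
  by_cases hc : μ.Compl ν
  · have : par (pre μ (ev x)) (pre ν (ev y)) = (pre μ (par (ev x) (pre ν (ev y))) ⊔
        pre ν (par (pre μ (ev x)) (ev y)) ⊔ pre .tau (par (ev x) (ev y)) : Alg A X) :=
      eval_eq (h (Or.inr ⟨μ, ν, hc, rfl⟩)) (valuation [ev x, ev y])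
    rw [this, sup_le_iff, sup_le_iff]
    grind
  · have : par (pre μ (ev x)) (pre ν (ev y)) = (pre μ (par (ev x) (pre ν (ev y))) ⊔
        pre ν (par (pre μ (ev x)) (ev y)) : Alg A X) :=
      eval_eq (h (Or.inl ⟨μ, ν, hc, rfl⟩)) (valuation [ev x, ev y])
    rw [this, sup_le_iff]
    grind

end Alg

end CCS

namespace CCS

universe u
variable {A : Type u}

namespace Alg

open LTS

variable {X : Semantics}

/-! ### Membership of the axioms in their systems -/

theorem axRS_subset_RS : axRS A ⊆ axiomSystem A .RS := fun _ h => by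
  simp [axiomSystem, h]

theorem axRSP1_subset_RS : axRSP1 A ⊆ axiomSystem A .RS := fun _ h => by
  simp [axiomSystem, h]

theorem axRSP2_subset_RS : axRSP2 A ⊆ axiomSystem A .RS := fun _ h => by
  simp [axiomSystem, h]

theorem axEL2_subset_RS : axEL2 A ⊆ axiomSystem A .RS := fun _ h => by
  simp [axiomSystem, h]

theorem axCS_subset_CS : axCS A ⊆ axiomSystem A .CS := fun _ h => by
  simp [axiomSystem, h]

theorem axCSP1_subset_CS : axCSP1 A ⊆ axiomSystem A .CS := fun _ h => by
  simp [axiomSystem, h]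

theorem axCSP2_subset_CS : axCSP2 A ⊆ axiomSystem A .CS := fun _ h => by
  simp [axiomSystem, h]

theorem axEL1_subset_CS : axEL1 A ⊆ axiomSystem A .CS := fun _ h => by
  simp [axiomSystem, h]

theorem axS_subset_S : axS A ⊆ axiomSystem A .S := fun _ h => by
  simp [axiomSystem, h]

theorem axSP1_subset_S : axSP1 A ⊆ axiomSystem A .S := fun _ h => by
  simp [axiomSystem, h]

theorem axSP2_subset_S : axSP2 A ⊆ axiomSystem A .S := fun _ h => by
  simp [axiomSystem, h]

theorem axEL1_subset_S : axEL1 A ⊆ axiomSystem A .S := fun _ h => by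
  simp [axiomSystem, h]

theorem axCT_subset_CT : axCT A ⊆ axiomSystem A .CT := fun _ h => by
  simp [axiomSystem, h]

theorem axCTP_subset_CT : axCTP A ⊆ axiomSystem A .CT := fun _ h => by
  simp [axiomSystem, h]

theorem axEL1_subset_CT : axEL1 A ⊆ axiomSystem A .CT := fun _ h => by
  simp [axiomSystem, h]

theorem axT_subset_T : axT A ⊆ axiomSystem A .T := fun _ h => by
  simp [axiomSystem, h]

theorem axTP_subset_T : axTP A ⊆ axiomSystem A .T := fun _ h => by
  simp [axiomSystem, h]

theorem axEL1_subset_T : axEL1 A ⊆ axiomSystem A .T := fun _ h => by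
  simp [axiomSystem, h]

theorem axRS_subset_FT : axRS A ⊆ axiomSystem A .FT := fun _ h => by
  simp [axiomSystem, h]

theorem axFT_subset_FT : axFT A ⊆ axiomSystem A .FT := fun _ h => by
  simp [axiomSystem, h]

theorem axEL2_subset_FT : axEL2 A ⊆ axiomSystem A .FT := fun _ h => by
  simp [axiomSystem, h]

theorem axFP_subset_FT : axFP A ⊆ axiomSystem A .FT := fun _ h => by
  simp [axiomSystem, h]

theorem axR_subset_R : axR A ⊆ axiomSystem A .R := fun _ h => by
  simp [axiomSystem, h]

theorem axFP_subset_R : axFP A ⊆ axiomSystem A .R := fun _ h => by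
  simp [axiomSystem, h]

theorem axEL2_subset_R : axEL2 A ⊆ axiomSystem A .R := fun _ h => by
  simp [axiomSystem, h]

theorem axR_subset_F : axR A ⊆ axiomSystem A .F := fun _ h => by
  simp [axiomSystem, h]

theorem axFP_subset_F : axFP A ⊆ axiomSystem A .F := fun _ h => by
  simp [axiomSystem, h]

theorem axEL2_subset_F : axEL2 A ⊆ axiomSystem A .F := fun _ h => by
  simp [axiomSystem, h]

theorem axRT_subset_RT : axRT A ⊆ axiomSystem A .RT := fun _ h => by
  simp [axiomSystem, h]

theorem axEL2_subset_RT : axEL2 A ⊆ axiomSystem A .RT := fun _ h => by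
  simp [axiomSystem, h]

theorem axFP_subset_RT : axFP A ⊆ axiomSystem A .RT := fun _ h => by
  simp [axiomSystem, h]

/-! ### The laws of the simulation semantics -/

theorem simLaws_RS : SimLaws A .RS Eq where
  eqOrTrue := Or.inl rfl
  mono := by
    rintro μ ν _ x y z rfl
    have h : (pre μ (pre ν x ⊔ pre ν y ⊔ z) : Alg A .RS) =
        pre μ (pre ν x ⊔ pre ν y ⊔ z) ⊔ pre μ (pre ν x ⊔ z) :=
      eval_eq (axRS_subset_RS ⟨μ, ν, rfl⟩) (valuation [x, y, z])
    exact sup_eq_left.1 h.symm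
  split_both := by
    rintro μ _ ν _ x y u z w v rfl rfl
    exact eval_eq (axRSP1_subset_RS ⟨μ, ν, rfl⟩) (valuation [x, y, z, w, u, v])
  split_right := by
    rintro s hs ν _ y z w m rfl
    -- In RSP2 the variables `1, 2, 3` are `y, z, w`, variable `0` does not occur, and the
    -- derivatives of `s` start at `4`.
    let ρ : ℕ → Alg A .RS := fun k => if k < 4 then valuation [⊥, y, z, w] k
      else ev ((s.branches.map Prod.snd).getD (k - 4) .nil)
    have hρ : ∀ i : Fin s.branches.length, ρ (i + 4) = ev (s.branches.get i).2 := by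
      intro i
      simp [ρ]
    have key := eval_eq (X := .RS) (axRSP2_subset_RS ⟨_, _, ν, injective_of_simple hs, rfl⟩) ρ
    simp only [eval_add] at key
    simp only [eval] at key
    rw [ev_eq_of_get (v := fun i => i + 4) hρ] at key
    change par (ev s) (pre ν y ⊔ pre ν z ⊔ w) = par (ev s) (pre ν y ⊔ w) ⊔
      par (ev s) (pre ν z ⊔ w) ⊔ _ at key
    rw [key, sup_le_iff, sup_le_iff, and_assoc, eval_finSum_le_iff, forall_tr_iff]
    simp only [eval, hρ]
    exact Iff.rfl
  expand _ _ := expands_of_axEL2 axEL2_subset_RS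

theorem simLaws_CS : SimLaws A .CS fun _ _ => True where
  eqOrTrue := Or.inr rfl
  mono := by
    rintro μ ν ξ x y z -
    have h : (pre μ (pre ν x ⊔ pre ξ y ⊔ z) : Alg A .CS) =
        pre μ (pre ν x ⊔ pre ξ y ⊔ z) ⊔ pre μ (pre ν x ⊔ z) :=
      eval_eq (axCS_subset_CS ⟨μ, ν, rfl⟩) (valuation [x, pre ξ y, z])
    exact sup_eq_left.1 h.symm
  split_both := by
    rintro μ μ' ν ν' x y u z w v - -
    exact eval_eq (axCSP1_subset_CS ⟨μ, μ', ν, ν', rfl⟩) (valuation [x, y, z, w, u, v])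
  split_right := by
    rintro s hs ν ν' y z w m -
    rcases simple_true_iff hs with rfl | ⟨μ, x, rfl⟩
    · simp [ev, bot_par]
      grind
    · have h : par (pre μ (ev x)) (pre ν y ⊔ pre ν' z ⊔ w) =
          (pre μ (par (ev x) (pre ν y ⊔ pre ν' z ⊔ w)) ⊔ par (pre μ (ev x)) (pre ν y ⊔ w) ⊔
            par (pre μ (ev x)) (pre ν' z ⊔ w) : Alg A .CS) :=
        eval_eq (axCSP2_subset_CS ⟨μ, ν, ν', rfl⟩) (valuation [ev x, y, z, w])
      simp only [ev, sup_bot, h, sup_le_iff, Tree.tr_cons, Tree.tr_nil, or_false]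
      grind
  expand _ _ := expands_of_axEL1 axEL1_subset_CS

theorem pre_le_pre_sup_of_S (μ : Act A) (x y : Alg A .S) : pre μ x ≤ pre μ (x ⊔ y) := by
  have h : (pre μ (x ⊔ y) : Alg A .S) = pre μ (x ⊔ y) ⊔ pre μ x :=
    eval_eq (axS_subset_S ⟨μ, rfl⟩) (valuation [x, y])
  exact sup_eq_left.1 h.symm

theorem simLaws_S : SimLaws A .S fun _ _ => True where
  eqOrTrue := Or.inr rfl
  mono := by
    rintro μ ν ξ x y z -
    rw [sup_right_comm]
    exact pre_le_pre_sup_of_S ..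
  split_both := by
    rintro μ μ' ν ν' x y u z w v - -
    have h : ∀ a b c d : Alg A .S,
        par (a ⊔ b) (c ⊔ d) = par a (c ⊔ d) ⊔ par b (c ⊔ d) ⊔ par (a ⊔ b) c ⊔ par (a ⊔ b) d :=
      fun a b c d => eval_eq (axSP1_subset_S rfl) (valuation [a, b, c, d])
    -- The common parts `u` and `v` are put into both halves of their sums, which idempotence
    -- permits.
    have h' := h (pre μ x ⊔ u) (pre μ' y ⊔ u) (pre ν z ⊔ v) (pre ν' w ⊔ v)
    rwa [← sup_sup_distrib_right, ← sup_sup_distrib_right] at h'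
  split_right := by
    rintro s hs ν ν' y z w m -
    rcases simple_true_iff hs with rfl | ⟨μ, x, rfl⟩
    · simp [ev, bot_par]
      grind
    · have h : ∀ a b : Alg A .S, par (pre μ (ev x)) (a ⊔ b) =
          (pre μ (par (ev x) (a ⊔ b)) ⊔ par (pre μ (ev x)) a ⊔ par (pre μ (ev x)) b : Alg A .S) :=
        fun a b => eval_eq (axSP2_subset_S ⟨μ, rfl⟩) (valuation [ev x, a, b])
      have h' := h (pre ν y ⊔ w) (pre ν' z ⊔ w)
      rw [← sup_sup_distrib_right] at h'
      simp only [ev, sup_bot, h', sup_le_iff, Tree.tr_cons, Tree.tr_nil, or_false]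
      grind
  expand _ _ := expands_of_axEL1 axEL1_subset_S

/-! ### The laws of the linear semantics -/

theorem split_of_axFP (h : axFP A ⊆ axiomSystem A X) (μ ν : Act A) (x y w z : Alg A X)
    (hμ : μ = ν) :
    par (pre μ x ⊔ pre ν y ⊔ w) z = par (pre μ x ⊔ w) z ⊔ par (pre ν y ⊔ w) z := by
  subst hμ
  exact eval_eq (h ⟨μ, rfl⟩) (valuation [x, y, z, w])

/-- The axiom CT needs a prefix in both sums. For the total relation `InitRel` says that `s` and `t`
are both empty or both nonempty, and two empty trees are handled by idempotence. -/
theorem linearLaws_CT : LinearLaws A .CT fun _ _ => True where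
  eqOrTrue := Or.inr rfl
  choice := by
    intro μ s t h
    cases s with
    | nil =>
      cases t with
      | nil => simp [ev]
      | cons ν t t' =>
        obtain ⟨_, _, _, h⟩ := h.2 ν t (Tree.tr_cons.2 (Or.inl ⟨rfl, rfl⟩))
        simp at h
    | cons ν s s' =>
      cases t with
      | nil =>
        obtain ⟨_, _, _, h⟩ := h.1 ν s (Tree.tr_cons.2 (Or.inl ⟨rfl, rfl⟩))
        simp at h
      | cons ξ t t' =>
        have key : pre μ (pre ν (ev s) ⊔ ev s') ⊔ pre μ (pre ξ (ev t) ⊔ ev t') =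
            (pre μ (pre ν (ev s) ⊔ pre ξ (ev t) ⊔ ev s' ⊔ ev t') : Alg A .CT) :=
          eval_eq (axCT_subset_CT ⟨μ, ν, ξ, rfl⟩) (valuation [ev s, ev t, ev s', ev t'])
        simp only [ev]
        rw [key, sup_sup_sup_comm, sup_assoc (_ ⊔ _)]
  split := by
    rintro μ ν x y w z -
    exact eval_eq (axCTP_subset_CT ⟨μ, ν, rfl⟩) (valuation [x, y, z, w])
  expand _ _ := expands_of_axEL1 axEL1_subset_CT

theorem pre_sup_of_T (μ : Act A) (x y : Alg A .T) : pre μ (x ⊔ y) = pre μ x ⊔ pre μ y :=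
  (eval_eq (axT_subset_T ⟨μ, rfl⟩) (valuation [x, y])).symm

theorem linearLaws_T : LinearLaws A .T fun _ _ => True where
  eqOrTrue := Or.inr rfl
  choice μ s t _ := pre_sup_of_T μ _ _
  split := by
    rintro μ ν x y w z -
    have h : ∀ a b : Alg A .T, par (a ⊔ b) z = par a z ⊔ par b z :=
      fun a b => eval_eq (axTP_subset_T rfl) (valuation [a, b, z])
    rw [← h, ← sup_sup_distrib_right]
  expand _ _ := expands_of_axEL1 axEL1_subset_T

theorem InitRel.trans {s t w : Tree A} (h : InitRel Eq s t) (h' : InitRel Eq t w) :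
    InitRel Eq s w := by
  simp only [InitRel, exists_and_left, exists_eq_left'] at *
  exact ⟨fun a x hx => let ⟨y, hy⟩ := h.1 a x hx; h'.1 a y hy,
    fun a x hx => let ⟨y, hy⟩ := h'.2 a x hx; h.2 a y hy⟩

theorem InitRel.of_tr_iff {s t : Tree A} (h : ∀ a x, s.tr a x ↔ t.tr a x) : InitRel Eq s t :=
  ⟨fun a x hx => ⟨a, x, rfl, (h a x).1 hx⟩, fun a x hx => ⟨a, x, rfl, (h a x).2 hx⟩⟩

/-- All branches of `t` have labels that already occur in `s`, so `mono` can add them. -/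
theorem pre_ev_le_pre_sup {μ : Act A} {s t : Tree A} (mono : ∀ (μ ν ξ : Act A) (x y z : Alg A X),
    ν = ξ → pre μ (pre ν x ⊔ z) ≤ pre μ (pre ν x ⊔ pre ξ y ⊔ z)) (h : InitRel Eq s t) :
    (pre μ (ev s) : Alg A X) ≤ pre μ (ev s ⊔ ev t) := by
  rw [← ev_append]
  refine pre_ev_mono mono (ev_mono fun a x hx => Tree.tr_append.2 (Or.inl hx)) (fun b x hx => ?_) μ
  rcases Tree.tr_append.1 hx with hx | hx
  · exact ⟨b, x, rfl, hx⟩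
  · obtain ⟨a, y, rfl, hy⟩ := h.2 b x hx
    exact ⟨b, y, rfl, hy⟩

theorem mono_FT (μ ν ξ : Act A) (x y z : Alg A .FT) (h : ν = ξ) :
    pre μ (pre ν x ⊔ z) ≤ pre μ (pre ν x ⊔ pre ξ y ⊔ z) := by
  subst h
  have h : (pre μ (pre ν x ⊔ pre ν y ⊔ z) : Alg A .FT) =
      pre μ (pre ν x ⊔ pre ν y ⊔ z) ⊔ pre μ (pre ν x ⊔ z) :=
    eval_eq (axRS_subset_FT ⟨μ, ν, rfl⟩) (valuation [x, y, z])
  exact sup_eq_left.1 h.symm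

theorem pre_sup_le_of_FT (μ : Act A) (x y : Alg A .FT) : pre μ (x ⊔ y) ≤ pre μ x ⊔ pre μ y := by
  have h : (pre μ x ⊔ pre μ y : Alg A .FT) = pre μ x ⊔ pre μ y ⊔ pre μ (x ⊔ y) :=
    eval_eq (axFT_subset_FT ⟨μ, rfl⟩) (valuation [x, y])
  exact sup_eq_left.1 h.symm

/-- In `choice`, FT gives one inequality and RS, through monotonicity of prefixing for equal
initials, the other. -/
theorem linearLaws_FT : LinearLaws A .FT Eq where
  eqOrTrue := Or.inl rfl
  choice μ s t h := le_antisymm (pre_sup_le_of_FT ..) (sup_le (pre_ev_le_pre_sup mono_FT h)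
    (by rw [sup_comm]; exact pre_ev_le_pre_sup mono_FT h.symm))
  split := split_of_axFP axFP_subset_FT
  expand _ _ := expands_of_axEL2 axEL2_subset_FT

theorem eq_of_axR (h : axR A ⊆ axiomSystem A X) (μ ν : Act A) (x y z w : Alg A X) :
    pre μ (pre ν x ⊔ z) ⊔ pre μ (pre ν y ⊔ w) =
      pre μ (pre ν x ⊔ pre ν y ⊔ z) ⊔ pre μ (pre ν y ⊔ w) :=
  eval_eq (h ⟨μ, ν, rfl⟩) (valuation [x, y, z, w])

theorem mono_of_axR (h : axR A ⊆ axiomSystem A X) (μ ν ξ : Act A) (x y z : Alg A X)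
    (hν : ν = ξ) : pre μ (pre ν x ⊔ z) ≤ pre μ (pre ν x ⊔ pre ξ y ⊔ z) := by
  subst hν
  -- With `w := ν.x + z`, both summands on the right of R become `μ(ν.x + ν.y + z)`, so the first
  -- summand on the left lies below it.
  have := eq_of_axR h μ ν x y z (pre ν x ⊔ z)
  rw [← sup_assoc, sup_comm (pre ν y) (pre ν x), sup_idem] at this
  rw [← this]
  exact le_sup_left

/-- A branch of a `μ`-derivative may be added to another `μ`-derivative that has its label. -/
theorem pre_sup_pre_le_of_axR (h : axR A ⊆ axiomSystem A X) {μ ν : Act A} {x y z w m : Alg A X}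
    (hx : pre ν x ≤ z) (hy : pre ν y ≤ w) (hz : pre μ z ≤ m) (hw : pre μ w ≤ m) :
    pre μ (z ⊔ pre ν y) ≤ m := by
  have := eq_of_axR h μ ν x y z w
  rw [sup_eq_right.2 hx, sup_eq_right.2 hy, sup_right_comm, sup_eq_right.2 hx] at this
  exact le_sup_left.trans (this.symm.le.trans (sup_le hz hw))

theorem linearLaws_of_axR (h : axR A ⊆ axiomSystem A X) (h' : axFP A ⊆ axiomSystem A X)
    (h'' : axEL2 A ⊆ axiomSystem A X) : LinearLaws A X Eq where
  eqOrTrue := Or.inl rfl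
  choice μ s t hst := by
    refine le_antisymm (pre_sup_ev_le le_sup_left fun ν r hr z hz hm => ?_)
      (sup_le (pre_ev_le_pre_sup (mono_of_axR h) hst)
      (by rw [sup_comm]; exact pre_ev_le_pre_sup (mono_of_axR h) hst.symm))
    obtain ⟨_, x, rfl, hx⟩ := hst.2 ν r hr
    exact pre_sup_pre_le_of_axR h ((pre_le_ev hx).trans hz) (pre_le_ev hr) hm le_sup_right
  split := split_of_axFP h'
  expand _ _ := expands_of_axEL2 h''

theorem linearLaws_R : LinearLaws A .R Eq :=
  linearLaws_of_axR axR_subset_R axFP_subset_R axEL2_subset_R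

theorem linearLaws_F : LinearLaws A .F Eq :=
  linearLaws_of_axR axR_subset_F axFP_subset_F axEL2_subset_F

/-- The axiom RT for sums given only by their upper bounds. The derivatives are functions of the
label, so repetitions in `ν` repeat summands and do no harm. -/
theorem pre_sup_of_axRT (μ : Act A) (ν : Fin (Nat.card (Act A)) → Act A) (x y : Act A → Alg A .RT)
    (z : Alg A .RT) {a b : Alg A .RT} (ha : ∀ m, a ≤ m ↔ ∀ i, pre (ν i) (x (ν i)) ≤ m)
    (hb : ∀ m, b ≤ m ↔ ∀ i, pre (ν i) (y (ν i)) ≤ m) :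
    pre μ (a ⊔ b ⊔ z) = pre μ (a ⊔ z) ⊔ pre μ (b ⊔ z) := by
  let f : (Act A → Alg A .RT) → ℕ → Alg A .RT := fun x k =>
    if h : k < Nat.card (Act A) then x (ν ⟨k, h⟩) else ⊥
  -- Variable `0` is `z`, the odd variable `2 i + 1` is `xᵢ` and the even variable `2 i + 2` is
  -- `yᵢ`.
  let ρ : ℕ → Alg A .RT := fun k => if k = 0 then z else
    if k % 2 = 1 then f x (k / 2) else f y (k / 2 - 1)
  have hx : ∀ i : Fin (Nat.card (Act A)), ρ (2 * i + 1) = x (ν i) := by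
    intro i
    have h₁ : (2 * (i : ℕ) + 1) % 2 = 1 := by omega
    have h₂ : (2 * (i : ℕ) + 1) / 2 = i := by omega
    simp [ρ, h₁, h₂, f]
  have hy : ∀ i : Fin (Nat.card (Act A)), ρ (2 * i + 2) = y (ν i) := by
    intro i
    have h₁ : (2 * (i : ℕ) + 2) % 2 = 0 := by omega
    have h₂ : (2 * (i : ℕ) + 2) / 2 - 1 = i := by omega
    simp [ρ, h₁, f]
  have key := eval_eq (X := .RT) (axRT_subset_RT ⟨μ, ν, rfl⟩) ρ
  simp only [eval_add] at key
  simp only [eval] at key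
  have h₁ : eval ρ (Term.finSum fun i => .pre (ν i) (.var (2 * i + 1))) = a :=
    eq_of_forall_ge_iff fun m => by simp only [eval_finSum_le_iff, eval, hx, ha]
  have h₂ : eval ρ (Term.finSum fun i => .pre (ν i) (.var (2 * i + 2))) = b :=
    eq_of_forall_ge_iff fun m => by simp only [eval_finSum_le_iff, eval, hy, hb]
  have h₃ : eval ρ (Term.finSum fun i => .pre (ν i) (.var (2 * i + 1)) +
      .pre (ν i) (.var (2 * i + 2))) = a ⊔ b :=
    eq_of_forall_ge_iff fun m => by
      simp only [eval_finSum_le_iff, eval_add, sup_le_iff, ha, hb, forall_and]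
      simp only [eval, hx, hy]
  rw [h₁, h₂, h₃] at key
  exact key

theorem tr_unique_of_simple {s : Tree A} (h : Simple Eq s) {a : Act A} {x y : Tree A}
    (hx : s.tr a x) (hy : s.tr a y) : x = y := by
  obtain ⟨i, hi⟩ := List.mem_iff_get.1 hx
  obtain ⟨j, hj⟩ := List.mem_iff_get.1 hy
  obtain rfl : i = j := injective_of_simple h (by simp only [hi, hj])
  exact congrArg Prod.snd (hi.symm.trans hj)

/-- With distinct labels the derivative is a function of the label, so the tree is a sum over any
enumeration of its initials, with or without repetitions. -/
theorem exists_ev_le_iff_of_simple {s : Tree A} (h : Simple Eq s) {ι : Type*} {ν : ι → Act A}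
    (hν : ∀ a, (∃ t, s.tr a t) ↔ ∃ i, ν i = a) : ∃ x : Act A → Alg A X,
      ∀ m, ev s ≤ m ↔ ∀ i, pre (ν i) (x (ν i)) ≤ m := by
  classical
  refine ⟨fun a => if h : ∃ t, s.tr a t then ev h.choose else ⊥, fun m => ?_⟩
  rw [ev_le_iff]
  constructor
  · intro hm i
    have hi : ∃ t, s.tr (ν i) t := (hν _).2 ⟨i, rfl⟩
    simp only [dif_pos hi]
    exact hm _ _ hi.choose_spec
  · intro hm a t ht
    have ha : ∃ t, s.tr a t := ⟨t, ht⟩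
    obtain ⟨i, rfl⟩ := (hν a).1 ha
    have := hm i
    simp only [dif_pos ha] at this
    rwa [tr_unique_of_simple h ha.choose_spec ht] at this

theorem choice_of_simple [Finite A] (μ : Act A) {s t : Tree A} (hs : Simple Eq s)
    (ht : Simple Eq t) (h : InitRel Eq s t) :
    pre μ (ev s ⊔ ev t) = (pre μ (ev s) ⊔ pre μ (ev t) : Alg A .RT) := by
  classical
  have hinit : ∀ a, (∃ x, t.tr a x) ↔ ∃ x, s.tr a x := by
    intro a
    constructor
    · rintro ⟨x, hx⟩
      obtain ⟨_, y, rfl, hy⟩ := h.2 a x hx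
      exact ⟨y, hy⟩
    · rintro ⟨x, hx⟩
      obtain ⟨_, y, rfl, hy⟩ := h.1 a x hx
      exact ⟨y, hy⟩
  by_cases h₀ : ∃ a x, s.tr a x
  · obtain ⟨a₀, h₀⟩ := h₀
    -- The axiom has as many summands as there are actions. Actions that are not initial are
    -- replaced by the initial action `a₀`, which gives an enumeration of the initials of exactly
    -- that length.
    let e := (Finite.equivFin (Act A)).symm
    have hν : ∀ a, (∃ x, s.tr a x) ↔
        ∃ i, (fun i => if ∃ x, s.tr (e i) x then e i else a₀) i = a := by
      intro a
      constructor
      · exact fun ha => ⟨e.symm a, by simp [ha]⟩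
      · rintro ⟨i, rfl⟩
        by_cases hi : ∃ x, s.tr (e i) x
        · simpa [hi] using hi
        · simpa [hi] using h₀
    obtain ⟨x, hx⟩ := exists_ev_le_iff_of_simple (X := .RT) hs hν
    obtain ⟨y, hy⟩ := exists_ev_le_iff_of_simple (X := .RT) ht fun a => (hinit a).trans (hν a)
    simpa only [sup_bot] using pre_sup_of_axRT μ _ x y ⊥ hx hy
  · have : (ev s : Alg A .RT) = ev t :=
      ev_congr fun a x => iff_of_false (fun h => h₀ ⟨a, x, h⟩)
        fun hx => h₀ ⟨a, (hinit a).1 ⟨x, hx⟩⟩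
    rw [this, sup_idem, sup_idem]

/-- Taking all labels in RT equal to `ν` gives the binary law `key`. It splits two branches with the
same label, with and without `ev t` added, and so reduces the claim to smaller trees with the same
initials. -/
theorem choice_step [Finite A] {μ ν : Act A} {x y w s t : Tree A}
    (hs : ∀ a r, s.tr a r ↔ (Tree.cons ν x (.cons ν y w)).tr a r) (h : InitRel Eq s t)
    (ih : ∀ s', s'.size < (Tree.cons ν x (.cons ν y w)).size → InitRel Eq s' t →
      pre μ (ev s' ⊔ ev t) = (pre μ (ev s') ⊔ pre μ (ev t) : Alg A .RT)) :
    pre μ (ev s ⊔ ev t) = (pre μ (ev s) ⊔ pre μ (ev t) : Alg A .RT) := by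
  have key : ∀ z : Alg A .RT, pre μ (pre ν (ev x) ⊔ pre ν (ev y) ⊔ z) =
      pre μ (pre ν (ev x) ⊔ z) ⊔ pre μ (pre ν (ev y) ⊔ z) := by
    intro z
    have : Nonempty (Fin (Nat.card (Act A))) := ⟨Finite.equivFin _ .tau⟩
    exact pre_sup_of_axRT μ (fun _ => ν) (fun _ => ev x) (fun _ => ev y) z (fun m => by simp)
      (fun m => by simp)
  have hst : InitRel Eq (.cons ν x (.cons ν y w)) t := (InitRel.of_tr_iff hs).symm.trans h
  have h₁ := ih (.cons ν x w) (by simp only [Tree.size]; omega)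
    ((initRel_cons_cons (Or.inl rfl) rfl x y w).trans hst)
  have h₂ := ih (.cons ν y w) (by simp only [Tree.size]; omega)
    ((initRel_cons_cons' (Or.inl rfl) rfl x y w).trans hst)
  rw [ev_congr hs]
  simp only [ev, ← sup_assoc] at h₁ h₂ ⊢
  rw [sup_assoc (_ ⊔ _), key, key, ← sup_assoc, ← sup_assoc, h₁, h₂,
    ← sup_sup_distrib_right]

theorem choice_RT [Finite A] (μ : Act A) (s t : Tree A) (h : InitRel Eq s t) :
    pre μ (ev s ⊔ ev t) = (pre μ (ev s) ⊔ pre μ (ev t) : Alg A .RT) := by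
  induction hn : s.size + t.size using Nat.strong_induction_on generalizing s t with
  | _ n ih =>
    subst hn
    by_cases hs : Simple Eq s
    · by_cases ht : Simple Eq t
      · exact choice_of_simple μ hs ht h
      · obtain ⟨ν, x, _, y, w, rfl, hsize, hw⟩ := exists_cons_cons_of_not_simple ht
        rw [sup_comm (ev s), sup_comm (pre μ (ev s))]
        exact choice_step hw h.symm fun s' hs' h' => ih _ (by omega) s' s h' rfl
    · obtain ⟨ν, x, _, y, w, rfl, hsize, hw⟩ := exists_cons_cons_of_not_simple hs
      exact choice_step hw h fun s' hs' h' => ih _ (by omega) s' t h' rfl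

theorem linearLaws_RT [Finite A] : LinearLaws A .RT Eq where
  eqOrTrue := Or.inl rfl
  choice := choice_RT
  split := split_of_axFP axFP_subset_RT
  expand _ _ := expands_of_axEL2 axEL2_subset_RT

theorem par_ev [Finite A] (X : Semantics) (s t : Tree A) :
    par (ev s) (ev t) = (ev (s.par t) : Alg A X) := by
  cases X
  exacts [simLaws_RS.par_ev s t, simLaws_CS.par_ev s t, simLaws_S.par_ev s t,
    linearLaws_RT.par_ev s t, linearLaws_FT.par_ev s t, linearLaws_R.par_ev s t,
    linearLaws_F.par_ev s t, linearLaws_CT.par_ev s t, linearLaws_T.par_ev s t]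

/-- Every closed term is provably equal to the tree of its transitions. -/
theorem mk_eq_ev [Finite A] {t : Term A} (ht : t.Closed) :
    (mk t : Alg A X) = ev (Tree.ofTerm t) := by
  induction t with
  | nil => rfl
  | var n => exact ht.elim
  | pre μ t ih =>
    change pre μ (mk t) = pre μ (ev (Tree.ofTerm t)) ⊔ ⊥
    rw [sup_bot, ih ht]
  | plus t u iht ihu =>
    change mk t ⊔ mk u = ev ((Tree.ofTerm t).append (Tree.ofTerm u))
    rw [ev_append, iht ht.1, ihu ht.2]
  | par t u iht ihu =>
    change par (mk t) (mk u) = ev ((Tree.ofTerm t).par (Tree.ofTerm u))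
    rw [← par_ev, iht ht.1, ihu ht.2]

end Alg

end CCS

/-! ## Ground-completeness -/

namespace CCS

universe u
variable {A : Type u}

namespace Alg

open LTS

variable {X : Semantics}

/-! ### Completeness for the simulation semantics -/

/-- A plain simulation may relate a deadlocked tree to a nonempty one, which rules out
`pre_ev_mono`; the axiom S makes prefixing monotone unconditionally. -/
theorem ev_le_of_simLE_S {s t : Tree A} (h : SimLE Tree.tr (fun _ _ => True) s t) :
    (ev s : Alg A .S) ≤ ev t := by
  induction s using Tree.tr_induction generalizing t with
  | _ s ih =>
    refine ev_le_iff.2 fun μ s' hs => ?_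
    obtain ⟨t', ht, h'⟩ := h.step hs
    have hle := ih μ s' hs h'
    refine le_trans ?_ (pre_le_ev ht)
    rw [← sup_eq_right.2 hle]
    exact pre_le_pre_sup_of_S ..

theorem ev_le_of_simLE {r : Act A → Act A → Prop} (L : SimLaws A X r)
    {C : Set (Act A) → Set (Act A) → Prop}
    (hC : ∀ Y Z, C Y Z → ∀ b ∈ Z, ∃ a ∈ Y, r a b) {s t : Tree A}
    (h : SimLE Tree.tr C s t) : (ev s : Alg A X) ≤ ev t := by
  induction s using Tree.tr_induction generalizing t with
  | _ s ih =>
    refine ev_le_iff.2 fun μ s' hs => ?_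
    obtain ⟨t', ht, h'⟩ := h.step hs
    refine (pre_ev_mono L.mono (ih μ s' hs h') (fun b x hx => ?_) μ).trans (pre_le_ev ht)
    obtain ⟨a, ⟨y, hy⟩, hr⟩ := hC _ _ h'.init_rel b ⟨x, hx⟩
    exact ⟨a, y, hr, hy⟩

/-! ### Completeness for the linear semantics -/

/-- The trees in a nonempty list may be summed up below a prefix. -/
theorem exists_sum_of_list {μ : Act A} {m : Alg A X} (C : Tree A → Prop)
    (hC : ∀ q q', C q → C q' → C (q.append q'))
    (hpre : ∀ q q', C q → C q' → pre μ (ev q ⊔ ev q') ≤ (pre μ (ev q) ⊔ pre μ (ev q') : Alg A X))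
    (l : List (Tree A)) (hl : l ≠ []) (h : ∀ q ∈ l, C q ∧ pre μ (ev q) ≤ m) :
    ∃ t, C t ∧ pre μ (ev t) ≤ m ∧ ∀ ν r, t.tr ν r ↔ ∃ q ∈ l, q.tr ν r := by
  induction l with
  | nil => exact absurd rfl hl
  | cons q l ih =>
    have hq := h q List.mem_cons_self
    by_cases hl' : l = []
    · subst hl'
      exact ⟨q, hq.1, hq.2, by simp⟩
    · obtain ⟨t, ht, hm, htr⟩ := ih hl' fun q hq => h q (List.mem_cons_of_mem _ hq)
      refine ⟨q.append t, hC _ _ hq.1 ht, ?_, fun ν r => by simp [htr]⟩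
      rw [ev_append]
      exact (hpre _ _ hq.1 ht).trans (sup_le hq.2 hm)

/-- Merges the `μ`-derivatives of `t` that satisfy `C` into one tree, provably below `t` after
prefixing. The merged tree can stand in for all these derivatives when matching a single branch of
`s`. -/
theorem exists_sum (C : Tree A → Prop) (t : Tree A) (μ : Act A)
    (hC : ∀ q q', C q → C q' → C (q.append q'))
    (hpre : ∀ q q', C q → C q' → pre μ (ev q ⊔ ev q') ≤ (pre μ (ev q) ⊔ pre μ (ev q') : Alg A X))
    (h : ∃ q, t.tr μ q ∧ C q) : ∃ t', C t' ∧ pre μ (ev t') ≤ (ev t : Alg A X) ∧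
      ∀ ν r, t'.tr ν r ↔ ∃ q, t.tr μ q ∧ C q ∧ q.tr ν r := by
  classical
  have hmem : ∀ q, q ∈ (t.branches.filter fun b => b.1 = μ ∧ C b.2).map Prod.snd ↔
      t.tr μ q ∧ C q := by
    intro q
    simp [Tree.tr]
  obtain ⟨q, hq⟩ := h
  obtain ⟨t', h₁, h₂, h₃⟩ := exists_sum_of_list (m := ev t) C hC hpre _
    (List.ne_nil_of_mem ((hmem q).2 hq)) fun q hq =>
      ⟨((hmem q).1 hq).2, pre_le_ev ((hmem q).1 hq).1⟩
  refine ⟨t', h₁, h₂, fun ν r => ?_⟩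
  simp only [h₃, hmem, and_assoc]

theorem ev_le_of_traces {s t : Tree A}
    (h : ∀ φ, Reach Tree.tr (fun _ => True) s φ → Reach Tree.tr (fun _ => True) t φ) :
    (ev s : Alg A .T) ≤ ev t := by
  induction s using Tree.tr_induction generalizing t with
  | _ s ih =>
    refine ev_le_iff.2 fun μ s' hs => ?_
    have h' : ∀ φ, Reach Tree.tr (fun _ => True) s' φ →
        ∃ q, t.tr μ q ∧ Reach Tree.tr (fun _ => True) q φ := fun φ hφ => h (μ :: φ) ⟨s', hs, hφ⟩
    obtain ⟨q₀, hq₀, -⟩ := h' [] trivial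
    obtain ⟨t', -, hle, htr⟩ := exists_sum (X := .T) (fun _ => True) t μ (fun _ _ _ _ => trivial)
      (fun _ _ _ _ => (pre_sup_of_T ..).le) ⟨q₀, hq₀, trivial⟩
    refine le_trans ?_ hle
    have hle' : (ev s' : Alg A .T) ≤ ev t' := by
      refine ih μ s' hs fun φ hφ => ?_
      obtain ⟨q, hq, hqφ⟩ := h' φ hφ
      cases φ with
      | nil => trivial
      | cons ν φ =>
        obtain ⟨r, hr, hrφ⟩ := hqφ
        exact ⟨r, (htr ν r).2 ⟨q, hq, trivial, hr⟩, hrφ⟩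
    rw [← sup_eq_right.2 hle', pre_sup_of_T]
    exact le_sup_left

theorem initRel_append {r : Act A → Act A → Prop} {q q' s : Tree A} (h : InitRel r q s)
    (h' : InitRel r q' s) : InitRel r (q.append q') s := by
  simp only [InitRel, Tree.tr_append] at *
  grind

theorem exists_completed_trace (s : Tree A) : ∃ φ, Reach Tree.tr (fun Y => Y = ∅) s φ := by
  induction s using Tree.tr_induction with
  | _ s ih =>
    by_cases h : init Tree.tr s = ∅
    · exact ⟨[], h⟩
    · obtain ⟨μ, s', hs⟩ := Set.nonempty_iff_ne_empty.2 h
      obtain ⟨φ, hφ⟩ := ih μ s' hs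
      exact ⟨μ :: φ, s', hs, hφ⟩

theorem initRel_true_iff {s t : Tree A} :
    InitRel (fun _ _ => True) s t ↔ (init Tree.tr s = ∅ ↔ init Tree.tr t = ∅) := by
  simp only [← Set.not_nonempty_iff_eq_empty, not_iff_not]
  constructor
  · intro h
    constructor
    · rintro ⟨a, x, hx⟩
      obtain ⟨b, y, -, hy⟩ := h.1 a x hx
      exact ⟨b, y, hy⟩
    · rintro ⟨a, x, hx⟩
      obtain ⟨b, y, -, hy⟩ := h.2 a x hx
      exact ⟨b, y, hy⟩
  · intro h
    constructor
    · intro a x hx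
      obtain ⟨b, y, hy⟩ := h.1 ⟨a, x, hx⟩
      exact ⟨b, y, trivial, hy⟩
    · intro a x hx
      obtain ⟨b, y, hy⟩ := h.2 ⟨a, x, hx⟩
      exact ⟨b, y, trivial, hy⟩

theorem initRel_eq_iff {s t : Tree A} : InitRel Eq s t ↔ init Tree.tr s = init Tree.tr t := by
  simp only [InitRel, exists_and_left, exists_eq_left', Set.ext_iff]
  constructor
  · intro h a
    exact ⟨fun ⟨x, hx⟩ => h.1 a x hx, fun ⟨x, hx⟩ => h.2 a x hx⟩
  · intro h
    exact ⟨fun a x hx => (h a).1 ⟨x, hx⟩, fun a x hx => (h a).2 ⟨x, hx⟩⟩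

theorem LinearLaws.pre_le_of_le {r : Act A → Act A → Prop} (L : LinearLaws A X r) {s t : Tree A}
    (h : InitRel r s t) (hle : (ev s : Alg A X) ≤ ev t) (μ : Act A) :
    (pre μ (ev s) : Alg A X) ≤ pre μ (ev t) := by
  rw [← sup_eq_right.2 hle, L.choice μ s t h]
  exact le_sup_left

/-- The derivatives merged are those that are deadlocked exactly when `s'` is. At least one exists,
since every finite tree has a completed trace. -/
theorem ev_le_of_completedTraces {s t : Tree A}
    (h : ∀ φ, Reach Tree.tr (fun Y => Y = ∅) s φ → Reach Tree.tr (fun Y => Y = ∅) t φ) :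
    (ev s : Alg A .CT) ≤ ev t := by
  induction s using Tree.tr_induction generalizing t with
  | _ s ih =>
    refine ev_le_iff.2 fun μ s' hs => ?_
    have h' : ∀ φ, Reach Tree.tr (fun Y => Y = ∅) s' φ → ∃ q, t.tr μ q ∧
        InitRel (fun _ _ => True) q s' ∧ Reach Tree.tr (fun Y => Y = ∅) q φ := by
      intro φ hφ
      obtain ⟨q, hq, hqφ⟩ := h (μ :: φ) ⟨s', hs, hφ⟩
      refine ⟨q, hq, initRel_true_iff.2 ?_, hqφ⟩
      cases φ with
      | nil => exact iff_of_true hqφ hφ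
      | cons ν φ =>
        obtain ⟨x, hx, -⟩ := hφ
        obtain ⟨y, hy, -⟩ := hqφ
        exact iff_of_false (Set.nonempty_iff_ne_empty.1 ⟨ν, y, hy⟩)
          (Set.nonempty_iff_ne_empty.1 ⟨ν, x, hx⟩)
    obtain ⟨φ₀, hφ₀⟩ := exists_completed_trace s'
    obtain ⟨q₀, hq₀, hC₀, -⟩ := h' φ₀ hφ₀
    obtain ⟨t', hC, hle, htr⟩ := exists_sum (X := .CT) (InitRel (fun _ _ => True) · s') t μ
      (fun _ _ => initRel_append) (fun q q' hq hq' => (linearLaws_CT.choice μ q q'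
        (initRel_true_iff.2 ((initRel_true_iff.1 hq).trans (initRel_true_iff.1 hq').symm))).le)
      ⟨q₀, hq₀, hC₀⟩
    refine le_trans (linearLaws_CT.pre_le_of_le hC.symm (ih μ s' hs fun φ hφ => ?_) μ) hle
    obtain ⟨q, hq, hqC, hqφ⟩ := h' φ hφ
    cases φ with
    | nil => exact (initRel_true_iff.1 hC).2 hφ
    | cons ν φ =>
      obtain ⟨r, hr, hrφ⟩ := hqφ
      exact ⟨r, (htr ν r).2 ⟨q, hq, hqC, hr⟩, hrφ⟩

/-- Only derivatives with the initials of `s'` are merged, so the sum has these initials too and the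
first decoration is preserved. -/
theorem ev_le_of_readyTraces [Finite A] {s t : Tree A}
    (h : ∀ Y φ, DTrace Tree.tr (fun I Y => I = Y) s Y φ → DTrace Tree.tr (fun I Y => I = Y) t Y φ) :
    (ev s : Alg A .RT) ≤ ev t := by
  induction s using Tree.tr_induction generalizing t with
  | _ s ih =>
    refine ev_le_iff.2 fun μ s' hs => ?_
    have h' : ∀ Y φ, DTrace Tree.tr (fun I Y => I = Y) s' Y φ → ∃ q, t.tr μ q ∧
        InitRel Eq q s' ∧ DTrace Tree.tr (fun I Y => I = Y) q Y φ := by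
      intro Y φ hφ
      obtain ⟨-, q, hq, hqφ⟩ := h (init Tree.tr s) ((μ, Y) :: φ) ⟨rfl, s', hs, hφ⟩
      exact ⟨q, hq, initRel_eq_iff.2 (hqφ.head.trans hφ.head.symm), hqφ⟩
    obtain ⟨q₀, hq₀, hC₀, -⟩ := h' (init Tree.tr s') [] rfl
    obtain ⟨t', hC, hle, htr⟩ := exists_sum (X := .RT) (InitRel Eq · s') t μ
      (fun _ _ => initRel_append) (fun q q' hq hq' => (linearLaws_RT.choice μ q q'
        (hq.trans hq'.symm)).le) ⟨q₀, hq₀, hC₀⟩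
    refine le_trans (linearLaws_RT.pre_le_of_le hC.symm (ih μ s' hs fun Y φ hφ => ?_) μ) hle
    obtain ⟨q, hq, hqC, hqφ⟩ := h' Y φ hφ
    have hY : init Tree.tr t' = Y := (initRel_eq_iff.1 hC).trans hφ.head
    cases φ with
    | nil => exact hY
    | cons b φ =>
      obtain ⟨-, r, hr, hrφ⟩ := hqφ
      exact ⟨hY, r, (htr _ r).2 ⟨q, hq, hqC, hr⟩, hrφ⟩

theorem inter_compl_eq_empty_iff {Y Z : Set (Act A)} : Y ∩ Zᶜ = ∅ ↔ Y ⊆ Z := by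
  rw [← Set.sdiff_eq, Set.sdiff_eq_empty]

theorem init_append (q q' : Tree A) :
    init Tree.tr (q.append q') = init Tree.tr q ∪ init Tree.tr q' :=
  init_union fun _ _ => Tree.tr_append

theorem ev_le_of_failureTraces {s t : Tree A}
    (h : ∀ Y φ, DTrace Tree.tr (fun I Y => I ∩ Y = ∅) s Y φ →
      DTrace Tree.tr (fun I Y => I ∩ Y = ∅) t Y φ) :
    (ev s : Alg A .FT) ≤ ev t := by
  induction s using Tree.tr_induction generalizing t with
  | _ s ih =>
    refine ev_le_iff.2 fun μ s' hs => ?_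
    have h' : ∀ Y φ, DTrace Tree.tr (fun I Y => I ∩ Y = ∅) s' Y φ → ∃ q, t.tr μ q ∧
        init Tree.tr q ⊆ init Tree.tr s' ∧
        DTrace Tree.tr (fun I Y => I ∩ Y = ∅) q (init Tree.tr s')ᶜ φ := by
      intro Y φ hφ
      -- The largest set that `s'` can refuse is observed after `μ`; this forces the initials of the
      -- matching derivative to be among those of `s'`.
      obtain ⟨-, q, hq, hqφ⟩ := h ∅ ((μ, (init Tree.tr s')ᶜ) :: φ)
        ⟨Set.inter_empty _, s', hs, hφ.decoration (Set.inter_compl_self _)⟩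
      exact ⟨q, hq, inter_compl_eq_empty_iff.1 hqφ.head, hqφ⟩
    obtain ⟨q₀, hq₀, hC₀, -⟩ := h' ∅ [] (Set.inter_empty _)
    obtain ⟨t', hC, hle, htr⟩ := exists_sum (X := .FT) (init Tree.tr · ⊆ init Tree.tr s') t μ
      (fun q q' hq hq' => by rw [init_append]; exact Set.union_subset hq hq')
      (fun q q' _ _ => pre_sup_le_of_FT ..) ⟨q₀, hq₀, hC₀⟩
    refine le_trans (pre_ev_mono mono_FT (ih μ s' hs fun Y φ hφ => ?_) (fun b x hx => ?_) μ) hle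
    · obtain ⟨q, hq, hqC, hqφ⟩ := h' Y φ hφ
      have hY : init Tree.tr t' ∩ Y = ∅ :=
        Set.subset_eq_empty (Set.inter_subset_inter_left Y hC) hφ.head
      cases φ with
      | nil => exact hY
      | cons b φ =>
        obtain ⟨-, r, hr, hrφ⟩ := hqφ
        exact ⟨hY, r, (htr _ r).2 ⟨q, hq, hqC, hr⟩, hrφ⟩
    · obtain ⟨y, hy⟩ := hC ⟨x, hx⟩
      exact ⟨b, y, rfl, hy⟩

/-- The sum of all branches with labels in `Z` of the `μ`-derivatives of `t`. -/
theorem exists_tree_of_derivatives (t : Tree A) (μ : Act A) (Z : Set (Act A)) :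
    ∃ t' : Tree A, ∀ ν r, t'.tr ν r ↔ ν ∈ Z ∧ ∃ q, t.tr μ q ∧ q.tr ν r := by
  classical
  refine ⟨.ofList (((t.branches.filter fun b => b.1 = μ).flatMap fun b => b.2.branches).filter
    fun b => b.1 ∈ Z), fun ν r => ?_⟩
  simp only [Tree.tr_ofList, List.mem_filter, List.mem_flatMap, decide_eq_true_eq, Prod.exists]
  simp only [Tree.tr]
  grind

/-- The common part of the completeness proofs for readies and failures. -/
theorem ev_le_of_axR (h : axR A ⊆ axiomSystem A X) {K : Set (Act A) → Set (Act A) → Prop}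
    {J : Set (Act A) → Set (Act A) → Prop}
    (hK : ∀ Z, ∃ Y, K Y Z ∧ ∀ I, K Y I → J I Z) (hJ : ∀ I Z, J I Z → I ⊆ Z)
    (hadd : ∀ (μ ν : Act A) (q : Tree A) (Z : Set (Act A)), J (init Tree.tr q) Z → ν ∈ Z →
      ∀ y z w m : Alg A X, ev q ≤ z → pre ν y ≤ w → pre μ z ≤ m → pre μ w ≤ m →
        pre μ (z ⊔ pre ν y) ≤ m) {s t : Tree A}
    (hst : ∀ Y φ, Reach Tree.tr (K Y) s φ → Reach Tree.tr (K Y) t φ) :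
    (ev s : Alg A X) ≤ ev t := by
  induction s using Tree.tr_induction generalizing t with
  | _ s ih =>
    refine ev_le_iff.2 fun μ s' hs => ?_
    have h' : ∀ Y φ, Reach Tree.tr (K Y) s' φ → ∃ q, t.tr μ q ∧ Reach Tree.tr (K Y) q φ :=
      fun Y φ hφ => hst Y (μ :: φ) ⟨s', hs, hφ⟩
    -- `Y₀` is an observation that pins down the initials: the ready set itself for readies, its
    -- complement as refusal set for failures.
    obtain ⟨Y₀, hY₀, hJ₀⟩ := hK (init Tree.tr s')
    obtain ⟨q₀, hq₀, hK₀⟩ := h' Y₀ [] hY₀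
    replace hJ₀ : J (init Tree.tr q₀) (init Tree.tr s') := hJ₀ _ hK₀
    obtain ⟨t', htr⟩ := exists_tree_of_derivatives t μ (init Tree.tr s')
    have hinit : init Tree.tr t' = init Tree.tr s' := by
      ext ν
      constructor
      · rintro ⟨r, hr⟩
        exact ((htr ν r).1 hr).1
      · rintro ⟨x, hx⟩
        -- Some observation is possible after `ν`, and it passes to `t`; so some `μ`-derivative of
        -- `t` offers `ν`.
        obtain ⟨Y, hY, -⟩ := hK (init Tree.tr x)
        obtain ⟨q, hq, r, hr, -⟩ := h' Y [ν] ⟨x, hx, hY⟩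
        exact ⟨r, (htr ν r).2 ⟨⟨x, hx⟩, q, hq, hr⟩⟩
    have hle : pre μ (ev t') ≤ (ev t : Alg A X) := by
      have hq₀t' : (ev q₀ : Alg A X) ≤ ev t' := ev_mono fun ν r hr =>
        (htr ν r).2 ⟨hJ _ _ hJ₀ ⟨r, hr⟩, q₀, hq₀, hr⟩
      -- The tree `t'` is built up from the derivative `q₀`, one branch at a time, staying below `ev
      -- t` under the prefix by `hadd`.
      rw [← sup_eq_right.2 hq₀t']
      refine pre_sup_ev_le (pre_le_ev hq₀) fun ν r hr z hz hm => ?_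
      obtain ⟨hν, q, hq, hqr⟩ := (htr ν r).1 hr
      exact hadd μ ν q₀ _ hJ₀ hν _ _ _ _ hz (pre_le_ev hqr) hm (pre_le_ev hq)
    refine le_trans (pre_ev_mono (mono_of_axR h) (ih μ s' hs fun Y φ hφ => ?_)
      (fun b x hx => ?_) μ) hle
    · cases φ with
      | nil => simpa only [Reach, hinit] using hφ
      | cons ν φ =>
        obtain ⟨q, hq, r, hr, hrφ⟩ := h' Y _ hφ
        obtain ⟨x, hx, -⟩ := hφ
        exact ⟨r, (htr ν r).2 ⟨⟨x, hx⟩, q, hq, hr⟩, hrφ⟩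
    · obtain ⟨y, hy⟩ : b ∈ init Tree.tr s' := hinit ▸ ⟨x, hx⟩
      exact ⟨b, y, rfl, hy⟩

theorem ev_le_of_readies {s t : Tree A}
    (h : ∀ Y φ, Reach Tree.tr (fun I => I = Y) s φ → Reach Tree.tr (fun I => I = Y) t φ) :
    (ev s : Alg A .R) ≤ ev t := by
  refine ev_le_of_axR (K := fun Y I => I = Y) (J := fun I Z => I = Z) axR_subset_R
    (fun Z => ⟨Z, rfl, fun _ => id⟩) (fun _ _ => Eq.subset) ?_ h
  -- For readies `q` has all the initials in question, so it has a `ν`-branch, as R requires.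
  rintro μ ν q _ rfl ⟨x, hx⟩ y z w m hz hw hm hm'
  exact pre_sup_pre_le_of_axR axR_subset_R ((pre_le_ev hx).trans hz) hw hm hm'

theorem axF_subset_F : axF A ⊆ axiomSystem A .F := fun _ h => by
  simp [axiomSystem, h]

theorem ev_le_of_failures {s t : Tree A}
    (h : ∀ Y φ, Reach Tree.tr (fun I => I ∩ Y = ∅) s φ → Reach Tree.tr (fun I => I ∩ Y = ∅) t φ) :
    (ev s : Alg A .F) ≤ ev t := by
  refine ev_le_of_axR (K := fun Y I => I ∩ Y = ∅) (J := fun I Z => I ⊆ Z) axR_subset_F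
    (fun Z => ⟨Zᶜ, Set.inter_compl_self Z, fun _ => inter_compl_eq_empty_iff.1⟩)
    (fun _ _ => id) ?_ h
  rintro μ ν q _ - - y z w m hz hw hm hm'
  -- The axiom F adds a branch of another `μ`-derivative even if its label is new to `z`.
  have key : (pre μ z ⊔ pre μ (pre ν y ⊔ w) : Alg A .F) =
      pre μ z ⊔ pre μ (z ⊔ pre ν y) ⊔ pre μ (pre ν y ⊔ w) :=
    eval_eq (axF_subset_F ⟨μ, rfl⟩) (valuation [z, pre ν y, w])
  rw [sup_eq_right.2 hw] at key
  exact (le_sup_right.trans le_sup_left).trans (key.symm.le.trans (sup_le hm hm'))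

theorem emptyIff_exists_mem {Y Z : Set (Act A)} (h : EmptyIff Y Z) : ∀ b ∈ Z, ∃ a ∈ Y, True := by
  intro b hb
  obtain ⟨a, ha⟩ := Set.nonempty_iff_ne_empty.2
    (mt h.1 (Set.nonempty_iff_ne_empty.1 ⟨b, hb⟩))
  exact ⟨a, ha, trivial⟩

/-- Equivalent trees have the same value. -/
theorem ev_eq_of_equiv [Finite A] {s t : Tree A} (h : X.Equiv Tree.tr s t) :
    (ev s : Alg A X) = ev t := by
  rw [Semantics.equiv_iff] at h
  cases X
  · have hC : ∀ Y Z : Set (Act A), Y = Z → ∀ b ∈ Z, ∃ a ∈ Y, a = b :=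
      fun Y Z e b hb => ⟨b, e ▸ hb, rfl⟩
    exact le_antisymm (ev_le_of_simLE simLaws_RS hC h.1) (ev_le_of_simLE simLaws_RS hC h.2)
  · exact le_antisymm (ev_le_of_simLE simLaws_CS (fun _ _ => emptyIff_exists_mem) h.1)
      (ev_le_of_simLE simLaws_CS (fun _ _ => emptyIff_exists_mem) h.2)
  · exact le_antisymm (ev_le_of_simLE_S h.1) (ev_le_of_simLE_S h.2)
  · exact le_antisymm (ev_le_of_readyTraces fun Y φ => (h Y φ).1)
      (ev_le_of_readyTraces fun Y φ => (h Y φ).2)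
  · exact le_antisymm (ev_le_of_failureTraces fun Y φ => (h Y φ).1)
      (ev_le_of_failureTraces fun Y φ => (h Y φ).2)
  · exact le_antisymm (ev_le_of_readies fun Y φ => (h Y φ).1)
      (ev_le_of_readies fun Y φ => (h Y φ).2)
  · exact le_antisymm (ev_le_of_failures fun Y φ => (h Y φ).1)
      (ev_le_of_failures fun Y φ => (h Y φ).2)
  · exact le_antisymm (ev_le_of_completedTraces fun φ => (h.2 φ).1)
      (ev_le_of_completedTraces fun φ => (h.2 φ).2)
  · exact le_antisymm (ev_le_of_traces fun φ => (h φ).1) (ev_le_of_traces fun φ => (h φ).2)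

end Alg

theorem groundComplete_axiomSystem [Finite A] (X : Semantics) :
    GroundComplete (axiomSystem A X) (X.Equiv Proc.tr) := by
  intro p q h
  rw [← Alg.mk_eq_mk, Alg.mk_eq_ev p.2, Alg.mk_eq_ev q.2]
  exact Alg.ev_eq_of_equiv ((Tree.isFunctionalBisim_ofProc.equiv_iff X).2 h)

end CCS

theorem mainTheorem7 {A : Type*} [Finite A] (X : Semantics) :
    (CCS.axiomSystem A X).Finite ∧
      CCS.Sound (CCS.axiomSystem A X) (X.Equiv CCS.Proc.tr) ∧
      CCS.GroundComplete (CCS.axiomSystem A X) (X.Equiv CCS.Proc.tr) :=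
  ⟨CCS.finite_axiomSystem X, CCS.sound_axiomSystem X, CCS.groundComplete_axiomSystem X⟩
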